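/- On $\mathbf{SU}(2)$ let $X,Y$ be the left-invariant vector fields given by $X=\begin{pmatrix}0&1\\-1&0\end{pmatrix}$, $Y=\begin{pmatrix}0&i\\i&0\end{pmatrix}$, let $Z=\begin{pmatrix}i&0\\0&-i\end{pmatrix}$, and put $\mathcal L=X^2+Y^2$. Use the cylindric coordinates $(r,\theta,z)\mapsto\exp(r\cos\theta\,X+r\sin\theta\,Y)\exp(zZ)$. Let $\nu$ be a Haar measure on $\mathbf{SU}(2)$ of total mass $V$, and let $p_t$ $(t>0)$ be the heat kernel of $e^{t\mathcal L}$ issued from the identity, with respect to $\nu$: $p$ is real, smooth on $(0,\infty)\times\mathbf{SU}(2)$, $\partial_t p_t=\mathcal L p_t$, and $\int p_t f\,d\nu\to f(1)$ as $t\to0^+$ for every smooth $f$. (Thus $V=1$ for the normalized Haar measure, and $V=2\pi^2$ for the Riemannian volume of the round unit sphere $\mathbf{SU}(2)\simeq\mathbb S^3$, in which case the factor $2\pi^2/V$ below is $1$.) Let $r\in[0,\pi/2)$, $\theta\in\mathbb R$, $z\in[-\pi,\pi]$, and write $p_t(r,z)$ for the value of $p_t$ at the point with coordinates $(r,\theta,z)$;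 the formulas show that it does not depend on $\theta$. Square roots are principal. Then the following hold. 1. For $\lambda\in\mathbb C$ with $\operatorname{Re}\lambda>0$, the denominator below does not vanish for any $y\in\mathbb R$, both integrals converge absolutely, and $$\int_0^{\infty}p_t(r,z)\,e^{-t-\lambda/t}\,dt=\frac{2\pi^2}{V}\int_{-\infty}^{\infty}\frac{dy}{8\pi^2\left(\cosh\sqrt{y^2+4\lambda}-\cos r\cos(z+iy)\right)}.$$ 2. For every $t>0$ and every $\gamma>0$, $$p_t(r,z)=\frac{2\pi^2}{V}\cdot\frac{e^t}{16\,i\,\pi^3t^2}\int_{\gamma-i\infty}^{\gamma+i\infty}\left(\int_{-\infty}^{\infty}\frac{e^{\lambda/t}}{\cosh\sqrt{y^2+4\lambda}-\cos r\cos(z+iy)}\,dy\right)d\lambda,$$ where the outer integral converges absolutely. 3. The operator $-\mathcal L+1$ has a Green function with respect to $\nu$ with pole at the identity, that is, a real function $G\in L^1(\nu)$, continuous off the identity, with $\int G\,(-\mathcal L f+f)\,d\nu=f(1)$ for every smooth $f$. Every such $G$ satisfies, whenever $(r,z)\neq(0,0)$, $$G(r,z)=\int_0^\infty e^{-t}p_t(r,z)\,dt=\frac{2\pi^2}{V}\cdot\frac{1}{8\pi\sqrt{1-2\cos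 r\cos z+\cos^2 r}},$$ where the integral in $t$ converges absolutely. -/

import Mathlib

open MeasureTheory Filter Topology Set
open scoped ContDiff

noncomputable section

/-- The compact group `SU(2)`, with the topology induced from the complex `2 × 2` matrices. -/
abbrev SU2 : Type := Matrix.specialUnitaryGroup (Fin 2) ℂ

instance SU2.instMeasurableSpace : MeasurableSpace SU2 := borel SU2

instance SU2.instBorelSpace : BorelSpace SU2 := ⟨rfl⟩

/-- The matrix with rows `(a, b)` and `(-b̄, ā)`. -/
def su2Matrix (a b : ℂ) : Matrix (Fin 2) (Fin 2) ℂ :=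
  !![a, b; -(starRingEnd ℂ) b, (starRingEnd ℂ) a]

theorem su2Matrix_mem {a b : ℂ} (h : Complex.normSq a + Complex.normSq b = 1) :
    su2Matrix a b ∈ Matrix.specialUnitaryGroup (Fin 2) ℂ := by
  have h' : a * (starRingEnd ℂ) a + b * (starRingEnd ℂ) b = 1 := by
    rw [Complex.mul_conj, Complex.mul_conj, ← Complex.ofReal_add, h, Complex.ofReal_one]
  rw [Matrix.mem_specialUnitaryGroup_iff, Matrix.mem_unitaryGroup_iff]
  constructor
  · ext i j
    fin_cases i <;> fin_cases j <;>
      simp [su2Matrix, Matrix.mul_apply, Fin.sum_univ_two, Matrix.star_apply] <;>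
      first | ring1 | linear_combination h'
  · simp [su2Matrix, Matrix.det_fin_two]
    linear_combination h'

/-- The Lie algebra elements `X`, `Y`, `Z`. -/
def lieX : Matrix (Fin 2) (Fin 2) ℂ := !![0, 1; -1, 0]

def lieY : Matrix (Fin 2) (Fin 2) ℂ := !![0, Complex.I; Complex.I, 0]

def lieZ : Matrix (Fin 2) (Fin 2) ℂ := !![Complex.I, 0; 0, -Complex.I]

/-- The element `exp (r cos θ X + r sin θ Y)` of `SU(2)`. -/
def horizontalExp (r θ : ℝ) : SU2 :=
  ⟨su2Matrix (Real.cos r) (Real.sin r * Complex.exp (θ * Complex.I)), su2Matrix_mem (by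
    have h1 : Complex.normSq (Complex.exp (θ * Complex.I)) = 1 := by
      rw [Complex.normSq_eq_norm_sq, Complex.norm_exp_ofReal_mul_I, one_pow]
    rw [Complex.normSq_mul, h1, Complex.normSq_ofReal, Complex.normSq_ofReal, mul_one]
    nlinarith [Real.sin_sq_add_cos_sq r])⟩

/-- The element `exp (z Z)` of `SU(2)`. -/
def verticalExp (z : ℝ) : SU2 :=
  ⟨su2Matrix (Complex.exp (z * Complex.I)) 0, su2Matrix_mem (by
    rw [Complex.normSq_eq_norm_sq, Complex.norm_exp_ofReal_mul_I]; simp)⟩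

theorem exp_smul_of_sq_eq_neg_one {A : Matrix (Fin 2) (Fin 2) ℂ} (hA : A * A = -1) (s : ℝ) :
    NormedSpace.exp (s • A) = Real.cos s • (1 : Matrix (Fin 2) (Fin 2) ℂ) + Real.sin s • A := by
  let _ : NormedRing (Matrix (Fin 2) (Fin 2) ℂ) := Matrix.linftyOpNormedRing
  let _ : NormedAlgebra ℝ (Matrix (Fin 2) (Fin 2) ℂ) := Matrix.linftyOpNormedAlgebra
  have hc : Continuous (Complex.liftAux A hA) :=
    (Complex.liftAux A hA).toLinearMap.continuous_of_finiteDimensional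
  have h := NormedSpace.map_exp (Complex.liftAux A hA) hc (s * Complex.I)
  rw [← Complex.exp_eq_exp_ℂ, Complex.exp_mul_I] at h
  simp [Complex.liftAux_apply, Algebra.algebraMap_eq_smul_one, Complex.cos_ofReal_re,
    Complex.sin_ofReal_re] at h
  exact h.symm

theorem coe_horizontalExp (r θ : ℝ) : (horizontalExp r θ : Matrix (Fin 2) (Fin 2) ℂ) =
    NormedSpace.exp ((r * Real.cos θ) • lieX + (r * Real.sin θ) • lieY) := by
  have hA : (Real.cos θ • lieX + Real.sin θ • lieY) * (Real.cos θ • lieX + Real.sin θ • lieY)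
      = -1 := by
    have h : (Complex.cos θ) ^ 2 + (Complex.sin θ) ^ 2 = 1 := Complex.cos_sq_add_sin_sq _
    ext i j
    fin_cases i <;> fin_cases j <;>
      simp [lieX, lieY, Matrix.mul_apply, Fin.sum_univ_two] <;>
      linear_combination (-h) + Complex.sin θ ^ 2 * Complex.I_sq
  have h : (r * Real.cos θ) • lieX + (r * Real.sin θ) • lieY =
      r • (Real.cos θ • lieX + Real.sin θ • lieY) := by
    rw [smul_add, smul_smul, smul_smul]
  rw [h, exp_smul_of_sq_eq_neg_one hA]
  ext i j
  fin_cases i <;> fin_cases j <;>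
    simp [horizontalExp, su2Matrix, lieX, lieY, Complex.exp_mul_I, ← Complex.cos_conj,
      ← Complex.sin_conj] <;> ring

theorem coe_verticalExp (z : ℝ) : (verticalExp z : Matrix (Fin 2) (Fin 2) ℂ) =
    NormedSpace.exp (z • lieZ) := by
  have hA : lieZ * lieZ = -1 := by
    ext i j
    fin_cases i <;> fin_cases j <;> simp [lieZ, Matrix.mul_apply, Fin.sum_univ_two]
  rw [exp_smul_of_sq_eq_neg_one hA]
  ext i j
  fin_cases i <;> fin_cases j <;>
    simp [verticalExp, su2Matrix, lieZ, Complex.exp_mul_I, ← Complex.cos_conj,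
      ← Complex.sin_conj]

/-- The point of `SU(2)` with cylindric coordinates `(r, θ, z)`, namely
`exp (r cos θ X + r sin θ Y) exp (z Z)`. -/
def cylPoint (r θ z : ℝ) : SU2 := horizontalExp r θ * verticalExp z

/-- The left-invariant vector field `X`: differentiation along `s ↦ g exp (s X)`. -/
def fieldX (f : SU2 → ℝ) (g : SU2) : ℝ := deriv (fun s : ℝ => f (g * horizontalExp s 0)) 0

/-- The left-invariant vector field `Y`: differentiation along `s ↦ g exp (s Y)`. -/
def fieldY (f : SU2 → ℝ) (g : SU2) : ℝ :=
  deriv (fun s : ℝ => f (g * horizontalExp s (Real.pi / 2))) 0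

/-- The operator `L = X² + Y²`. -/
def subLaplacian (f : SU2 → ℝ) (g : SU2) : ℝ := fieldX (fieldX f) g + fieldY (fieldY f) g

/-- The entries of an element of `SU(2)`, giving its closed embedding in `ℂ⁴ = ℝ⁸`. -/
def su2Entries (g : SU2) : Fin 2 → Fin 2 → ℂ := fun i j => (g : Matrix (Fin 2) (Fin 2) ℂ) i j

/-- Smooth functions on the compact submanifold `SU(2)` of the space of matrices: the restrictions
of the smooth functions on that space. -/
def IsSmoothSU2 (f : SU2 → ℝ) : Prop :=
  ∃ F : (Fin 2 → Fin 2 → ℂ) → ℝ, ContDiff ℝ ∞ F ∧ ∀ g, f g = F (su2Entries g)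

/-- `p` is the heat kernel, issued from the identity, of the semigroup generated by `L`, with
respect to the measure `ν`: it is smooth on `(0, ∞) × SU(2)`, solves the heat equation
`∂ₜ p = L p`, and `p t · ν` tends to the Dirac mass at the identity as `t → 0⁺`.
The values `p t` for `t ≤ 0` play no role. -/
structure IsSubellipticHeatKernel (ν : Measure SU2) (p : ℝ → SU2 → ℝ) : Prop where
  smooth : ∃ F : ℝ × (Fin 2 → Fin 2 → ℂ) → ℝ, ContDiffOn ℝ ∞ F (Ioi 0 ×ˢ univ) ∧
    ∀ t > 0, ∀ g, p t g = F (t, su2Entries g)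
  heat_eq : ∀ t > 0, ∀ g, HasDerivAt (fun s => p s g) (subLaplacian (p t) g) t
  initial : ∀ f : SU2 → ℝ, IsSmoothSU2 f →
    Tendsto (fun t => ∫ g, p t g * f g ∂ν) (𝓝[>] 0) (𝓝 (f 1))

/-- `G` is the Green function, with pole at the identity, of `-L + 1` with respect to the measure
`ν`: it is continuous off the pole, integrable, and `(-L + 1) G = δ₁` in the sense of
distributions (`L` is symmetric with respect to Haar measure). -/
structure IsGreenFunction (ν : Measure SU2) (G : SU2 → ℝ) : Prop where
  continuousOn : ContinuousOn G {1}ᶜ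
  integrable : Integrable G ν
  fundamental : ∀ f : SU2 → ℝ, IsSmoothSU2 f →
    ∫ g, G g * (-subLaplacian f g + f g) ∂ν = f 1

/-- The denominator `cosh √(y² + 4λ) - cos r cos (z + iy)`, with the principal square root. -/
def laplaceDenom (r z : ℝ) (lam : ℂ) (y : ℝ) : ℂ :=
  Complex.cosh (Complex.sqrt ((y : ℂ) ^ 2 + 4 * lam))
    - Real.cos r * Complex.cos (z + y * Complex.I)

end

/-! Let `(a, b)` be the first row of an element of SU(2), so |a|² + |b|² = 1. On the monomials aⁱ āʲ
bᵏ the operator L is triangular (`subLaplacian_monomial`): it multiplies by -(2(i+j+k) + 4ij + 4ik)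
and adds a multiple of aⁱ⁻¹ āʲ⁻¹ bᵏ. L is symmetric for Haar measure, so the moments of p_t against
these monomials solve a triangular linear system in t, with initial values read off at the identity.
This determines them, and they agree with the moments of V⁻¹ ∑ₘ (m+1) e^{-m(m+2)t} ∑_{α+β=m}
e^{(β-α)²t} R_{αβ}(a), where R_{αβ} are the disk polynomials. Stone-Weierstrass then identifies p_t
with this series (`eq_heatSeries`), which depends on a alone and hence not on θ.

The factors e^{(β-α)²t} are Gaussian averages of e^{(β-α)y}. Under the average the inner sum becomes
the Chebyshev polynomial U_m at X = (a e^{-y} + ā e^{y})/2 = cos r cos(z+iy). With the weight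
e^{-t-λ/t}, the exponents combine to -(m+1)²t - (y²+4λ)/(4t); the subordination integral
(`integral_subKernel`) turns this into e^{-(m+1)w}/(2(m+1)) with w = √(y²+4λ), and the generating
function of the U_m sums the result to 1/(4(cosh w - X)). Convergence and the nonvanishing of the
denominator come from ellipses with foci ±1: X lies inside the ellipse of parameter |y|, cosh w lies
on that of parameter Re w, and Re w > |y| (`cosh_sub_cosh_le_norm`, `abs_lt_re_sqrt`).

The contour formula is Fourier inversion after the substitution s = 1/t. For the Green function one
lets λ → 0 in the Laplace transform. Positivity of p_t, proved by a minimum principle, justifies the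
limit, and the limiting integral has an arctangent primitive. The time integral of e^{-t} p_t is a
Green function, and any two of them have equal moments, hence agree off the pole. -/

noncomputable section

/-! ### The group `SU(2)`: topology, coordinates and Haar measure -/

namespace SU2

/-- The first entry of an element of `SU(2)`. -/
def fst (g : SU2) : ℂ := su2Entries g 0 0

/-- The second entry of an element of `SU(2)`. -/
def snd (g : SU2) : ℂ := su2Entries g 0 1

theorem normSq_fst_add_snd (g : SU2) :
    fst g * (starRingEnd ℂ) (fst g) + snd g * (starRingEnd ℂ) (snd g) = 1 := by
  have h := (Matrix.mem_unitaryGroup_iff.1 (Matrix.mem_specialUnitaryGroup_iff.1 g.2).1)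
  have := congrFun (congrFun h 0) 0
  simpa [Matrix.mul_apply, Fin.sum_univ_two, Matrix.star_apply, fst, snd, su2Entries] using this

theorem entries_one (g : SU2) :
    su2Entries g 1 0 = -(starRingEnd ℂ) (snd g) ∧ su2Entries g 1 1 = (starRingEnd ℂ) (fst g) := by
  have h := (Matrix.mem_unitaryGroup_iff.1 (Matrix.mem_specialUnitaryGroup_iff.1 g.2).1)
  have hd := (Matrix.mem_specialUnitaryGroup_iff.1 g.2).2
  have h00 := congrFun (congrFun h 0) 0
  have h10 := congrFun (congrFun h 1) 0
  rw [Matrix.det_fin_two] at hd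
  simp [Matrix.mul_apply, Fin.sum_univ_two, Matrix.star_apply] at h00 h10
  simp only [fst, snd, su2Entries]
  constructor
  -- The second row is orthogonal to the first, which has norm one, and the determinant is one;
  -- Cramer's rule solves for it.
  · linear_combination (-(starRingEnd ℂ) (g.1 0 1)) * hd - (g.1 1 0) * h00 + (g.1 0 0) * h10
  · linear_combination ((starRingEnd ℂ) (g.1 0 0)) * hd - (g.1 1 1) * h00 + (g.1 0 1) * h10

theorem coe_eq (g : SU2) : (g : Matrix (Fin 2) (Fin 2) ℂ) = su2Matrix (fst g) (snd g) := by
  ext i j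
  have h := entries_one g
  fin_cases i <;> fin_cases j
  · rfl
  · rfl
  · exact h.1
  · exact h.2

theorem ext_coord {g h : SU2} (h1 : fst g = fst h) (h2 : snd g = snd h) : g = h := by
  apply Subtype.ext
  rw [coe_eq, coe_eq h, h1, h2]

theorem fst_mul (g h : SU2) :
    fst (g * h) = fst g * fst h - snd g * (starRingEnd ℂ) (snd h) := by
  have : (↑(g * h) : Matrix (Fin 2) (Fin 2) ℂ) = g.1 * h.1 := rfl
  simp only [fst, su2Entries, this, Matrix.mul_apply, Fin.sum_univ_two]
  have := (entries_one h).1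
  simp only [su2Entries] at this
  rw [this]
  simp only [snd, su2Entries]
  ring

theorem snd_mul (g h : SU2) :
    snd (g * h) = fst g * snd h + snd g * (starRingEnd ℂ) (fst h) := by
  have : (↑(g * h) : Matrix (Fin 2) (Fin 2) ℂ) = g.1 * h.1 := rfl
  simp only [snd, su2Entries, this, Matrix.mul_apply, Fin.sum_univ_two]
  have := (entries_one h).2
  simp only [su2Entries] at this
  rw [this]
  simp only [fst, su2Entries]

@[simp] theorem fst_one : fst 1 = 1 := by simp [fst, su2Entries]
@[simp] theorem snd_one : snd 1 = 0 := by simp [snd, su2Entries]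

theorem fst_inv (g : SU2) : fst g⁻¹ = (starRingEnd ℂ) (fst g) := rfl

theorem snd_inv (g : SU2) : snd g⁻¹ = - snd g := by
  have h : snd g⁻¹ = (starRingEnd ℂ) (su2Entries g 1 0) := rfl
  rw [h, (entries_one g).1]; simp

/-- The element of `SU(2)` with prescribed first row. -/
def mk (a b : ℂ) (h : Complex.normSq a + Complex.normSq b = 1) : SU2 :=
  ⟨su2Matrix a b, su2Matrix_mem h⟩

theorem fst_horizontalExp (r θ : ℝ) : fst (horizontalExp r θ) = Real.cos r := by
  simp [fst, su2Entries, horizontalExp, su2Matrix]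
theorem snd_horizontalExp (r θ : ℝ) :
    snd (horizontalExp r θ) = Real.sin r * Complex.exp (θ * Complex.I) := rfl
theorem fst_verticalExp (z : ℝ) : fst (verticalExp z) = Complex.exp (z * Complex.I) := rfl
theorem snd_verticalExp (z : ℝ) : snd (verticalExp z) = 0 := rfl

theorem fst_cylPoint (r θ z : ℝ) :
    fst (cylPoint r θ z) = Real.cos r * Complex.exp (z * Complex.I) := by
  rw [cylPoint, fst_mul, fst_horizontalExp, fst_verticalExp, snd_verticalExp]; simp

theorem norm_fst_sq_add (g : SU2) : ‖fst g‖ ^ 2 + ‖snd g‖ ^ 2 = 1 := by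
  have := normSq_fst_add_snd g
  rw [Complex.mul_conj, Complex.mul_conj, Complex.normSq_eq_norm_sq, Complex.normSq_eq_norm_sq]
    at this
  exact_mod_cast this

theorem norm_fst_le (g : SU2) : ‖fst g‖ ≤ 1 := by
  nlinarith [norm_fst_sq_add g, norm_nonneg (fst g), sq_nonneg ‖snd g‖]

theorem fst_eq_one_iff (g : SU2) : fst g = 1 ↔ g = 1 := by
  refine ⟨fun h => ext_coord (by simp [h]) ?_, fun h => by simp [h]⟩
  have := norm_fst_sq_add g
  rw [h] at this
  simp at this
  simp [this]

theorem horizontalExp_add (s t θ : ℝ) :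
    horizontalExp (s + t) θ = horizontalExp s θ * horizontalExp t θ := by
  have h : Complex.exp (θ * Complex.I) * (starRingEnd ℂ) (Complex.exp (θ * Complex.I)) = 1 := by
    rw [Complex.mul_conj, Complex.normSq_eq_norm_sq, Complex.norm_exp_ofReal_mul_I]; simp
  apply ext_coord
  · rw [fst_mul]
    simp only [fst_horizontalExp, snd_horizontalExp, Real.cos_add, map_mul, Complex.conj_ofReal]
    push_cast
    linear_combination (Complex.sin s * Complex.sin t) * h
  · rw [snd_mul]
    simp only [fst_horizontalExp, snd_horizontalExp, Real.sin_add, Complex.conj_ofReal]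
    push_cast; ring

@[simp] theorem horizontalExp_zero (θ : ℝ) : horizontalExp 0 θ = 1 := by
  apply ext_coord <;> simp [fst_horizontalExp, snd_horizontalExp]

theorem continuous_su2Entries : Continuous su2Entries :=
  continuous_subtype_val

theorem isEmbedding_su2Entries : IsEmbedding su2Entries := IsEmbedding.subtypeVal

theorem continuous_fst : Continuous fst :=
  (continuous_apply_apply 0 0).comp continuous_su2Entries

theorem continuous_snd : Continuous snd :=
  (continuous_apply_apply 0 1).comp continuous_su2Entries

instance : SecondCountableTopology SU2 :=
  isEmbedding_su2Entries.secondCountableTopology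

instance : IsTopologicalGroup SU2 where
  continuous_mul := Continuous.subtype_mk
    ((continuous_subtype_val.comp _root_.continuous_fst).mul
      (continuous_subtype_val.comp _root_.continuous_snd)) _
  continuous_inv := Continuous.subtype_mk continuous_subtype_val.star _

/-- The group is the continuous image of the unit sphere of ℂ² under `mk`. -/
instance : CompactSpace SU2 := by
  have hc : IsCompact {x : ℂ × ℂ | Complex.normSq x.1 + Complex.normSq x.2 = 1} := by
    apply Metric.isCompact_of_isClosed_isBounded
    · exact isClosed_eq (by fun_prop) continuous_const
    · refine (Metric.isBounded_closedBall (x := (0 : ℂ × ℂ)) (r := 1)).subset ?_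
      rintro ⟨a, b⟩ h
      simp only [mem_ofPred_eq, Complex.normSq_eq_norm_sq] at h
      simp only [Metric.mem_closedBall, dist_zero_right, Prod.norm_mk, sup_le_iff]
      constructor <;> nlinarith [norm_nonneg a, norm_nonneg b, sq_nonneg ‖a‖, sq_nonneg ‖b‖]
  have : CompactSpace {x : ℂ × ℂ | Complex.normSq x.1 + Complex.normSq x.2 = 1} :=
    isCompact_iff_compactSpace.1 hc
  have hcont : Continuous (fun x : {x : ℂ × ℂ | Complex.normSq x.1 + Complex.normSq x.2 = 1} =>
      mk x.1.1 x.1.2 x.2) := by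
    refine Continuous.subtype_mk ?_ _
    refine continuous_matrix fun i j => ?_
    fin_cases i <;> fin_cases j <;> simp [su2Matrix] <;> fun_prop
  refine ⟨?_⟩
  have hs : Set.range (fun x : {x : ℂ × ℂ | Complex.normSq x.1 + Complex.normSq x.2 = 1} =>
      mk x.1.1 x.1.2 x.2) = univ := by
    refine eq_univ_of_forall fun g => ⟨⟨(fst g, snd g), ?_⟩, ?_⟩
    · simp only [mem_ofPred_eq, Complex.normSq_eq_norm_sq]; exact norm_fst_sq_add g
    · exact ext_coord rfl rfl
  rw [← hs]
  exact isCompact_range hcont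

end SU2

/-! ### Invariance of Haar measure on compact groups. -/

/-- A right translate of μ is again left invariant, hence a multiple of μ. The total mass is
unchanged, finite and nonzero, so the multiple is 1. -/
theorem MeasureTheory.Measure.IsHaarMeasure.isMulRightInvariant_of_compactSpace {G : Type*}
    [Group G] [TopologicalSpace G] [IsTopologicalGroup G] [CompactSpace G]
    [MeasurableSpace G] [BorelSpace G] (μ : Measure G) [μ.IsHaarMeasure] :
    μ.IsMulRightInvariant := by
  refine ⟨fun g => ?_⟩
  have : (Measure.map (· * g) μ).IsMulLeftInvariant := by
    refine ⟨fun h => ?_⟩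
    rw [Measure.map_map (by fun_prop) (by fun_prop)]
    conv_rhs => rw [← map_mul_left_eq_self μ h]
    rw [Measure.map_map (by fun_prop) (by fun_prop)]
    congr 1
    ext x
    simp [mul_assoc]
  have hfin : IsFiniteMeasure (Measure.map (· * g) μ) := by infer_instance
  have h := Measure.isMulInvariant_eq_smul_of_compactSpace (Measure.map (· * g) μ) μ
  have h1 := congrArg (fun m => m univ) h
  simp only [Measure.smul_apply] at h1
  rw [Measure.map_apply (by fun_prop) MeasurableSet.univ, preimage_univ] at h1
  have h2 : ((Measure.haarScalarFactor (Measure.map (· * g) μ) μ : NNReal) : ENNReal) = 1 := by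
    have h0 : μ univ ≠ 0 := (Measure.measure_univ_pos.2 (NeZero.ne μ)).ne'
    have ht : μ univ ≠ ⊤ := measure_ne_top μ univ
    rw [ENNReal.smul_def, smul_eq_mul] at h1
    exact ((ENNReal.mul_eq_right h0 ht).1 h1.symm)
  rw [h]
  have h3 : Measure.haarScalarFactor (Measure.map (· * g) μ) μ = 1 := by exact_mod_cast h2
  rw [h3, one_smul]

/-- Right invariance of μ makes its image under inversion left invariant; comparing total masses
again gives the factor 1. -/
theorem MeasureTheory.Measure.IsHaarMeasure.isInvInvariant_of_compactSpace {G : Type*}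
    [Group G] [TopologicalSpace G] [IsTopologicalGroup G] [CompactSpace G]
    [MeasurableSpace G] [BorelSpace G] (μ : Measure G) [μ.IsHaarMeasure] :
    μ.IsInvInvariant := by
  have := Measure.IsHaarMeasure.isMulRightInvariant_of_compactSpace μ
  refine ⟨?_⟩
  have hfin : IsFiniteMeasure μ.inv := by unfold Measure.inv; infer_instance
  have h := Measure.isMulInvariant_eq_smul_of_compactSpace μ.inv μ
  have h1 := congrArg (fun m => m univ) h
  simp only [Measure.smul_apply, Measure.inv_apply, Set.inv_univ] at h1
  have h2 : ((Measure.haarScalarFactor μ.inv μ : NNReal) : ENNReal) = 1 := by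
    have h0 : μ univ ≠ 0 := (Measure.measure_univ_pos.2 (NeZero.ne μ)).ne'
    have ht : μ univ ≠ ⊤ := measure_ne_top μ univ
    rw [ENNReal.smul_def, smul_eq_mul] at h1
    exact ((ENNReal.mul_eq_right h0 ht).1 h1.symm)
  rw [h]
  have h3 : Measure.haarScalarFactor μ.inv μ = 1 := by exact_mod_cast h2
  rw [h3, one_smul]

namespace SU2

instance (ν : Measure SU2) [ν.IsHaarMeasure] : ν.IsMulRightInvariant :=
  Measure.IsHaarMeasure.isMulRightInvariant_of_compactSpace ν

instance (ν : Measure SU2) [ν.IsHaarMeasure] : ν.IsInvInvariant :=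
  Measure.IsHaarMeasure.isInvInvariant_of_compactSpace ν

theorem measureReal_univ_pos (ν : Measure SU2) [ν.IsHaarMeasure] : 0 < ν.real univ :=
  ENNReal.toReal_pos (Measure.measure_univ_pos.2 (NeZero.ne ν)).ne' (measure_ne_top ν univ)

theorem integrable_of_continuous {E : Type*} [NormedAddCommGroup E] (ν : Measure SU2)
    [ν.IsHaarMeasure] {f : SU2 → E} (hf : Continuous f) : Integrable f ν :=
  hf.integrable_of_hasCompactSupport (HasCompactSupport.of_compactSpace f)

end SU2

/-! ### Left-invariant calculus on `SU(2)` -/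

namespace SU2

/-- The left-invariant horizontal vector field in direction `cos θ X + sin θ Y`. -/
def field (θ : ℝ) (f : SU2 → ℝ) (g : SU2) : ℝ := deriv (fun s : ℝ => f (g * horizontalExp s θ)) 0

/-- Right multiplication by `cos θ X + sin θ Y` on matrices. -/
def rightMul (θ : ℝ) (A : Fin 2 → Fin 2 → ℂ) : Fin 2 → Fin 2 → ℂ :=
  fun i => ![-A i 1 * Complex.exp (-(θ * Complex.I)), A i 0 * Complex.exp (θ * Complex.I)]

theorem contDiff_rightMul (θ : ℝ) : ContDiff ℝ ∞ (rightMul θ) := by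
  refine contDiff_pi.2 fun i => contDiff_pi.2 fun j => ?_
  fin_cases j <;> simp [rightMul] <;> fun_prop

theorem su2Entries_mul_horizontalExp (g : SU2) (s θ : ℝ) :
    su2Entries (g * horizontalExp s θ) =
      Real.cos s • su2Entries g + Real.sin s • rightMul θ (su2Entries g) := by
  have hc : (starRingEnd ℂ) (Complex.exp (θ * Complex.I)) = Complex.exp (-(θ * Complex.I)) := by
    rw [← Complex.exp_conj]; simp
  have : (↑(g * horizontalExp s θ) : Matrix (Fin 2) (Fin 2) ℂ) = g.1 * (horizontalExp s θ).1 := rfl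
  ext i j
  simp only [su2Entries, this, Matrix.mul_apply, Fin.sum_univ_two, Pi.add_apply, Pi.smul_apply,
    rightMul]
  fin_cases j <;> simp [horizontalExp, su2Matrix, hc, -Complex.ofReal_cos, -Complex.ofReal_sin] <;>
    ring

theorem hasDerivAt_su2Entries (g : SU2) (θ s : ℝ) :
    HasDerivAt (fun s => su2Entries (g * horizontalExp s θ))
      (rightMul θ (su2Entries (g * horizontalExp s θ))) s := by
  have h0 : ∀ g : SU2, HasDerivAt (fun s => su2Entries (g * horizontalExp s θ))
      (rightMul θ (su2Entries g)) 0 := by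
    intro g
    have h := ((Real.hasDerivAt_cos 0).smul_const (su2Entries g)).add
      ((Real.hasDerivAt_sin 0).smul_const (rightMul θ (su2Entries g)))
    simp only [Real.sin_zero, neg_zero, zero_smul, Real.cos_zero, one_smul, zero_add] at h
    refine h.congr_of_eventuallyEq (Eventually.of_forall fun s => ?_)
    simp [su2Entries_mul_horizontalExp]
  -- The one-parameter group law moves the derivative at `s` to the derivative at `0` based at the
  -- translated point.
  have h1 := h0 (g * horizontalExp s θ)
  have h2 : HasDerivAt (fun t : ℝ => t - s) 1 s := (hasDerivAt_id s).sub_const s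
  have h3 := HasDerivAt.scomp_of_eq s h1 h2 (sub_self s).symm
  rw [one_smul] at h3
  refine h3.congr_of_eventuallyEq (Eventually.of_forall fun t => ?_)
  simp only [Function.comp_apply, mul_assoc, ← horizontalExp_add]
  congr 3; ring

/-- A function of the entries differentiated along a horizontal field. -/
theorem hasDerivAt_comp_entries {F : (Fin 2 → Fin 2 → ℂ) → ℝ} (hF : ContDiff ℝ ∞ F) (g : SU2)
    (θ s : ℝ) : HasDerivAt (fun s => F (su2Entries (g * horizontalExp s θ)))
      (fderiv ℝ F (su2Entries (g * horizontalExp s θ))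
        (rightMul θ (su2Entries (g * horizontalExp s θ)))) s :=
  ((hF.differentiable (by simp)).differentiableAt.hasFDerivAt).comp_hasDerivAt s
    (hasDerivAt_su2Entries g θ s)

theorem field_comp_entries {F : (Fin 2 → Fin 2 → ℂ) → ℝ} (hF : ContDiff ℝ ∞ F) (θ : ℝ) (g : SU2) :
    field θ (fun g => F (su2Entries g)) g =
      fderiv ℝ F (su2Entries g) (rightMul θ (su2Entries g)) := by
  have := (hasDerivAt_comp_entries hF g θ 0).deriv
  simpa [field] using this

theorem smooth_field {f : SU2 → ℝ} (hf : IsSmoothSU2 f) (θ : ℝ) : IsSmoothSU2 (field θ f) := by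
  obtain ⟨F, hF, hfF⟩ := hf
  obtain rfl : f = fun g => F (su2Entries g) := funext hfF
  refine ⟨fun A => fderiv ℝ F A (rightMul θ A), ?_, fun g => field_comp_entries hF θ g⟩
  exact (hF.fderiv_right (m := ∞) (by simp)).clm_apply (contDiff_rightMul θ)

theorem hasDerivAt_field {f : SU2 → ℝ} (hf : IsSmoothSU2 f) (g : SU2) (θ s : ℝ) :
    HasDerivAt (fun s => f (g * horizontalExp s θ)) (field θ f (g * horizontalExp s θ)) s := by
  obtain ⟨F, hF, hfF⟩ := hf
  obtain rfl : f = fun g => F (su2Entries g) := funext hfF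
  rw [field_comp_entries hF]
  exact hasDerivAt_comp_entries hF g θ s

theorem hasDerivAt_field_zero {f : SU2 → ℝ} (hf : IsSmoothSU2 f) (g : SU2) (θ : ℝ) :
    HasDerivAt (fun s => f (g * horizontalExp s θ)) (field θ f g) 0 := by
  simpa using hasDerivAt_field hf g θ 0

end SU2

namespace IsSmoothSU2
open SU2

variable {f h : SU2 → ℝ}

theorem continuous (hf : IsSmoothSU2 f) : Continuous f := by
  obtain ⟨F, hF, hfF⟩ := hf
  obtain rfl : f = fun g => F (su2Entries g) := funext hfF
  exact hF.continuous.comp continuous_su2Entries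

theorem add (hf : IsSmoothSU2 f) (hh : IsSmoothSU2 h) : IsSmoothSU2 (fun g => f g + h g) := by
  obtain ⟨F, hF, hfF⟩ := hf
  obtain ⟨H, hH, hhH⟩ := hh
  exact ⟨fun A => F A + H A, hF.add hH, fun g => by simp only [hfF, hhH]⟩

theorem mul (hf : IsSmoothSU2 f) (hh : IsSmoothSU2 h) : IsSmoothSU2 (fun g => f g * h g) := by
  obtain ⟨F, hF, hfF⟩ := hf
  obtain ⟨H, hH, hhH⟩ := hh
  exact ⟨fun A => F A * H A, hF.mul hH, fun g => by simp only [hfF, hhH]⟩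

theorem const (c : ℝ) : IsSmoothSU2 (fun _ => c) := ⟨fun _ => c, contDiff_const, fun _ => rfl⟩

theorem bounded (hf : IsSmoothSU2 f) : ∃ C, ∀ g, ‖f g‖ ≤ C := by
  obtain ⟨C, hC⟩ := (isCompact_univ (X := SU2)).exists_bound_of_continuousOn hf.continuous.continuousOn
  exact ⟨C, fun g => hC g (mem_univ g)⟩

theorem subLaplacian (hf : IsSmoothSU2 f) : IsSmoothSU2 (subLaplacian f) :=
  (smooth_field (smooth_field hf 0) 0).add (smooth_field (smooth_field hf _) _)

end IsSmoothSU2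

namespace SU2

theorem subLaplacian_eq (f : SU2 → ℝ) (g : SU2) :
    subLaplacian f g = field 0 (field 0 f) g + field (Real.pi / 2) (field (Real.pi / 2) f) g := rfl

variable {f h : SU2 → ℝ}

theorem field_mul (hf : IsSmoothSU2 f) (hh : IsSmoothSU2 h) (θ : ℝ) (g : SU2) :
    field θ (fun g => f g * h g) g = field θ f g * h g + f g * field θ h g := by
  have := ((hasDerivAt_field_zero hf g θ).mul (hasDerivAt_field_zero hh g θ)).deriv
  simp only [horizontalExp_zero, mul_one] at this
  exact this

variable (ν : Measure SU2) [ν.IsHaarMeasure]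

/-- By right invariance the integral of `f (g * horizontalExp s θ)` is constant in `s`;
differentiate under the integral at `s = 0`. -/
theorem integral_field (hf : IsSmoothSU2 f) (θ : ℝ) : ∫ g, field θ f g ∂ν = 0 := by
  obtain ⟨C, hC⟩ := (smooth_field hf θ).bounded
  have hd := (hasDerivAt_integral_of_dominated_loc_of_deriv_le (μ := ν) (𝕜 := ℝ)
    (F := fun s g => f (g * horizontalExp s θ)) (x₀ := 0) (s := univ) (bound := fun _ => C)
    (F' := fun s g => field θ f (g * horizontalExp s θ)) univ_mem
    (Eventually.of_forall fun s =>
      (hf.continuous.comp (continuous_mul_const _)).aestronglyMeasurable)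
    (integrable_of_continuous ν (hf.continuous.comp (continuous_mul_const _)))
    (((smooth_field hf θ).continuous.comp (continuous_mul_const _)).aestronglyMeasurable)
    (Eventually.of_forall fun g s _ => hC _) (integrable_const C)
    (Eventually.of_forall fun g s _ => hasDerivAt_field hf g θ s)).2
  have hc : (fun s => ∫ g, f (g * horizontalExp s θ) ∂ν) = fun _ => ∫ g, f g ∂ν :=
    funext fun s => integral_mul_right_eq_self f _
  rw [hc] at hd
  have := hd.unique (hasDerivAt_const _ _)
  simpa using this

theorem integral_field_mul (hf : IsSmoothSU2 f) (hh : IsSmoothSU2 h) (θ : ℝ) :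
    ∫ g, field θ f g * h g ∂ν = - ∫ g, f g * field θ h g ∂ν := by
  have h0 := integral_field ν (hf.mul hh) θ
  have h1 : (fun g => field θ (fun g => f g * h g) g) =
    fun g => field θ f g * h g + f g * field θ h g := funext fun g => field_mul hf hh θ g
  rw [h1, integral_add] at h0
  · linarith
  · exact integrable_of_continuous ν ((smooth_field hf θ).mul hh).continuous
  · exact integrable_of_continuous ν (hf.mul (smooth_field hh θ)).continuous

/-- Each field is skew for Haar measure, so its square is symmetric. -/
theorem integral_subLaplacian_mul (hf : IsSmoothSU2 f) (hh : IsSmoothSU2 h) :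
    ∫ g, subLaplacian f g * h g ∂ν = ∫ g, f g * subLaplacian h g ∂ν := by
  have key : ∀ θ, ∫ g, field θ (field θ f) g * h g ∂ν = ∫ g, f g * field θ (field θ h) g ∂ν := by
    intro θ
    rw [integral_field_mul ν (smooth_field hf θ) hh, integral_field_mul ν hf (smooth_field hh θ),
      neg_neg]
  simp only [subLaplacian_eq, add_mul, mul_add]
  rw [integral_add, integral_add, key, key]
  all_goals refine integrable_of_continuous ν ?_
  · exact (hf.mul (smooth_field (smooth_field hh 0) 0)).continuous
  · exact (hf.mul (smooth_field (smooth_field hh _) _)).continuous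
  · exact ((smooth_field (smooth_field hf 0) 0).mul hh).continuous
  · exact ((smooth_field (smooth_field hf _) _).mul hh).continuous

theorem integral_subLaplacian (hf : IsSmoothSU2 f) : ∫ g, subLaplacian f g ∂ν = 0 := by
  simp only [subLaplacian_eq]
  rw [integral_add, integral_field ν (smooth_field hf _), integral_field ν (smooth_field hf _),
    add_zero]
  · exact integrable_of_continuous ν (smooth_field (smooth_field hf 0) 0).continuous
  · exact integrable_of_continuous ν (smooth_field (smooth_field hf _) _).continuous

end SU2

/-! ### Regularity of the heat kernel and its evolution tested on smooth functions. -/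

namespace IsSubellipticHeatKernel
open SU2

variable {ν : Measure SU2} {p : ℝ → SU2 → ℝ}

theorem smooth_at (hp : IsSubellipticHeatKernel ν p) {t : ℝ} (ht : 0 < t) : IsSmoothSU2 (p t) := by
  obtain ⟨F, hF, hpF⟩ := hp.smooth
  refine ⟨fun A => F (t, A), ?_, fun g => hpF t ht g⟩
  rw [← contDiffOn_univ]
  exact hF.comp (by fun_prop) fun A _ => ⟨ht, mem_univ _⟩

theorem continuousOn (hp : IsSubellipticHeatKernel ν p) :
    ContinuousOn (fun x : ℝ × SU2 => p x.1 x.2) (Ioi 0 ×ˢ univ) := by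
  obtain ⟨F, hF, hpF⟩ := hp.smooth
  have h : ContinuousOn (fun x : ℝ × SU2 => F (x.1, su2Entries x.2)) (Ioi 0 ×ˢ univ) :=
    hF.continuousOn.comp (continuous_fst.prodMk
      (continuous_su2Entries.comp continuous_snd)).continuousOn fun x hx => ⟨hx.1, mem_univ _⟩
  exact h.congr fun x hx => hpF _ hx.1 _

/-- The heat equation replaces L p by the time derivative of the smooth extension, whose joint
continuity is immediate. -/
theorem continuousOn_subLaplacian (hp : IsSubellipticHeatKernel ν p) :
    ContinuousOn (fun x : ℝ × SU2 => subLaplacian (p x.1) x.2) (Ioi 0 ×ˢ univ) := by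
  obtain ⟨F, hF, hpF⟩ := hp.smooth
  have ho : IsOpen (Ioi (0 : ℝ) ×ˢ (univ : Set (Fin 2 → Fin 2 → ℂ))) := isOpen_Ioi.prod isOpen_univ
  have h : ContinuousOn (fun x : ℝ × SU2 => fderiv ℝ F (x.1, su2Entries x.2) (1, 0))
      (Ioi 0 ×ˢ univ) :=
    ((hF.continuousOn_fderiv_of_isOpen ho (by simp)).comp (continuous_fst.prodMk
      (continuous_su2Entries.comp continuous_snd)).continuousOn
      fun x hx => ⟨hx.1, mem_univ _⟩).clm_apply continuousOn_const
  refine h.congr fun x hx => ?_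
  have hx1 : 0 < x.1 := hx.1
  have hd : HasFDerivAt F (fderiv ℝ F (x.1, su2Entries x.2)) (x.1, su2Entries x.2) :=
    ((hF.contDiffAt (ho.mem_nhds (mk_mem_prod (mem_Ioi.2 hx1) (mem_univ _)))).differentiableAt (by simp)).hasFDerivAt
  have h1 := hd.comp_hasDerivAt x.1
    ((hasDerivAt_id x.1).prodMk (hasDerivAt_const x.1 (su2Entries x.2)))
  refine (hp.heat_eq x.1 hx1 x.2).unique (h1.congr_of_eventuallyEq ?_)
  filter_upwards [Ioi_mem_nhds hx1] with s hs
  exact hpF s hs _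

/-- Compactness of [t/2, 2t] × SU(2) bounds L p uniformly, which is the domination needed to
differentiate under the integral. -/
theorem hasDerivAt_integral [ν.IsHaarMeasure] (hp : IsSubellipticHeatKernel ν p) {f : SU2 → ℝ}
    (hf : IsSmoothSU2 f) {t : ℝ} (ht : 0 < t) :
    HasDerivAt (fun t => ∫ g, p t g * f g ∂ν) (∫ g, subLaplacian (p t) g * f g ∂ν) t := by
  have hK : IsCompact (Icc (t / 2) (2 * t) ×ˢ (univ : Set SU2)) := isCompact_Icc.prod isCompact_univ
  obtain ⟨C, hC⟩ := hK.exists_bound_of_continuousOn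
    (hp.continuousOn_subLaplacian.mono (prod_mono (fun s hs => lt_of_lt_of_le (by positivity) hs.1)
      subset_rfl))
  obtain ⟨B, hB⟩ := hf.bounded
  have hB0 : 0 ≤ B := (norm_nonneg _).trans (hB 1)
  refine (hasDerivAt_integral_of_dominated_loc_of_deriv_le (μ := ν) (𝕜 := ℝ)
    (F := fun s g => p s g * f g) (x₀ := t) (s := Icc (t / 2) (2 * t)) (bound := fun _ => C * B)
    (F' := fun s g => subLaplacian (p s) g * f g) (Icc_mem_nhds (by linarith) (by linarith))
    ?_ (integrable_of_continuous ν ((hp.smooth_at ht).mul hf).continuous)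
    ((hp.smooth_at ht).subLaplacian.mul hf).continuous.aestronglyMeasurable
    (Eventually.of_forall fun g s hs => ?_) (integrable_const _)
    (Eventually.of_forall fun g s hs => ?_)).2
  · filter_upwards [Ioi_mem_nhds ht] with s hs
    exact ((hp.smooth_at hs).mul hf).continuous.aestronglyMeasurable
  · rw [norm_mul]
    exact mul_le_mul (hC (s, g) ⟨hs, mem_univ _⟩) (hB g) (norm_nonneg _)
      ((norm_nonneg _).trans (hC (s, g) ⟨hs, mem_univ _⟩))
  · exact (hp.heat_eq s (lt_of_lt_of_le (by positivity) hs.1) g).mul_const _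

theorem hasDerivAt_integral' [ν.IsHaarMeasure] (hp : IsSubellipticHeatKernel ν p) {f : SU2 → ℝ}
    (hf : IsSmoothSU2 f) {t : ℝ} (ht : 0 < t) :
    HasDerivAt (fun t => ∫ g, p t g * f g ∂ν) (∫ g, p t g * subLaplacian f g ∂ν) t := by
  rw [← integral_subLaplacian_mul ν (hp.smooth_at ht) hf]
  exact hp.hasDerivAt_integral hf ht

end IsSubellipticHeatKernel

/-! ### Monomials in the coordinates of `SU(2)` -/

namespace SU2

/-- The monomial `a ^ i * ā ^ j * b ^ k` in the coordinates of `SU(2)`. -/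
def monomial (i j k : ℕ) (g : SU2) : ℂ := fst g ^ i * (starRingEnd ℂ) (fst g) ^ j * snd g ^ k

theorem continuous_monomial (i j k : ℕ) : Continuous (monomial i j k) :=
  ((continuous_fst.pow i).mul ((Complex.continuous_conj.comp continuous_fst).pow j)).mul
    (continuous_snd.pow k)

@[simp] theorem monomial_one (i j k : ℕ) : monomial i j k 1 = 0 ^ k := by simp [monomial]

/-- The fields and L act on real functions, so complex monomials are reached through real-linear
functionals φ; the real and imaginary parts are the ones used to recover complex identities. -/
theorem smooth_monomial (φ : ℂ →L[ℝ] ℝ) (i j k : ℕ) : IsSmoothSU2 (fun g => φ (monomial i j k g)) := by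
  refine ⟨fun A => φ (A 0 0 ^ i * (starRingEnd ℂ) (A 0 0) ^ j * A 0 1 ^ k), ?_, fun g => rfl⟩
  have hc : ContDiff ℝ ∞ (fun A : Fin 2 → Fin 2 → ℂ => (starRingEnd ℂ) (A 0 0)) :=
    Complex.conjCLE.contDiff.comp (contDiff_apply_apply ℝ ℂ 0 0)
  have h0 : ContDiff ℝ ∞ (fun A : Fin 2 → Fin 2 → ℂ => A 0 0) := contDiff_apply_apply ℝ ℂ 0 0
  have h1 : ContDiff ℝ ∞ (fun A : Fin 2 → Fin 2 → ℂ => A 0 1) := contDiff_apply_apply ℝ ℂ 0 1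
  exact φ.contDiff.comp (((h0.pow i).mul (hc.pow j)).mul (h1.pow k))

theorem hasDerivAt_fst (g : SU2) (θ : ℝ) :
    HasDerivAt (fun s => fst (g * horizontalExp s θ))
      (-(Complex.exp (-(θ * Complex.I)) * snd g)) 0 := by
  have h := hasDerivAt_su2Entries g θ 0
  have := hasDerivAt_pi.1 (hasDerivAt_pi.1 h 0) 0
  simp only [rightMul, horizontalExp_zero, mul_one] at this
  refine HasDerivAt.congr_deriv (f := fun s => fst (g * horizontalExp s θ)) this ?_
  simp [snd]; ring

theorem hasDerivAt_snd (g : SU2) (θ : ℝ) :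
    HasDerivAt (fun s => snd (g * horizontalExp s θ)) (Complex.exp (θ * Complex.I) * fst g) 0 := by
  have h := hasDerivAt_su2Entries g θ 0
  have := hasDerivAt_pi.1 (hasDerivAt_pi.1 h 0) 1
  simp only [rightMul, horizontalExp_zero, mul_one] at this
  refine HasDerivAt.congr_deriv (f := fun s => snd (g * horizontalExp s θ)) this ?_
  simp [fst]; ring

theorem hasDerivAt_conj_fst (g : SU2) (θ : ℝ) :
    HasDerivAt (fun s => (starRingEnd ℂ) (fst (g * horizontalExp s θ)))
      (-(Complex.exp (θ * Complex.I) * (starRingEnd ℂ) (snd g))) 0 := by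
  have := (hasDerivAt_fst g θ).star
  refine HasDerivAt.congr_deriv (f := fun s => (starRingEnd ℂ) (fst (g * horizontalExp s θ))) this ?_
  simp [← Complex.exp_conj]

theorem hasDerivAt_conj_snd (g : SU2) (θ : ℝ) :
    HasDerivAt (fun s => (starRingEnd ℂ) (snd (g * horizontalExp s θ)))
      (Complex.exp (-(θ * Complex.I)) * (starRingEnd ℂ) (fst g)) 0 := by
  have := (hasDerivAt_snd g θ).star
  refine HasDerivAt.congr_deriv (f := fun s => (starRingEnd ℂ) (snd (g * horizontalExp s θ))) this ?_
  simp [← Complex.exp_conj]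

theorem HasDerivAt.field_eq {f : SU2 → ℂ} {θ : ℝ} {g : SU2} {c : ℂ} (φ : ℂ →L[ℝ] ℝ)
    (h : HasDerivAt (fun s => f (g * horizontalExp s θ)) c 0) :
    field θ (fun g => φ (f g)) g = φ c := (φ.hasFDerivAt.comp_hasDerivAt (0 : ℝ) h).deriv

/-- The derivative of a monomial along a horizontal field. -/
def fieldMonomial (θ : ℝ) (i j k : ℕ) (g : SU2) : ℂ :=
  (((i : ℂ) * fst g ^ (i - 1) * (-(Complex.exp (-(θ * Complex.I)) * snd g))) *
      (starRingEnd ℂ) (fst g) ^ j +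
    fst g ^ i * ((j : ℂ) * (starRingEnd ℂ) (fst g) ^ (j - 1) *
      (-(Complex.exp (θ * Complex.I) * (starRingEnd ℂ) (snd g))))) * snd g ^ k +
  fst g ^ i * (starRingEnd ℂ) (fst g) ^ j *
    ((k : ℂ) * snd g ^ (k - 1) * (Complex.exp (θ * Complex.I) * fst g))

theorem field_monomial (φ : ℂ →L[ℝ] ℝ) (θ : ℝ) (i j k : ℕ) :
    field θ (fun g => φ (monomial i j k g)) = fun g => φ (fieldMonomial θ i j k g) := by
  funext g
  apply HasDerivAt.field_eq φ
  have := (((hasDerivAt_fst g θ).pow i).mul ((hasDerivAt_conj_fst g θ).pow j)).mul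
    ((hasDerivAt_snd g θ).pow k)
  simp only [Pi.mul_apply, Pi.pow_apply, horizontalExp_zero, mul_one] at this
  exact this

/-- The second derivative is sorted by its dependence on θ: the constant part contributes to L,
while the e^{±2iθ} parts cancel between θ = 0 and θ = π/2. The truncated exponents are harmless,
since their coefficients vanish whenever truncation occurs. -/
theorem field_fieldMonomial (φ : ℂ →L[ℝ] ℝ) (θ : ℝ) (i j k : ℕ) (g : SU2) :
    field θ (fun g => φ (fieldMonomial θ i j k g)) g = φ (
      -(i + j + k : ℂ) * monomial i j k g
      + 2 * (i * fst g ^ (i - 1) * (j * (starRingEnd ℂ) (fst g) ^ (j - 1)) * snd g ^ k) *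
          (snd g * (starRingEnd ℂ) (snd g))
      - 2 * i * k * monomial i j k g
      + Complex.exp (θ * Complex.I) ^ 2 * (
          fst g ^ i * (j * ((j - 1 : ℕ) : ℂ) * (starRingEnd ℂ) (fst g) ^ (j - 1 - 1)) *
            (starRingEnd ℂ) (snd g) ^ 2 * snd g ^ k
          - 2 * (fst g ^ i * (j * (starRingEnd ℂ) (fst g) ^ (j - 1)) * (k * snd g ^ (k - 1))
            * (starRingEnd ℂ) (snd g) * fst g)
          + fst g ^ i * (starRingEnd ℂ) (fst g) ^ j * (k * ((k - 1 : ℕ) : ℂ) * snd g ^ (k - 1 - 1))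
            * fst g ^ 2)
      + Complex.exp (-(θ * Complex.I)) ^ 2 * (
          (i * ((i - 1 : ℕ) : ℂ) * fst g ^ (i - 1 - 1)) * (starRingEnd ℂ) (fst g) ^ j *
            snd g ^ 2 * snd g ^ k)) := by
  apply HasDerivAt.field_eq φ
  have ha := hasDerivAt_fst g θ
  have hb := hasDerivAt_snd g θ
  have hA := hasDerivAt_conj_fst g θ
  have hB := hasDerivAt_conj_snd g θ
  have h1 := (((((ha.pow (i - 1)).const_mul (i : ℂ)).mul
    ((hb.const_mul (Complex.exp (-(θ * Complex.I)))).neg)).mul (hA.pow j)).add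
    ((ha.pow i).mul (((hA.pow (j - 1)).const_mul (j : ℂ)).mul
      ((hB.const_mul (Complex.exp (θ * Complex.I))).neg)))).mul (hb.pow k)
  have h2 := ((ha.pow i).mul (hA.pow j)).mul (((hb.pow (k - 1)).const_mul (k : ℂ)).mul
    (ha.const_mul (Complex.exp (θ * Complex.I))))
  have h := h1.add h2
  simp only [Pi.mul_apply, Pi.pow_apply, Pi.add_apply, Pi.neg_apply, horizontalExp_zero,
    mul_one] at h
  refine HasDerivAt.congr_deriv h ?_
  have hE : Complex.exp (θ * Complex.I) * Complex.exp (-(θ * Complex.I)) = 1 := by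
    rw [← Complex.exp_add]; simp
  have hi : (i : ℂ) * fst g ^ (i - 1) * fst g = i * fst g ^ i := by
    rcases i with _ | i
    · simp
    · simp [pow_succ]; ring
  have hj : (j : ℂ) * (starRingEnd ℂ) (fst g) ^ (j - 1) * (starRingEnd ℂ) (fst g) =
      j * (starRingEnd ℂ) (fst g) ^ j := by
    rcases j with _ | j
    · simp
    · simp [pow_succ]; ring
  have hk : (k : ℂ) * snd g ^ (k - 1) * snd g = k * snd g ^ k := by
    rcases k with _ | k
    · simp
    · simp [pow_succ]; ring
  simp only [monomial]
  -- With all powers made independent variables, the claim is a polynomial identity modulo `hE`,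
  -- `hi`, `hj`, `hk`.
  generalize Complex.exp (θ * Complex.I) = E at *
  generalize Complex.exp (-(θ * Complex.I)) = E' at *
  generalize (starRingEnd ℂ) (fst g) = A at *
  generalize (starRingEnd ℂ) (snd g) = B at *
  generalize fst g = a at *
  generalize snd g = b at *
  generalize ((i - 1 : ℕ) : ℂ) = i' at *
  generalize ((j - 1 : ℕ) : ℂ) = j' at *
  generalize ((k - 1 : ℕ) : ℂ) = k' at *
  generalize a ^ (i - 1 - 1) = a2 at *
  generalize a ^ (i - 1) = a1 at *
  generalize a ^ i = a0 at *
  generalize A ^ (j - 1 - 1) = A2 at *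
  generalize A ^ (j - 1) = A1 at *
  generalize A ^ j = A0 at *
  generalize b ^ (k - 1 - 1) = b2 at *
  generalize b ^ (k - 1) = b1 at *
  generalize b ^ k = b0 at *
  linear_combination (exp := 1)
    (-(↑i * a1 * a * A0 * b0) - (↑j * A1 * A * a0 * b0) - ↑k * b1 * b * a0 * A0
      + 2 * (i * a1 * (j * A1) * b0) * (b * B) - 2 * (i * a1 * a) * (k * b1 * b) * A0) * hE
    + (-(A0 * b0) - 2 * A0 * (k * b1 * b)) * hi - (a0 * b0) * hj
    + (-(a0 * A0) - 2 * A0 * (i * a0)) * hk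

/-- The squares of e^{iθ} at θ = 0 and π/2 are 1 and -1, so the oscillating parts cancel. The
remaining mixed term contains b b̄ = 1 - a ā, which produces the lower monomial. This triangularity
drives every moment computation below. -/
theorem subLaplacian_monomial (φ : ℂ →L[ℝ] ℝ) (i j k : ℕ) (g : SU2) :
    subLaplacian (fun g => φ (monomial i j k g)) g =
      φ (-(2 * (i + j + k) + 4 * i * k + 4 * i * j : ℂ) * monomial i j k g
        + 4 * i * j * monomial (i - 1) (j - 1) k g) := by
  rw [subLaplacian_eq, field_monomial, field_monomial, field_fieldMonomial, field_fieldMonomial,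
    ← map_add]
  congr 1
  have h1 : Complex.exp (((Real.pi / 2 : ℝ) : ℂ) * Complex.I) = Complex.I := by
    push_cast; exact Complex.exp_pi_div_two_mul_I
  have h2 : Complex.exp (-(((Real.pi / 2 : ℝ) : ℂ) * Complex.I)) = -Complex.I := by
    rw [Complex.exp_neg, h1, Complex.inv_I]
  rw [h1, h2]
  simp only [Complex.ofReal_zero, zero_mul, neg_zero, Complex.exp_zero, one_pow, neg_sq,
    Complex.I_sq, one_mul]
  have hn := normSq_fst_add_snd g
  have hi : (i : ℂ) * fst g ^ (i - 1) * fst g = i * fst g ^ i := by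
    rcases i with _ | i
    · simp
    · simp [pow_succ]; ring
  have hj : (j : ℂ) * (starRingEnd ℂ) (fst g) ^ (j - 1) * (starRingEnd ℂ) (fst g) =
      j * (starRingEnd ℂ) (fst g) ^ j := by
    rcases j with _ | j
    · simp
    · simp [pow_succ]; ring
  simp only [monomial]
  generalize (starRingEnd ℂ) (fst g) = A at *
  generalize (starRingEnd ℂ) (snd g) = B at *
  generalize fst g = a at *
  generalize snd g = b at *
  linear_combination (4 * (i * a ^ (i - 1) * (j * A ^ (j - 1)) * b ^ k)) * hn
    - 4 * (j * A ^ (j - 1) * A) * b ^ k * hi - 4 * i * a ^ i * b ^ k * hj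

end SU2

/-! ### Chebyshev polynomials on ellipses -/

/-- Geometrically, cosh sends a vertical line into an ellipse with foci ±1. As cosh w ∓ 1 are 2
sinh²(w/2) and 2 cosh²(w/2), the sum of distances is given by the parallelogram law for e^{w/2} and
e^{-w/2}. -/
theorem Complex.norm_cosh_sub_one_add_norm_cosh_add_one (w : ℂ) :
    ‖Complex.cosh w - 1‖ + ‖Complex.cosh w + 1‖ = 2 * Real.cosh w.re := by
  have h2 : w = 2 * (w / 2) := by ring
  set v := w / 2 with hv
  have hre : w.re = 2 * v.re := by rw [h2]; simp
  have hs := Complex.cosh_sq v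
  have hc := Complex.cosh_two_mul v
  have e1 : Complex.cosh w - 1 = 2 * Complex.sinh v ^ 2 := by rw [h2, hc, hs]; ring
  have e2 : Complex.cosh w + 1 = 2 * Complex.cosh v ^ 2 := by rw [h2, hc]; linear_combination -hs
  have hp := parallelogram_law_with_norm ℝ (Complex.exp v) (Complex.exp (-v))
  have c1 : Complex.exp v + Complex.exp (-v) = 2 * Complex.cosh v := by
    rw [Complex.cosh]; ring
  have s1 : Complex.exp v - Complex.exp (-v) = 2 * Complex.sinh v := by
    rw [Complex.sinh]; ring
  rw [c1, s1, norm_mul, norm_mul, Complex.norm_exp, Complex.norm_exp] at hp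
  rw [e1, e2, norm_mul, norm_mul, norm_pow, norm_pow, hre, Real.cosh_eq]
  have x1 : Real.exp (2 * v.re) = Real.exp v.re * Real.exp v.re := by rw [← Real.exp_add]; ring_nf
  have x2 : Real.exp (-(2 * v.re)) = Real.exp (-v.re) * Real.exp (-v.re) := by
    rw [← Real.exp_add]; ring_nf
  rw [x1, x2]
  simp only [Complex.neg_re, Complex.norm_ofNat] at hp ⊢
  nlinarith [hp]

/-- Half the trace of `g * diag (e ^ (-y), e ^ y)`, where `a` is the first entry of `g ∈ SU(2)`. -/
def halfTrace (a : ℂ) (y : ℝ) : ℂ :=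
  (a * Complex.exp (-y) + (starRingEnd ℂ) a * Complex.exp y) / 2

theorem continuous_halfTrace (a : ℂ) : Continuous (halfTrace a) := by
  unfold halfTrace; fun_prop

theorem halfTrace_cyl (r z y : ℝ) : halfTrace (Real.cos r * Complex.exp (z * Complex.I)) y =
    Real.cos r * Complex.cos (z + y * Complex.I) := by
  have h1 : (z + y * Complex.I) * Complex.I = z * Complex.I + -y := by
    linear_combination (y : ℂ) * Complex.I_sq
  have h2 : -(z + y * Complex.I) * Complex.I = -(z * Complex.I) + y := by
    linear_combination (-y : ℂ) * Complex.I_sq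
  rw [halfTrace, Complex.cos, h1, h2, Complex.exp_add, Complex.exp_add, map_mul, Complex.conj_ofReal,
    ← Complex.exp_conj, map_mul, Complex.conj_ofReal, Complex.conj_I, mul_neg]
  ring

/-- `halfTrace a y` is |a| times the point cosh(y - i arg a) of the ellipse of parameter y, and the
filled ellipse is convex and symmetric. -/
theorem norm_halfTrace_sub_one_add_le {a : ℂ} (ha : ‖a‖ ≤ 1) (y : ℝ) :
    ‖halfTrace a y - 1‖ + ‖halfTrace a y + 1‖ ≤ 2 * Real.cosh y := by
  set x : ℂ := Complex.cosh (y - a.arg * Complex.I) with hx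
  have hE : ‖x - 1‖ + ‖x + 1‖ = 2 * Real.cosh y := by
    rw [hx, Complex.norm_cosh_sub_one_add_norm_cosh_add_one]; simp
  have ht : halfTrace a y = ‖a‖ * x := by
    conv_lhs => rw [← Complex.norm_mul_exp_arg_mul_I a]
    rw [halfTrace, hx, Complex.cosh, neg_sub, sub_eq_add_neg, sub_eq_add_neg, Complex.exp_add,
      Complex.exp_add, map_mul, Complex.conj_ofReal, ← Complex.exp_conj, map_mul,
      Complex.conj_ofReal, Complex.conj_I, mul_neg]
    ring
  set ρ := ‖a‖
  have hρ : 0 ≤ ρ := norm_nonneg a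
  -- The shrunk point ρx is the convex combination of x and -x with weights (1 ± ρ)/2.
  have e1 : halfTrace a y - 1 = ((1 + ρ) / 2 : ℝ) * (x - 1) + ((1 - ρ) / 2 : ℝ) * (-(x + 1)) := by
    rw [ht]; push_cast; ring
  have e2 : halfTrace a y + 1 = ((1 + ρ) / 2 : ℝ) * (x + 1) + ((1 - ρ) / 2 : ℝ) * (-(x - 1)) := by
    rw [ht]; push_cast; ring
  have n1 := norm_add_le (((1 + ρ) / 2 : ℝ) * (x - 1)) (((1 - ρ) / 2 : ℝ) * (-(x + 1)))
  have n2 := norm_add_le (((1 + ρ) / 2 : ℝ) * (x + 1)) (((1 - ρ) / 2 : ℝ) * (-(x - 1)))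
  rw [← e1] at n1
  rw [← e2] at n2
  simp only [norm_mul, norm_neg, Complex.norm_real, Real.norm_eq_abs] at n1 n2
  rw [abs_of_nonneg (by linarith), abs_of_nonneg (by linarith)] at n1 n2
  linarith

/-- Moving from the inner to the outer ellipse changes the distance to each focus by at most the
length of the move; add the two triangle inequalities. -/
theorem cosh_sub_cosh_le_norm {a : ℂ} (ha : ‖a‖ ≤ 1) (y : ℝ) (w : ℂ) :
    Real.cosh w.re - Real.cosh y ≤ ‖Complex.cosh w - halfTrace a y‖ := by
  have h1 := Complex.norm_cosh_sub_one_add_norm_cosh_add_one w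
  have h2 := norm_halfTrace_sub_one_add_le ha y
  have h3 := norm_add_le (Complex.cosh w - halfTrace a y) (halfTrace a y - 1)
  have h4 := norm_add_le (Complex.cosh w - halfTrace a y) (halfTrace a y + 1)
  rw [show Complex.cosh w - halfTrace a y + (halfTrace a y - 1) = Complex.cosh w - 1 by ring] at h3
  rw [show Complex.cosh w - halfTrace a y + (halfTrace a y + 1) = Complex.cosh w + 1 by ring] at h4
  linarith

/-- Chebyshev polynomials of the second kind. -/
def chebU : ℕ → ℂ → ℂ
  | 0, _ => 1
  | 1, x => 2 * x
  | m + 2, x => 2 * x * chebU (m + 1) x - chebU m x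

theorem continuous_chebU (m : ℕ) : Continuous (chebU m) := by
  induction m using Nat.twoStepInduction with
  | zero => exact continuous_const
  | one => exact continuous_const.mul continuous_id
  | more m h0 h1 =>
    show Continuous (fun x => 2 * x * chebU (m + 1) x - chebU m x)
    fun_prop

/-- This is the weight expansion of the SU(2) character of dimension m + 1. It avoids dividing by
sinh w and can be bounded term by term. -/
theorem chebU_cosh (m : ℕ) (w : ℂ) : chebU m (Complex.cosh w) =
    ∑ i ∈ Finset.range (m + 1), Complex.exp w ^ i * Complex.exp (-w) ^ (m - i) := by
  have hxy : Complex.exp w * Complex.exp (-w) = 1 := by rw [← Complex.exp_add]; simp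
  have h2 : 2 * Complex.cosh w = Complex.exp w + Complex.exp (-w) := by rw [Complex.cosh]; ring
  have hs : ∀ n, ∑ i ∈ Finset.range (n + 1), Complex.exp w ^ i * Complex.exp (-w) ^ (n - i) =
      Complex.exp w ^ n + Complex.exp (-w) *
        ∑ i ∈ Finset.range n, Complex.exp w ^ i * Complex.exp (-w) ^ (n - 1 - i) := fun n =>
    geom_sum₂_succ_eq _ _
  induction m using Nat.twoStepInduction with
  | zero => simp [chebU]
  | one => rw [chebU, h2]; simp [Finset.sum_range_succ]; ring
  | more m h0 h1 =>
    rw [chebU, h0, h1, h2, hs (m + 2)]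
    simp only [show m + 2 - 1 = m + 1 from rfl]
    have h := hs (m + 1)
    simp only [Nat.add_sub_cancel] at h
    generalize ∑ i ∈ Finset.range (m + 1 + 1), Complex.exp w ^ i * Complex.exp (-w) ^ (m + 1 - i)
      = B at *
    generalize ∑ i ∈ Finset.range (m + 1), Complex.exp w ^ i * Complex.exp (-w) ^ (m - i) = A at *
    rw [show m + 2 = m + 1 + 1 from rfl, pow_succ (Complex.exp w) (m + 1)]
    linear_combination Complex.exp w * h + A * hxy

/-- Writing the argument as cosh w, the ellipse inequality forces |Re w| ≤ |y|; each of the m + 1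
weights is then at most e^{m|y|}. -/
theorem norm_chebU_halfTrace_le {a : ℂ} (ha : ‖a‖ ≤ 1) (m : ℕ) (y : ℝ) :
    ‖chebU m (halfTrace a y)‖ ≤ (m + 1) * Real.exp (m * |y|) := by
  obtain ⟨w', hw'⟩ := Complex.cos_surjective (halfTrace a y)
  obtain ⟨w, hw⟩ : ∃ w, Complex.cosh w = halfTrace a y := by
    refine ⟨w' * Complex.I, ?_⟩
    rw [Complex.cosh_mul_I, hw']
  have hr : |w.re| ≤ |y| := by
    have h1 := Complex.norm_cosh_sub_one_add_norm_cosh_add_one w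
    rw [hw] at h1
    have h2 := norm_halfTrace_sub_one_add_le ha y
    exact Real.cosh_le_cosh.1 (by linarith)
  rw [← hw, chebU_cosh]
  calc ‖∑ i ∈ Finset.range (m + 1), Complex.exp w ^ i * Complex.exp (-w) ^ (m - i)‖
      ≤ ∑ i ∈ Finset.range (m + 1), Real.exp (m * |y|) := by
        refine norm_sum_le_of_le _ fun i hi => ?_
        have hi' : i ≤ m := Nat.lt_succ_iff.1 (Finset.mem_range.1 hi)
        rw [norm_mul, norm_pow, norm_pow, Complex.norm_exp, Complex.norm_exp, Complex.neg_re,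
          ← Real.exp_nat_mul, ← Real.exp_nat_mul, ← Real.exp_add]
        apply Real.exp_le_exp.2
        have hm : (m : ℝ) = i + (m - i : ℕ) := by exact_mod_cast (Nat.add_sub_cancel' hi').symm
        rw [hm]
        have e1 := mul_le_mul_of_nonneg_left ((le_abs_self w.re).trans hr) (Nat.cast_nonneg (α := ℝ) i)
        have e2 := mul_le_mul_of_nonneg_left ((neg_le_abs w.re).trans hr)
          (Nat.cast_nonneg (α := ℝ) (m - i))
        linarith
    _ = (m + 1) * Real.exp (m * |y|) := by simp

/-- The bound separates e^{-|y|}, which serves integration in y, from geometric decay in m governed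
by the gap Re w - |y|. -/
theorem norm_exp_mul_chebU_le {a : ℂ} (ha : ‖a‖ ≤ 1) (m : ℕ) (y : ℝ) (w : ℂ) :
    ‖Complex.exp (-((m + 1) * w)) * chebU m (halfTrace a y)‖ ≤
      (m + 1) * Real.exp (-|y|) * Real.exp (-((m + 1) * (w.re - |y|))) := by
  have h0 : (-(((m : ℂ) + 1) * w)).re = -((m + 1) * w.re) := by
    rw [show (-(((m : ℂ) + 1) * w)) = -(((m + 1 : ℝ) : ℂ) * w) by push_cast; ring, Complex.neg_re,
      Complex.re_ofReal_mul]
  rw [norm_mul, Complex.norm_exp, h0]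
  refine (mul_le_mul_of_nonneg_left (norm_chebU_halfTrace_le ha m y) (Real.exp_nonneg _)).trans ?_
  rw [show Real.exp (-((m + 1) * w.re)) * ((m + 1) * Real.exp (m * |y|)) =
    (m + 1) * (Real.exp (-((m + 1) * w.re)) * Real.exp (m * |y|)) by ring, ← Real.exp_add,
    mul_assoc, ← Real.exp_add]
  apply le_of_eq
  congr 2; ring

/-- The generating function of Chebyshev polynomials of the second kind. -/
theorem hasSum_exp_mul_chebU {a : ℂ} (ha : ‖a‖ ≤ 1) {y : ℝ} {w : ℂ} (hw : |y| < w.re) :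
    HasSum (fun m : ℕ => Complex.exp (-((m + 1) * w)) * chebU m (halfTrace a y))
      (1 / (2 * (Complex.cosh w - halfTrace a y))) := by
  set x := halfTrace a y
  set s := Complex.exp (-w) with hs
  have hne : Complex.cosh w - x ≠ 0 := by
    have h1 := cosh_sub_cosh_le_norm ha y w
    have h2 : Real.cosh y < Real.cosh w.re :=
      Real.cosh_lt_cosh.2 (hw.trans_le (le_abs_self _))
    exact norm_pos_iff.1 (by linarith)
  have hpow : ∀ m : ℕ, Complex.exp (-((m + 1) * w)) = s ^ (m + 1) := by
    intro m; rw [hs, ← Complex.exp_nat_mul]; congr 1; push_cast; ring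
  have hsum : Summable (fun m : ℕ => s ^ (m + 1) * chebU m x) := by
    have hq : Summable (fun m : ℕ => ((m : ℝ) + 1) * Real.exp (-((m + 1) * (w.re - |y|)))) := by
      have h := summable_pow_mul_geometric_of_norm_lt_one 1 (r := Real.exp (-(w.re - |y|)))
        (by rw [Real.norm_eq_abs, Real.abs_exp]; exact Real.exp_lt_one_iff.2 (by linarith))
      have h1 := (summable_nat_add_iff 1).2 h
      refine h1.congr fun m => ?_
      rw [pow_one, ← Real.exp_nat_mul]
      push_cast; congr 2; ring
    refine Summable.of_norm_bounded (hq.mul_left (Real.exp (-|y|))) fun m => ?_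
    rw [← hpow]
    refine (norm_exp_mul_chebU_le ha m y w).trans (le_of_eq (by ring))
  obtain ⟨S, hS⟩ := hsum
  have h1 := (hasSum_nat_add_iff' 1).2 hS
  have h2 := (hasSum_nat_add_iff' 2).2 hS
  simp only [Finset.sum_range_succ, Finset.sum_range_zero, zero_add, chebU] at h1 h2
  -- With s = e^{-w}, the three-term recurrence relates the tails of the series and gives (1 - 2xs +
  -- s²) S = s; the bracket equals 2s(cosh w - x).
  have h3 := (h1.mul_left (2 * x * s)).sub (hS.mul_left (s ^ 2))
  have h4 : (fun m : ℕ => 2 * x * s * (s ^ (m + 1 + 1) * chebU (m + 1) x) -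
      s ^ 2 * (s ^ (m + 1) * chebU m x)) =
      fun m : ℕ => s ^ (m + 2 + 1) * (2 * x * chebU (m + 1) x - chebU m x) := by
    funext m; ring
  rw [h4] at h3
  have h5 := h2.unique h3
  have hse : s * Complex.exp w = 1 := by rw [hs, ← Complex.exp_add]; simp
  have hS' : S = 1 / (2 * (Complex.cosh w - x)) := by
    rw [eq_div_iff (mul_ne_zero two_ne_zero hne)]
    have hs0 : s ≠ 0 := Complex.exp_ne_zero _
    apply mul_left_cancel₀ hs0
    rw [Complex.cosh, ← hs]
    linear_combination h5 + S * hse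
  rw [← hS']
  simpa only [hpow] using hS

/-! ### Disk polynomials -/

/-- The disk (Zernike) polynomials, normalized by the value `1` at `1`. -/
def diskPoly : ℕ → ℕ → ℂ → ℂ
  | α, 0, a => a ^ α
  | 0, β + 1, a => (starRingEnd ℂ) a ^ (β + 1)
  | α + 1, β + 1, a => a * diskPoly α (β + 1) a + (starRingEnd ℂ) a * diskPoly (α + 1) β a
      - diskPoly α β a
  termination_by α β => α + β

theorem diskPoly_zero_right (α : ℕ) (a : ℂ) : diskPoly α 0 a = a ^ α := by rw [diskPoly]

theorem diskPoly_zero_left (β : ℕ) (a : ℂ) : diskPoly 0 β a = (starRingEnd ℂ) a ^ β := by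
  cases β with
  | zero => simp [diskPoly]
  | succ β => rw [diskPoly]

theorem diskPoly_succ_succ (α β : ℕ) (a : ℂ) : diskPoly (α + 1) (β + 1) a =
    a * diskPoly α (β + 1) a + (starRingEnd ℂ) a * diskPoly (α + 1) β a - diskPoly α β a := by
  rw [diskPoly]

theorem continuous_diskPoly (α β : ℕ) : Continuous (diskPoly α β) := by
  induction hn : α + β using Nat.strong_induction_on generalizing α β with
  | _ n ih =>
    rcases β with _ | β
    · simp only [funext (diskPoly_zero_right α)]; fun_prop
    rcases α with _ | α
    · simp only [funext (diskPoly_zero_left (β + 1))]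
      exact Complex.continuous_conj.pow _
    simp only [funext (diskPoly_succ_succ α β)]
    have h1 := ih _ (by omega) α (β + 1) rfl
    have h2 := ih _ (by omega) (α + 1) β rfl
    have h3 := ih _ (by omega) α β rfl
    exact ((continuous_id.mul h1).add (Complex.continuous_conj.mul h2)).sub h3

/-- The recursion for `diskPoly` is the Chebyshev recursion with 2x = au + āv sorted by powers of u
and v. So the disk polynomials are the diagonal matrix coefficients that appear when the character
is evaluated at g · diag(u, v). -/
theorem sum_antidiagonal_diskPoly (a u v : ℂ) (huv : u * v = 1) (m : ℕ) :
    ∑ x ∈ Finset.HasAntidiagonal.antidiagonal m, u ^ x.1 * v ^ x.2 * diskPoly x.1 x.2 a =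
      chebU m ((a * u + (starRingEnd ℂ) a * v) / 2) := by
  induction m using Nat.twoStepInduction with
  | zero => simp [chebU, diskPoly_zero_right]
  | one =>
    rw [Finset.Nat.sum_antidiagonal_succ]
    simp [chebU, diskPoly_zero_right, diskPoly_zero_left]; ring
  | more m h0 h1 =>
    rw [chebU, ← h0, ← h1]
    set X := 2 * ((a * u + (starRingEnd ℂ) a * v) / 2) with hX
    have hX' : X = a * u + (starRingEnd ℂ) a * v := by rw [hX]; ring
    rw [hX', add_mul]
    conv_rhs => enter [1, 1, 2]; rw [Finset.Nat.sum_antidiagonal_succ']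
    conv_rhs => enter [1, 2, 2]; rw [Finset.Nat.sum_antidiagonal_succ]
    rw [Finset.Nat.sum_antidiagonal_succ, Finset.Nat.sum_antidiagonal_succ']
    simp only [diskPoly_zero_right, diskPoly_zero_left, diskPoly_succ_succ, mul_add, Finset.mul_sum]
    have hs : ∀ x ∈ Finset.HasAntidiagonal.antidiagonal m, u ^ (x.1 + 1) * v ^ (x.2 + 1) *
        (a * diskPoly x.1 (x.2 + 1) a + (starRingEnd ℂ) a * diskPoly (x.1 + 1) x.2 a
          - diskPoly x.1 x.2 a) =
        a * u * (u ^ x.1 * v ^ (x.2 + 1) * diskPoly x.1 (x.2 + 1) a) +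
        (starRingEnd ℂ) a * v * (u ^ (x.1 + 1) * v ^ x.2 * diskPoly (x.1 + 1) x.2 a) -
        u ^ x.1 * v ^ x.2 * diskPoly x.1 x.2 a := by
      intro x _
      linear_combination (-(u ^ x.1 * v ^ x.2 * diskPoly x.1 x.2 a)) * huv
    rw [Finset.sum_congr rfl hs, Finset.sum_sub_distrib, Finset.sum_add_distrib]
    ring

theorem sum_antidiagonal_exp_mul_diskPoly (a : ℂ) (y : ℝ) (m : ℕ) :
    ∑ x ∈ Finset.HasAntidiagonal.antidiagonal m, (Real.exp (((x.2 : ℝ) - x.1) * y) : ℂ) * diskPoly x.1 x.2 a =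
      chebU m (halfTrace a y) := by
  rw [halfTrace, ← sum_antidiagonal_diskPoly a (Complex.exp (-y)) (Complex.exp y)
    (by rw [← Complex.exp_add]; simp) m]
  refine Finset.sum_congr rfl fun x _ => ?_
  rw [← Complex.exp_nat_mul, ← Complex.exp_nat_mul, ← Complex.exp_add]
  push_cast
  congr 2; ring

/-! ### The Gaussian kernel -/

/-- The Gaussian kernel on the line. -/
def gauss (t y : ℝ) : ℝ := (√(4 * Real.pi * t))⁻¹ * Real.exp (-y ^ 2 / (4 * t))

theorem gauss_nonneg (t y : ℝ) : 0 ≤ gauss t y := by unfold gauss; positivity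

theorem gauss_mul_exp {t : ℝ} (ht : 0 < t) (c y : ℝ) : gauss t y * Real.exp (c * y) =
    Real.exp (c ^ 2 * t) * ((√(4 * Real.pi * t))⁻¹ *
      Real.exp (-(1 / (4 * t)) * (y - 2 * c * t) ^ 2)) := by
  rw [gauss, mul_assoc, ← Real.exp_add, mul_left_comm, ← Real.exp_add]
  congr 2; field_simp; ring

theorem integrable_gauss_mul_exp {t : ℝ} (ht : 0 < t) (c : ℝ) :
    Integrable (fun y => gauss t y * Real.exp (c * y)) := by
  simp only [gauss_mul_exp ht]
  exact (((integrable_exp_neg_mul_sq (b := 1 / (4 * t)) (by positivity)).comp_sub_right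
    (2 * c * t)).const_mul _).const_mul _

/-- After completing the square this is a translated Gaussian integral. It realizes the growing
factors e^{(β-α)²t} of the spectral series as averages. -/
theorem integral_gauss_mul_exp {t : ℝ} (ht : 0 < t) (c : ℝ) :
    ∫ y, gauss t y * Real.exp (c * y) = Real.exp (c ^ 2 * t) := by
  simp only [gauss_mul_exp ht]
  rw [integral_const_mul, integral_const_mul,
    integral_sub_right_eq_self (fun y => Real.exp (-(1 / (4 * t)) * y ^ 2)) (2 * c * t),
    integral_gaussian]
  have : Real.pi / (1 / (4 * t)) = 4 * Real.pi * t := by field_simp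
  rw [this, inv_mul_cancel₀ (by positivity), mul_one]

theorem integrable_gauss_mul_exp_abs {t : ℝ} (ht : 0 < t) (c : ℝ) :
    Integrable (fun y => gauss t y * Real.exp (c * |y|)) := by
  refine ((integrable_gauss_mul_exp ht c).add (integrable_gauss_mul_exp ht (-c))).mono'
    ((Measurable.aestronglyMeasurable (by unfold gauss; fun_prop)))
    (Eventually.of_forall fun y => ?_)
  rw [Real.norm_of_nonneg (mul_nonneg (gauss_nonneg _ _) (Real.exp_nonneg _)), Pi.add_apply,
    ← mul_add]
  refine mul_le_mul_of_nonneg_left ?_ (gauss_nonneg _ _)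
  rcases abs_cases y with ⟨h, _⟩ | ⟨h, _⟩ <;> rw [h]
  · linarith [Real.exp_pos (-c * y)]
  · rw [mul_neg, ← neg_mul]; linarith [Real.exp_pos (c * y)]

theorem integral_gauss_mul_exp_abs_le {t : ℝ} (ht : 0 < t) (c : ℝ) :
    ∫ y, gauss t y * Real.exp (c * |y|) ≤ 2 * Real.exp (c ^ 2 * t) := by
  have h1 := integral_gauss_mul_exp ht c
  have h2 := integral_gauss_mul_exp ht (-c)
  have h3 := integral_add (integrable_gauss_mul_exp ht c) (integrable_gauss_mul_exp ht (-c))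
  rw [h1, h2, neg_sq] at h3
  rw [two_mul, ← h3]
  refine integral_mono (integrable_gauss_mul_exp_abs ht c)
    ((integrable_gauss_mul_exp ht c).add (integrable_gauss_mul_exp ht (-c))) fun y => ?_
  simp only [← mul_add]
  refine mul_le_mul_of_nonneg_left ?_ (gauss_nonneg _ _)
  rcases abs_cases y with ⟨h, _⟩ | ⟨h, _⟩ <;> rw [h]
  · linarith [Real.exp_pos (-c * y)]
  · rw [mul_neg, ← neg_mul]; linarith [Real.exp_pos (c * y)]

/-! ### The spectral series of the heat kernel -/

/-- The terms of the spectral expansion of the subelliptic heat kernel. -/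
def heatTerm (m : ℕ) (t : ℝ) (a : ℂ) : ℂ :=
  ((m + 1) * Real.exp (-(m * (m + 2)) * t) : ℝ) *
    ∑ x ∈ Finset.HasAntidiagonal.antidiagonal m, (Real.exp (((x.2 : ℝ) - x.1) ^ 2 * t) : ℂ) * diskPoly x.1 x.2 a

theorem continuous_heatTerm (m : ℕ) (t : ℝ) : Continuous (heatTerm m t) :=
  Continuous.mul (f := fun _ => _) continuous_const (continuous_finsetSum _ fun _ _ =>
    Continuous.mul (f := fun _ => _) continuous_const (continuous_diskPoly _ _))

/-- Replacing e^{(β-α)²t} by the Gaussian average of e^{(β-α)y} collapses the sum over α + β = m to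
a single Chebyshev value. -/
theorem heatTerm_eq {t : ℝ} (ht : 0 < t) (m : ℕ) (a : ℂ) : heatTerm m t a =
    ((m + 1) * Real.exp (-(m * (m + 2)) * t) : ℝ) *
      ∫ y, (gauss t y : ℂ) * chebU m (halfTrace a y) := by
  rw [heatTerm]
  congr 1
  simp only [← sum_antidiagonal_exp_mul_diskPoly, Finset.mul_sum, ← mul_assoc, ← Complex.ofReal_mul]
  rw [integral_finsetSum]
  · refine Finset.sum_congr rfl fun x _ => ?_
    rw [integral_mul_const, integral_complex_ofReal, integral_gauss_mul_exp ht]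
  · intro x _
    exact ((integrable_gauss_mul_exp ht ((x.2 : ℝ) - x.1)).ofReal (𝕜 := ℂ)).mul_const
      (diskPoly x.1 x.2 a)

/-- The Gaussian average grows at most like e^{m²t}; against e^{-m(m+2)t} there remains e^{-2mt},
where 2m is the lowest eigenvalue of -L at level m. -/
theorem norm_heatTerm_le {t : ℝ} (ht : 0 < t) {a : ℂ} (ha : ‖a‖ ≤ 1) (m : ℕ) :
    ‖heatTerm m t a‖ ≤ 2 * (m + 1) ^ 2 * Real.exp (-(2 * t)) ^ m := by
  have h1 : ‖∫ y, (gauss t y : ℂ) * chebU m (halfTrace a y)‖ ≤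
      (m + 1) * (2 * Real.exp ((m : ℝ) ^ 2 * t)) := by
    calc ‖∫ y, (gauss t y : ℂ) * chebU m (halfTrace a y)‖
        ≤ ∫ y, (m + 1) * (gauss t y * Real.exp (m * |y|)) := by
          refine norm_integral_le_of_norm_le ((integrable_gauss_mul_exp_abs ht m).const_mul _)
            (Eventually.of_forall fun y => ?_)
          rw [norm_mul, Complex.norm_real, Real.norm_of_nonneg (gauss_nonneg _ _), mul_left_comm]
          exact mul_le_mul_of_nonneg_left (norm_chebU_halfTrace_le ha m y) (gauss_nonneg _ _)
      _ ≤ _ := by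
          rw [integral_const_mul]
          exact mul_le_mul_of_nonneg_left (integral_gauss_mul_exp_abs_le ht m) (by positivity)
  rw [heatTerm_eq ht, norm_mul, Complex.norm_real, Real.norm_of_nonneg (by positivity)]
  refine (mul_le_mul_of_nonneg_left h1 (by positivity)).trans (le_of_eq ?_)
  rw [← Real.exp_nat_mul,
    show (m + 1) * Real.exp (-(m * (m + 2)) * t) * ((m + 1) * (2 * Real.exp ((m : ℝ) ^ 2 * t))) =
      2 * (m + 1) ^ 2 * (Real.exp (-(m * (m + 2)) * t) * Real.exp ((m : ℝ) ^ 2 * t)) by ring,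
    ← Real.exp_add]
  congr 2; ring

theorem summable_heatTerm_bound {t : ℝ} (ht : 0 < t) :
    Summable (fun m : ℕ => 2 * ((m : ℝ) + 1) ^ 2 * Real.exp (-(2 * t)) ^ m) := by
  have hr : ‖Real.exp (-(2 * t))‖ < 1 := by
    rw [Real.norm_eq_abs, Real.abs_exp]; exact Real.exp_lt_one_iff.2 (by linarith)
  have h2 := summable_pow_mul_geometric_of_norm_lt_one 2 hr
  have h1 := summable_pow_mul_geometric_of_norm_lt_one 1 hr
  have h0 := summable_pow_mul_geometric_of_norm_lt_one 0 hr
  refine (((h2.add (h1.mul_left 2)).add h0).mul_left 2).congr fun m => ?_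
  ring

/-- The spectral series of the subelliptic heat kernel, as a function of the first entry. -/
def heatSeries (t : ℝ) (a : ℂ) : ℂ := ∑' m, heatTerm m t a

theorem hasSum_heatTerm {t : ℝ} (ht : 0 < t) {a : ℂ} (ha : ‖a‖ ≤ 1) :
    HasSum (fun m => heatTerm m t a) (heatSeries t a) :=
  (Summable.of_norm_bounded (summable_heatTerm_bound ht) fun m => norm_heatTerm_le ht ha m).hasSum

theorem continuous_heatSeries_fst {t : ℝ} (ht : 0 < t) :
    Continuous (fun g : SU2 => heatSeries t (SU2.fst g)) :=
  continuous_tsum (fun m => (continuous_heatTerm m t).comp SU2.continuous_fst)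
    (summable_heatTerm_bound ht) fun m g => norm_heatTerm_le ht (SU2.norm_fst_le g) m

/-! ### Moments -/

namespace SU2

theorem integral_comp_verticalExp_mul (ν : Measure SU2) [ν.IsHaarMeasure] (f : SU2 → ℂ) (ψ : ℝ) :
    ∫ g, f (verticalExp ψ * g) ∂ν = ∫ g, f g ∂ν := integral_mul_left_eq_self f _

theorem integral_monomial_of_ne (ν : Measure SU2) [ν.IsHaarMeasure] {i j : ℕ} (hij : i ≠ j) :
    ∫ g, monomial i j 0 g ∂ν = 0 := by
  -- Left translation by `verticalExp ψ` multiplies the monomial by e^{i(i-j)ψ} (with i the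
  -- imaginary unit outside the bracket); this ψ makes the factor -1.
  set ψ : ℝ := Real.pi / ((i : ℝ) - j) with hψ
  have hne : ((i : ℝ) - j) ≠ 0 := sub_ne_zero.2 (by exact_mod_cast hij)
  have h := integral_comp_verticalExp_mul ν (monomial i j 0) ψ
  have hm : ∀ g, monomial i j 0 (verticalExp ψ * g) = - monomial i j 0 g := by
    intro g
    have he : Complex.exp (ψ * Complex.I) ^ i * (starRingEnd ℂ) (Complex.exp (ψ * Complex.I)) ^ j
        = -1 := by
      rw [← Complex.exp_conj, ← Complex.exp_nat_mul, ← Complex.exp_nat_mul, ← Complex.exp_add,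
        ← Complex.exp_pi_mul_I]
      congr 1
      have : (Real.pi : ℂ) = ((i : ℂ) - j) * ψ := by
        have : Real.pi = ((i : ℝ) - j) * ψ := by rw [hψ]; field_simp
        exact_mod_cast this
      rw [this, map_mul, Complex.conj_ofReal, Complex.conj_I]; ring
    simp only [monomial, fst_mul, fst_verticalExp, snd_verticalExp, zero_mul, sub_zero, map_mul,
      mul_pow, pow_zero, mul_one]
    linear_combination (fst g ^ i * (starRingEnd ℂ) (fst g) ^ j) * he
  simp only [hm, integral_neg] at h
  linear_combination (-1 / 2 : ℂ) * h

/-- Conjugation by `verticalExp ψ` preserves the measure, fixes a and rotates b by the angle 2ψ.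
With ψ = π/(2k) the factor bᵏ changes sign, so the integral equals its own negative, whatever Q is.
-/
theorem integral_mul_monomial (ν : Measure SU2) [ν.IsHaarMeasure] (Q : ℂ → ℂ) (i j : ℕ) {k : ℕ}
    (hk : k ≠ 0) : ∫ g, Q (fst g) * monomial i j k g ∂ν = 0 := by
  set ψ : ℝ := Real.pi / (2 * k) with hψ
  have h := integral_comp_verticalExp_mul ν (fun g => Q (fst g) * monomial i j k g) ψ
  rw [← integral_mul_right_eq_self _ (verticalExp (-ψ))] at h
  have h1 : Complex.exp (ψ * Complex.I) * Complex.exp ((-ψ : ℝ) * Complex.I) = 1 := by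
    rw [← Complex.exp_add]; simp
  have hf : ∀ g, fst (verticalExp ψ * (g * verticalExp (-ψ))) = fst g := by
    intro g
    simp only [fst_mul, snd_mul, fst_verticalExp, snd_verticalExp, map_zero, mul_zero, sub_zero,
      zero_mul]
    linear_combination fst g * h1
  have hs : ∀ g, snd (verticalExp ψ * (g * verticalExp (-ψ))) =
      Complex.exp (ψ * Complex.I) ^ 2 * snd g := by
    intro g
    simp only [fst_mul, snd_mul, fst_verticalExp, snd_verticalExp, map_zero, mul_zero, sub_zero,
      zero_mul, ← Complex.exp_conj, map_mul, Complex.conj_ofReal, Complex.conj_I]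
    have : ((-ψ : ℝ) : ℂ) * -Complex.I = ψ * Complex.I := by push_cast; ring
    rw [this]; ring
  have hm : ∀ g, monomial i j k (verticalExp ψ * (g * verticalExp (-ψ))) = - monomial i j k g := by
    intro g
    have he : (Complex.exp (ψ * Complex.I) ^ 2) ^ k = -1 := by
      rw [← pow_mul, ← Complex.exp_nat_mul, ← Complex.exp_pi_mul_I]
      congr 1
      have hk' : (k : ℝ) ≠ 0 := by exact_mod_cast hk
      have : (Real.pi : ℂ) = (2 * k) * ψ := by
        have : Real.pi = (2 * k) * ψ := by rw [hψ]; field_simp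
        exact_mod_cast this
      rw [this]; push_cast; ring
    simp only [monomial, hf, hs, mul_pow]
    linear_combination (fst g ^ i * (starRingEnd ℂ) (fst g) ^ j * snd g ^ k) * he
  simp only [hf, hm, mul_neg, integral_neg] at h
  linear_combination (-1 / 2 : ℂ) * h

theorem integral_mul_conj_monomial (ν : Measure SU2) [ν.IsHaarMeasure] (Q : ℂ → ℂ) (i j : ℕ) {k : ℕ}
    (hk : k ≠ 0) : ∫ g, Q (fst g) * (starRingEnd ℂ) (monomial i j k g) ∂ν = 0 := by
  have h := integral_mul_monomial ν (fun a => (starRingEnd ℂ) (Q a)) i j hk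
  have h2 := congrArg (starRingEnd ℂ) h
  rw [← integral_conj] at h2
  simpa using h2

theorem conj_monomial_zero (i j : ℕ) (g : SU2) :
    (starRingEnd ℂ) (monomial i j 0 g) = monomial j i 0 g := by
  simp [monomial, mul_comm]

theorem integrable_monomial (ν : Measure SU2) [ν.IsHaarMeasure] (i j k : ℕ) :
    Integrable (monomial i j k) ν := integrable_of_continuous ν (continuous_monomial i j k)

/-- L of a smooth function has integral zero; for |a|^{2(i+1)} the triangular formula makes this a
two-term recursion. -/
theorem integral_monomial_succ (ν : Measure SU2) [ν.IsHaarMeasure] (i : ℕ) :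
    ((i : ℂ) + 2) * ∫ g, monomial (i + 1) (i + 1) 0 g ∂ν = (i + 1) * ∫ g, monomial i i 0 g ∂ν := by
  have h := fun φ : ℂ →L[ℝ] ℝ => integral_subLaplacian ν (smooth_monomial φ (i + 1) (i + 1) 0)
  simp only [subLaplacian_monomial, Nat.add_sub_cancel] at h
  have hint : Integrable (fun g => (-(2 * (((i + 1 : ℕ) : ℂ) + ((i + 1 : ℕ) : ℂ) + ((0 : ℕ) : ℂ)) +
      4 * ((i + 1 : ℕ) : ℂ) * ((0 : ℕ) : ℂ) + 4 * ((i + 1 : ℕ) : ℂ) * ((i + 1 : ℕ) : ℂ))) *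
        monomial (i + 1) (i + 1) 0 g
        + 4 * ((i + 1 : ℕ) : ℂ) * ((i + 1 : ℕ) : ℂ) * monomial i i 0 g) ν :=
    ((integrable_monomial ν _ _ _).const_mul _).add ((integrable_monomial ν _ _ _).const_mul _)
  have h2 := fun φ : ℂ →L[ℝ] ℝ => (φ.integral_comp_comm hint).symm.trans (h φ)
  have h3 := Complex.ext (z := _) (w := 0) (h2 Complex.reCLM) (h2 Complex.imCLM)
  rw [integral_add ((integrable_monomial ν _ _ _).const_mul _)
    ((integrable_monomial ν _ _ _).const_mul _), integral_const_mul, integral_const_mul] at h3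
  push_cast at h3
  have hi : ((i : ℂ) + 1) ≠ 0 := by exact_mod_cast Nat.succ_ne_zero i
  apply mul_left_cancel₀ hi
  linear_combination (-1 / 4 : ℂ) * h3

theorem integral_monomial_self (ν : Measure SU2) [ν.IsHaarMeasure] (i : ℕ) :
    ∫ g, monomial i i 0 g ∂ν = ν.real univ / (i + 1) := by
  induction i with
  | zero => simp [monomial]
  | succ i ih =>
    have h := integral_monomial_succ ν i
    have h1 : ((i : ℂ) + 1) ≠ 0 := by exact_mod_cast Nat.succ_ne_zero i
    have h2 : ((i : ℂ) + 2) ≠ 0 := by exact_mod_cast Nat.succ_ne_zero (i + 1)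
    rw [ih, mul_div_cancel₀ _ h1] at h
    push_cast
    rw [show (i : ℂ) + 1 + 1 = i + 2 by ring, eq_div_iff h2, mul_comm, h]

theorem mul_conj_mul_monomial (i j k : ℕ) (g : SU2) :
    fst g * monomial i j k g = monomial (i + 1) j k g ∧
    (starRingEnd ℂ) (fst g) * monomial i j k g = monomial i (j + 1) k g := by
  constructor <;> simp only [monomial, pow_succ] <;> ring

open Nat in
/-- The inner products of disk polynomials with monomials. -/
theorem integral_diskPoly_mul_monomial (ν : Measure SU2) [ν.IsHaarMeasure] (α β i j : ℕ) :
    ∫ g, diskPoly α β (fst g) * monomial i j 0 g ∂ν =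
      (if α + i = β + j ∧ β ≤ i then
        (ν.real univ : ℂ) * (i ! * j !) / ((i - β)! * (i + α + 1)!) else 0 : ℂ) := by
  induction hn : α + β using Nat.strong_induction_on generalizing α β i j with
  | _ n ih =>
    rcases β with _ | β
    · have : ∀ g, diskPoly α 0 (fst g) * monomial i j 0 g = monomial (α + i) j 0 g := by
        intro g; rw [diskPoly_zero_right]; simp only [monomial, pow_add]; ring
      simp only [this]
      by_cases h : α + i = j
      · subst h
        rw [integral_monomial_self]
        simp only [zero_add, true_and, zero_le, if_true, Nat.sub_zero]
        rw [show i + α + 1 = (α + i) + 1 by ring, Nat.factorial_succ]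
        have := Nat.factorial_ne_zero i
        have := Nat.factorial_ne_zero (α + i)
        push_cast
        have h3 : ((α : ℂ) + i + 1) ≠ 0 := by exact_mod_cast Nat.succ_ne_zero (α + i)
        field_simp
      · rw [integral_monomial_of_ne ν h, if_neg (by omega)]
    rcases α with _ | α
    · have : ∀ g, diskPoly 0 (β + 1) (fst g) * monomial i j 0 g = monomial i (β + 1 + j) 0 g := by
        intro g; rw [diskPoly_zero_left]; simp only [monomial, pow_add]; ring
      simp only [this]
      by_cases h : i = β + 1 + j
      · subst h
        rw [integral_monomial_self, if_pos (by omega), Nat.add_zero, Nat.add_sub_cancel_left,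
          Nat.factorial_succ (β + 1 + j)]
        have := Nat.factorial_ne_zero j
        have := Nat.factorial_ne_zero (β + 1 + j)
        have h3 : (((β + 1 + j : ℕ) : ℂ) + 1) ≠ 0 := by
          exact_mod_cast Nat.succ_ne_zero (β + 1 + j)
        push_cast at h3 ⊢
        field_simp
      · rw [integral_monomial_of_ne ν h, if_neg (by omega)]
    have hint : ∀ α β i j, Integrable (fun g => diskPoly α β (fst g) * monomial i j 0 g) ν :=
      fun α β i j => integrable_of_continuous ν
        (((continuous_diskPoly α β).comp continuous_fst).mul (continuous_monomial i j 0))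
    have hrec : ∀ g, diskPoly (α + 1) (β + 1) (fst g) * monomial i j 0 g =
        diskPoly α (β + 1) (fst g) * monomial (i + 1) j 0 g +
        diskPoly (α + 1) β (fst g) * monomial i (j + 1) 0 g -
        diskPoly α β (fst g) * monomial i j 0 g := by
      intro g
      rw [diskPoly_succ_succ, ← (mul_conj_mul_monomial i j 0 g).1,
        ← (mul_conj_mul_monomial i j 0 g).2]
      ring
    simp only [hrec]
    have hadd : Integrable (fun g => diskPoly α (β + 1) (fst g) * monomial (i + 1) j 0 g +
        diskPoly (α + 1) β (fst g) * monomial i (j + 1) 0 g) ν := (hint _ _ _ _).add (hint _ _ _ _)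
    rw [integral_sub hadd (hint _ _ _ _),
      integral_add (hint _ _ _ _) (hint _ _ _ _), ih _ (by omega) α (β + 1) (i + 1) j rfl,
      ih _ (by omega) (α + 1) β i (j + 1) rfl, ih _ (by omega) α β i j rfl]
    by_cases h : α + i = β + j
    swap
    · rw [if_neg (by omega), if_neg (by omega), if_neg (by omega), if_neg (by omega)]; simp
    by_cases hb : β ≤ i
    swap
    · rw [if_neg (by omega), if_neg (by omega), if_neg (by omega), if_neg (by omega)]; simp
    obtain ⟨k, rfl⟩ := Nat.exists_eq_add_of_le hb
    obtain rfl : j = α + k := by omega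
    rw [if_pos (by omega), if_pos (by omega), if_pos (by omega)]
    have e1 : β + k + 1 - (β + 1) = k := by omega
    have e2 : β + k - β = k := by omega
    have e3 : β + k + 1 + α + 1 = β + k + α + 1 + 1 := by omega
    have e4 : β + k + (α + 1) + 1 = β + k + α + 1 + 1 := by omega
    rw [e1, e2, e3, e4, Nat.factorial_succ (β + k), Nat.factorial_succ (α + k),
      Nat.factorial_succ (β + k + α + 1)]
    have f1 := Nat.factorial_ne_zero k
    have f2 := Nat.factorial_ne_zero (β + k + α + 1)
    have f3 : ((β : ℂ) + k + α + 1 + 1) ≠ 0 := by exact_mod_cast Nat.succ_ne_zero (β + k + α + 1)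
    -- When k = 0 the monomial has degree just too low: the three contributions of the recursion
    -- cancel, which is the orthogonality. For k > 0 they combine to the closed form.
    rcases k with _ | k
    · rw [if_neg (by omega)]
      push_cast at f3 ⊢
      field_simp
      ring
    · rw [if_pos (by omega)]
      have e5 : β + (k + 1) - (β + 1) = k := by omega
      rw [e5, Nat.factorial_succ k]
      have f4 := Nat.factorial_ne_zero k
      have f5 : ((k : ℂ) + 1) ≠ 0 := by exact_mod_cast Nat.succ_ne_zero k
      push_cast at f3 ⊢
      field_simp
      ring

end SU2

/-- Multiplying by e^{ct} gives a function constant on (0, ∞) with limit zero at 0⁺. Only the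
one-sided limit is available as initial condition. -/
theorem eq_zero_of_hasDerivAt_neg_mul {u : ℝ → ℂ} {c : ℂ}
    (h : ∀ t > 0, HasDerivAt u (-c * u t) t) (h0 : Tendsto u (𝓝[>] 0) (𝓝 0)) {t : ℝ} (ht : 0 < t) :
    u t = 0 := by
  set w : ℝ → ℂ := fun t => Complex.exp (c * t) * u t with hw
  have hE : ∀ t : ℝ, HasDerivAt (fun t : ℝ => Complex.exp (c * t)) (Complex.exp (c * t) * c) t := by
    intro t
    have := ((hasDerivAt_id (t : ℂ)).const_mul c).cexp.comp_ofReal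
    simpa using this
  have hd : ∀ t > 0, HasDerivAt w 0 t := by
    intro t ht
    refine ((hE t).mul (h t ht)).congr_deriv ?_
    ring
  have hw0 : Tendsto w (𝓝[>] 0) (𝓝 0) := by
    have h1 : Tendsto (fun t : ℝ => Complex.exp (c * t)) (𝓝[>] 0) (𝓝 (Complex.exp (c * (0 : ℝ)))) :=
      ((hE 0).continuousAt.tendsto).mono_left nhdsWithin_le_nhds
    simpa using h1.mul h0
  have hconst : ∀ s > 0, w s = w t := by
    intro s hs
    refine isOpen_Ioi.is_const_of_deriv_eq_zero (s := Ioi (0 : ℝ)) isPreconnected_Ioi ?_ ?_ hs ht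
    · exact fun x hx => (hd x hx).differentiableAt.differentiableWithinAt
    · exact fun x hx => (hd x hx).deriv
  have hc : Tendsto w (𝓝[>] 0) (𝓝 (w t)) :=
    tendsto_const_nhds.congr' (by
      filter_upwards [self_mem_nhdsWithin] with s hs using (hconst s hs).symm)
  have := tendsto_nhds_unique hc hw0
  simpa [hw, Complex.exp_ne_zero] using this

/-! ### Moments of the spectral series -/

open Nat in
/-- Coefficients of the moments of the spectral series. -/
def momentCoeff (i j k : ℕ) : ℂ :=
  (((i - k : ℕ) : ℂ) + (j - k : ℕ) + 1) * (i ! * j !) / (k ! * (i + (j - k) + 1)!)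

/-- The eigenvalue of `-L` attached to the disk polynomial of index `(α, β)`. -/
def diskEigenvalue (α β : ℕ) : ℝ := 2 * (α + β) + 4 * α * β

/-- The moments of the spectral series. -/
def momentSeries (i j : ℕ) (t : ℝ) : ℂ :=
  ∑ k ∈ Finset.range (min i j + 1),
    momentCoeff i j k * Real.exp (-diskEigenvalue (j - k) (i - k) * t)

theorem hasDerivAt_exp_neg_mul (c t : ℝ) :
    HasDerivAt (fun t : ℝ => (Real.exp (-c * t) : ℂ)) (-c * Real.exp (-c * t)) t := by
  have := ((hasDerivAt_id t).const_mul (-c)).exp.ofReal_comp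
  refine this.congr_deriv ?_
  simp; ring

-- This is the coefficient comparison that makes `momentSeries` solve the triangular system
-- satisfied by the moments of p_t.
open Nat in
theorem momentCoeff_succ {i j k : ℕ} (hi : k ≤ i) (hj : k ≤ j) :
    ((diskEigenvalue (j + 1) (i + 1) : ℂ) - diskEigenvalue (j - k) (i - k)) *
      momentCoeff (i + 1) (j + 1) (k + 1) = 4 * (i + 1) * (j + 1) * momentCoeff i j k := by
  obtain ⟨α, rfl⟩ := Nat.exists_eq_add_of_le hj
  obtain ⟨β, rfl⟩ := Nat.exists_eq_add_of_le hi
  have e1 : k + α + 1 - (k + 1) = α := by omega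
  have e2 : k + β + 1 - (k + 1) = β := by omega
  simp only [momentCoeff, diskEigenvalue, e1, e2, Nat.add_sub_cancel_left]
  have e3 : k + β + 1 + α + 1 = k + β + α + 1 + 1 := by omega
  rw [e3, Nat.factorial_succ (k + β), Nat.factorial_succ (k + α), Nat.factorial_succ k,
    Nat.factorial_succ (k + β + α + 1)]
  have f1 := Nat.factorial_ne_zero k
  have f2 := Nat.factorial_ne_zero (k + β + α + 1)
  have f3 : ((k : ℂ) + β + α + 1 + 1) ≠ 0 := by exact_mod_cast Nat.succ_ne_zero (k + β + α + 1)
  have f4 : ((k : ℂ) + 1) ≠ 0 := by exact_mod_cast Nat.succ_ne_zero k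
  push_cast
  field_simp
  ring

theorem hasDerivAt_momentSeries_succ (i j : ℕ) (t : ℝ) :
    HasDerivAt (momentSeries (i + 1) (j + 1))
      (-(diskEigenvalue (j + 1) (i + 1)) * momentSeries (i + 1) (j + 1) t +
        4 * (i + 1) * (j + 1) * momentSeries i j t) t := by
  have hd : HasDerivAt (momentSeries (i + 1) (j + 1))
      (∑ k ∈ Finset.range (min (i + 1) (j + 1) + 1), momentCoeff (i + 1) (j + 1) k *
        (-diskEigenvalue (j + 1 - k) (i + 1 - k) *
          Real.exp (-diskEigenvalue (j + 1 - k) (i + 1 - k) * t))) t :=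
    HasDerivAt.fun_sum fun k _ => (hasDerivAt_exp_neg_mul _ t).const_mul _
  refine hd.congr_deriv ?_
  have hm : min (i + 1) (j + 1) = min i j + 1 := by omega
  simp only [momentSeries, hm]
  -- The term k = 0 has exactly the eigenvalue of the homogeneous equation; the terms k + 1 match
  -- the k-th terms of the lower series.
  rw [Finset.sum_range_succ', Finset.sum_range_succ' (n := min i j + 1), mul_add, Finset.mul_sum,
    Finset.mul_sum, add_right_comm, ← Finset.sum_add_distrib]
  congr 1
  · refine Finset.sum_congr rfl fun k hk => ?_
    have hk' := Finset.mem_range.1 hk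
    have h := momentCoeff_succ (i := i) (j := j) (k := k) (by omega) (by omega)
    simp only [Nat.add_sub_add_right]
    rw [← mul_assoc (4 * ((i : ℂ) + 1) * (j + 1)), ← h]
    ring
  · simp only [Nat.sub_zero]; ring

open Nat in
theorem momentSeries_of_eq_zero {i j : ℕ} (h : i = 0 ∨ j = 0) (t : ℝ) :
    momentSeries i j t = Real.exp (-diskEigenvalue j i * t) := by
  have hm : min i j = 0 := by omega
  have hc : momentCoeff i j 0 = 1 := by
    have f1 := Nat.factorial_ne_zero i
    have f2 := Nat.factorial_ne_zero j
    rcases h with rfl | rfl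
    · have f3 : ((j : ℂ) + 1) ≠ 0 := by exact_mod_cast Nat.succ_ne_zero j
      simp [momentCoeff, Nat.factorial_succ]
      exact ⟨f3, f2⟩
    · have f3 : ((i : ℂ) + 1) ≠ 0 := by exact_mod_cast Nat.succ_ne_zero i
      simp [momentCoeff, Nat.factorial_succ]
      exact ⟨f3, f1⟩
  simp [momentSeries, hm, hc]

-- The partial sums have a closed form, which makes the induction go through. At n = min(i, j) it
-- equals 1, the value at the identity of the monomial aⁱ āʲ.
open Nat in
theorem sum_momentCoeff_partial (i j n : ℕ) (hi : n ≤ i) (hj : n ≤ j) :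
    ∑ k ∈ Finset.range (n + 1), momentCoeff i j k =
      (i ! * j ! : ℂ) / (n ! * (i + (j - n))!) := by
  induction n with
  | zero =>
    simp only [zero_add, Finset.sum_range_one, momentCoeff, Nat.sub_zero, Nat.factorial_succ (i + j)]
    have f1 := Nat.factorial_ne_zero (i + j)
    have f3 : ((i : ℂ) + j + 1) ≠ 0 := by exact_mod_cast Nat.succ_ne_zero (i + j)
    push_cast
    field_simp
  | succ n ih =>
    rw [Finset.sum_range_succ, ih (by omega) (by omega)]
    obtain ⟨α, rfl⟩ := Nat.exists_eq_add_of_le hj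
    obtain ⟨β, rfl⟩ := Nat.exists_eq_add_of_le hi
    have e1 : n + 1 + α - n = α + 1 := by omega
    simp only [momentCoeff, Nat.add_sub_cancel_left, e1]
    have e2 : n + 1 + β + (α + 1) = n + 1 + β + α + 1 := by omega
    rw [e2, Nat.factorial_succ (n + 1 + β + α), Nat.factorial_succ n]
    have f1 := Nat.factorial_ne_zero n
    have f2 := Nat.factorial_ne_zero (n + 1 + β + α)
    have f3 : ((n : ℂ) + 1 + β + α + 1) ≠ 0 := by exact_mod_cast Nat.succ_ne_zero (n + 1 + β + α)
    have f4 : ((n : ℂ) + 1) ≠ 0 := by exact_mod_cast Nat.succ_ne_zero n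
    push_cast
    field_simp
    ring

theorem momentSeries_zero (i j : ℕ) : momentSeries i j 0 = 1 := by
  simp only [momentSeries, mul_zero, Real.exp_zero, Complex.ofReal_one, mul_one]
  rw [sum_momentCoeff_partial i j (min i j) (min_le_left _ _) (min_le_right _ _)]
  have f1 := Nat.factorial_ne_zero i
  have f2 := Nat.factorial_ne_zero j
  rcases le_total i j with h | h
  · rw [min_eq_left h, Nat.add_sub_cancel' h]
    exact div_self (by exact_mod_cast mul_ne_zero f1 f2)
  · rw [min_eq_right h, Nat.sub_self, Nat.add_zero, mul_comm (j.factorial : ℂ)]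
    exact div_self (by exact_mod_cast mul_ne_zero f1 f2)

theorem continuous_momentSeries (i j : ℕ) : Continuous (momentSeries i j) := by
  unfold momentSeries; fun_prop

namespace SU2

variable (ν : Measure SU2) [ν.IsHaarMeasure]

theorem integral_heatTerm_mul_monomial (m i j : ℕ) (t : ℝ) :
    ∫ g, heatTerm m t (fst g) * monomial i j 0 g ∂ν =
      ∑ x ∈ Finset.HasAntidiagonal.antidiagonal m,
        ((x.1 : ℂ) + x.2 + 1) * Real.exp (-diskEigenvalue x.1 x.2 * t) *
          ∫ g, diskPoly x.1 x.2 (fst g) * monomial i j 0 g ∂ν := by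
  have hpt : ∀ g, heatTerm m t (fst g) * monomial i j 0 g =
      ∑ x ∈ Finset.HasAntidiagonal.antidiagonal m,
        ((x.1 : ℂ) + x.2 + 1) * Real.exp (-diskEigenvalue x.1 x.2 * t) *
          (diskPoly x.1 x.2 (fst g) * monomial i j 0 g) := by
    intro g
    rw [heatTerm, Finset.mul_sum, Finset.sum_mul]
    refine Finset.sum_congr rfl fun x hx => ?_
    have hm : x.1 + x.2 = m := Finset.HasAntidiagonal.mem_antidiagonal.1 hx
    -- For α + β = m one has m(m+2) - (β-α)² = 2(α+β) + 4αβ.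
    have he : Real.exp (-diskEigenvalue x.1 x.2 * t) =
        Real.exp (-(m * (m + 2)) * t) * Real.exp (((x.2 : ℝ) - x.1) ^ 2 * t) := by
      rw [← Real.exp_add, ← hm]
      congr 1
      simp only [diskEigenvalue]
      push_cast
      ring
    rw [he, ← hm]
    push_cast
    ring
  simp only [hpt]
  rw [integral_finsetSum]
  · simp only [integral_const_mul]
  · intro x _
    refine integrable_of_continuous ν ?_
    exact Continuous.mul (f := fun _ => _) continuous_const
      (((continuous_diskPoly x.1 x.2).comp continuous_fst).mul (continuous_monomial i j 0))

theorem hasSum_integral_heatTerm_mul {t : ℝ} (ht : 0 < t) (f : SU2 → ℂ) (hf : Continuous f) :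
    HasSum (fun m => ∫ g, heatTerm m t (fst g) * f g ∂ν) (∫ g, heatSeries t (fst g) * f g ∂ν) := by
  obtain ⟨C, hC⟩ := (isCompact_univ (X := SU2)).exists_bound_of_continuousOn hf.continuousOn
  have hC0 : 0 ≤ C := (norm_nonneg _).trans (hC 1 (mem_univ _))
  have hint : ∀ m, Integrable (fun g => heatTerm m t (fst g) * f g) ν := fun m =>
    integrable_of_continuous ν (((continuous_heatTerm m t).comp continuous_fst).mul hf)
  have hb : ∀ m, ∫ g, ‖heatTerm m t (fst g) * f g‖ ∂ν ≤
      2 * ((m : ℝ) + 1) ^ 2 * Real.exp (-(2 * t)) ^ m * (C * ν.real univ) := by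
    intro m
    have : ∀ g, ‖heatTerm m t (fst g) * f g‖ ≤ 2 * ((m : ℝ) + 1) ^ 2 * Real.exp (-(2 * t)) ^ m * C :=
      fun g => by
        rw [norm_mul]
        exact mul_le_mul (norm_heatTerm_le ht (norm_fst_le g) m) (hC g (mem_univ _))
          (norm_nonneg _) (by positivity)
    refine (integral_mono (hint m).norm (integrable_const _) this).trans (le_of_eq ?_)
    rw [integral_const, smul_eq_mul]; ring
  have h := hasSum_integral_of_summable_integral_norm hint
    (Summable.of_nonneg_of_le (fun m => integral_nonneg fun g => norm_nonneg _) hb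
      ((summable_heatTerm_bound ht).mul_right _))
  have he : (fun g => ∑' m, heatTerm m t (fst g) * f g) = fun g => heatSeries t (fst g) * f g :=
    funext fun g => tsum_mul_right
  rwa [he] at h

/-- Orthogonality leaves only the finitely many indices (α, β) = (j - k, i - k) with k ≤ min(i, j);
the levels m are regrouped as one sum over all pairs. -/
theorem integral_heatSeries_mul_monomial {t : ℝ} (ht : 0 < t) (i j : ℕ) :
    ∫ g, heatSeries t (fst g) * monomial i j 0 g ∂ν = ν.real univ * momentSeries i j t := by
  have h := hasSum_integral_heatTerm_mul ν ht _ (continuous_monomial i j 0)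
  simp only [integral_heatTerm_mul_monomial] at h
  set F : ℕ × ℕ → ℂ := fun x => ((x.1 : ℂ) + x.2 + 1) * Real.exp (-diskEigenvalue x.1 x.2 * t) *
          ∫ g, diskPoly x.1 x.2 (fst g) * monomial i j 0 g ∂ν with hF
  set S := (Finset.range (min i j + 1)).image (fun k => (j - k, i - k)) with hS
  have h1 : HasSum F (∑ x ∈ S, F x) := by
    refine hasSum_sum_of_ne_finset_zero fun x hx => ?_
    rw [hF]
    simp only
    rw [integral_diskPoly_mul_monomial, if_neg, mul_zero]
    rintro ⟨h1, h2⟩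
    apply hx
    rw [hS, Finset.mem_image]
    exact ⟨i - x.2, by simp; omega, Prod.ext (by simp; omega) (by simp; omega)⟩
  have h2 := (Finset.HasAntidiagonal.sigmaAntidiagonalEquivProd (A := ℕ)).hasSum_iff.2 h1
  have h3 := h2.sigma (fun m => hasSum_fintype _)
  have h4 : (fun m => ∑ c : Finset.HasAntidiagonal.antidiagonal m,
      (F ∘ Finset.HasAntidiagonal.sigmaAntidiagonalEquivProd) ⟨m, c⟩) =
      fun m => ∑ x ∈ Finset.HasAntidiagonal.antidiagonal m, F x := by
    funext m
    exact Finset.sum_coe_sort (Finset.HasAntidiagonal.antidiagonal m) F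
  rw [h4] at h3
  rw [h.unique h3, hS, Finset.sum_image, momentSeries, Finset.mul_sum]
  · refine Finset.sum_congr rfl fun k hk => ?_
    have hk' := Finset.mem_range.1 hk
    simp only [hF]
    rw [integral_diskPoly_mul_monomial, if_pos (by omega), momentCoeff]
    have : i - (i - k) = k := by omega
    rw [this]
    ring
  · intro k hk l hl hkl
    have hk' := Finset.mem_range.1 hk
    have hl' := Finset.mem_range.1 hl
    simp only [Prod.mk.injEq] at hkl
    omega

end SU2

/-! ### Density of polynomials and uniqueness -/

namespace SU2

/-- The real coordinate functions. -/
def realCoord : Fin 4 → C(SU2, ℝ) :=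
  ![⟨fun g => (fst g).re, Complex.continuous_re.comp continuous_fst⟩,
    ⟨fun g => (fst g).im, Complex.continuous_im.comp continuous_fst⟩,
    ⟨fun g => (snd g).re, Complex.continuous_re.comp continuous_snd⟩,
    ⟨fun g => (snd g).im, Complex.continuous_im.comp continuous_snd⟩]

/-- The algebra of real polynomial functions on `SU(2)`. -/
def polyAlgebra : Subalgebra ℝ C(SU2, ℝ) := Algebra.adjoin ℝ (range realCoord)

theorem realCoord_mem (i : Fin 4) : realCoord i ∈ polyAlgebra :=
  Algebra.subset_adjoin (mem_range_self i)

theorem separatesPoints_polyAlgebra : polyAlgebra.SeparatesPoints := by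
  intro g h hgh
  by_contra hcon
  have hc : ∀ i, realCoord i g = realCoord i h := by
    intro i
    by_contra hne
    exact hcon ⟨realCoord i, ⟨realCoord i, realCoord_mem i, rfl⟩, hne⟩
  exact hgh (ext_coord (Complex.ext (hc 0) (hc 1)) (Complex.ext (hc 2) (hc 3)))

theorem exists_poly_near (f : C(SU2, ℝ)) {ε : ℝ} (hε : 0 < ε) :
    ∃ P ∈ polyAlgebra, ∀ g, |P g - f g| < ε := by
  obtain ⟨P, hP⟩ := ContinuousMap.exists_mem_subalgebra_near_continuousMap_of_separatesPoints
    polyAlgebra separatesPoints_polyAlgebra f ε hε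
  refine ⟨P, P.2, fun g => ?_⟩
  have := ((P : C(SU2, ℝ)) - f).norm_coe_le_norm g
  exact this.trans_lt hP

/-- Monomials in all four coordinates. -/
def monomial₄ (i j k l : ℕ) (g : SU2) : ℂ := monomial i j k g * (starRingEnd ℂ) (snd g) ^ l

theorem continuous_monomial₄ (i j k l : ℕ) : Continuous (monomial₄ i j k l) :=
  (continuous_monomial i j k).mul ((Complex.continuous_conj.comp continuous_snd).pow l)

/-- Trading b b̄ for 1 - a ā reduces every monomial to one free of b or of b̄, that is, to a
`monomial` or a conjugate of one. -/
theorem monomial₄_succ_succ (i j k l : ℕ) (g : SU2) :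
    monomial₄ i j (k + 1) (l + 1) g = monomial₄ i j k l g - monomial₄ (i + 1) (j + 1) k l g := by
  have h := normSq_fst_add_snd g
  simp only [monomial₄, monomial, pow_succ]
  linear_combination (fst g ^ i * (starRingEnd ℂ) (fst g) ^ j * snd g ^ k *
    (starRingEnd ℂ) (snd g) ^ l) * h

theorem monomial₄_zero_left (i j l : ℕ) (g : SU2) :
    monomial₄ i j 0 l g = (starRingEnd ℂ) (monomial j i l g) := by
  simp only [monomial₄, monomial, map_mul, map_pow, Complex.conj_conj, pow_zero, mul_one]; ring

/-- The span of the monomials. -/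
def monoSpan : Submodule ℂ (SU2 → ℂ) :=
  Submodule.span ℂ (range fun x : ℕ × ℕ × ℕ × ℕ => monomial₄ x.1 x.2.1 x.2.2.1 x.2.2.2)

theorem monomial₄_mem (i j k l : ℕ) : monomial₄ i j k l ∈ monoSpan :=
  Submodule.subset_span ⟨(i, j, k, l), rfl⟩

theorem mul_mem_monoSpan {f h : SU2 → ℂ} (hf : f ∈ monoSpan) (hh : h ∈ monoSpan) :
    f * h ∈ monoSpan := by
  have hle : monoSpan * monoSpan ≤ monoSpan := by
    rw [monoSpan, Submodule.span_mul_span]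
    refine Submodule.span_le.2 ?_
    rintro _ ⟨_, ⟨x, rfl⟩, _, ⟨y, rfl⟩, rfl⟩
    refine Submodule.subset_span ⟨(x.1 + y.1, x.2.1 + y.2.1, x.2.2.1 + y.2.2.1,
      x.2.2.2 + y.2.2.2), ?_⟩
    funext g
    simp only [monomial₄, monomial, pow_add, Pi.mul_apply]
    ring
  exact hle (Submodule.mul_mem_mul hf hh)

theorem polyAlgebra_mem_monoSpan {P : C(SU2, ℝ)} (hP : P ∈ polyAlgebra) :
    (fun g => (P g : ℂ)) ∈ monoSpan := by
  have hone : ∀ c : ℂ, (fun _ : SU2 => c) ∈ monoSpan := by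
    intro c
    have h := monoSpan.smul_mem c (monomial₄_mem 0 0 0 0)
    have he : (c • monomial₄ 0 0 0 0) = fun _ : SU2 => c := by
      funext g; simp [monomial₄, monomial]
    rwa [he] at h
  refine Algebra.adjoin_induction (p := fun P _ => (fun g => (P g : ℂ)) ∈ monoSpan)
    ?_ ?_ ?_ ?_ hP
  · rintro _ ⟨i, rfl⟩
    have ha := monomial₄_mem 1 0 0 0
    have hA := monomial₄_mem 0 1 0 0
    have hb := monomial₄_mem 0 0 1 0
    have hB := monomial₄_mem 0 0 0 1
    have hre : ∀ z : ℂ, (z.re : ℂ) = (1 / 2) * (z + (starRingEnd ℂ) z) := fun z => by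
      rw [Complex.add_conj]; push_cast; ring
    have him : ∀ z : ℂ, (z.im : ℂ) = (-Complex.I / 2) * (z + (-1) * (starRingEnd ℂ) z) := fun z => by
      rw [neg_one_mul, ← sub_eq_add_neg, Complex.sub_conj]
      push_cast
      linear_combination ((z.im : ℂ)) * Complex.I_sq
    fin_cases i
    · have h := monoSpan.smul_mem (1 / 2) (monoSpan.add_mem ha hA)
      convert h using 1
      funext g
      simp [realCoord, hre, monomial₄, monomial]
    · have h := monoSpan.smul_mem (-Complex.I / 2)
        (monoSpan.add_mem ha (monoSpan.smul_mem (-1) hA))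
      convert h using 1
      funext g
      simp [realCoord, him, monomial₄, monomial]
    · have h := monoSpan.smul_mem (1 / 2) (monoSpan.add_mem hb hB)
      convert h using 1
      funext g
      simp [realCoord, hre, monomial₄, monomial]
    · have h := monoSpan.smul_mem (-Complex.I / 2)
        (monoSpan.add_mem hb (monoSpan.smul_mem (-1) hB))
      convert h using 1
      funext g
      simp [realCoord, him, monomial₄, monomial]
  · intro r
    exact hone r
  · intro x y _ _ hx hy
    convert monoSpan.add_mem hx hy using 1
    funext g; simp
  · intro x y _ _ hx hy
    convert mul_mem_monoSpan hx hy using 1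
    funext g; simp

variable {ν : Measure SU2} {D : SU2 → ℂ}

theorem Integrable.mul_continuous (hD : Integrable D ν) {f : SU2 → ℂ} (hf : Continuous f) :
    Integrable (fun g => D g * f g) ν := by
  obtain ⟨C, hC⟩ := (isCompact_univ (X := SU2)).exists_bound_of_continuousOn hf.continuousOn
  exact hD.mul_bdd hf.aestronglyMeasurable (c := C)
    (Eventually.of_forall fun g => hC g (mem_univ g))

/-- Induction on the exponent of b, lowering the exponents of b and b̄ together until one is zero.
-/
theorem integral_mul_eq_zero_of_mem_monoSpan (hD : Integrable D ν)
    (h : ∀ i j k, ∫ g, D g * monomial i j k g ∂ν = 0)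
    (h' : ∀ i j k, ∫ g, D g * (starRingEnd ℂ) (monomial i j k g) ∂ν = 0) {f : SU2 → ℂ}
    (hf : f ∈ monoSpan) : Continuous f ∧ ∫ g, D g * f g ∂ν = 0 := by
  have hm : ∀ k i j l, ∫ g, D g * monomial₄ i j k l g ∂ν = 0 := by
    intro k
    induction k with
    | zero => intro i j l; simp only [monomial₄_zero_left]; exact h' _ _ _
    | succ k ih =>
      intro i j l
      rcases l with _ | l
      · simpa [monomial₄] using h i j (k + 1)
      · simp only [monomial₄_succ_succ, mul_sub]
        rw [integral_sub (Integrable.mul_continuous hD (continuous_monomial₄ _ _ _ _))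
          (Integrable.mul_continuous hD (continuous_monomial₄ _ _ _ _)), ih, ih, sub_zero]
  refine Submodule.span_induction (p := fun f _ => Continuous f ∧ ∫ g, D g * f g ∂ν = 0)
    ?_ ?_ ?_ ?_ hf
  · rintro _ ⟨x, rfl⟩
    exact ⟨continuous_monomial₄ _ _ _ _, hm _ _ _ _⟩
  · exact ⟨continuous_zero, by simp⟩
  · intro x y _ _ hx hy
    refine ⟨hx.1.add hy.1, ?_⟩
    simp only [Pi.add_apply, mul_add]
    rw [integral_add (Integrable.mul_continuous hD hx.1) (Integrable.mul_continuous hD hy.1),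
      hx.2, hy.2, add_zero]
  · intro c x _ hx
    refine ⟨continuous_const.smul hx.1, ?_⟩
    simp only [Pi.smul_apply, smul_eq_mul, mul_left_comm _ c]
    rw [integral_const_mul, hx.2, mul_zero]

/-- Real polynomials are uniformly dense in the continuous functions by Stone-Weierstrass, and
pairing with an integrable D is continuous for the uniform norm. -/
theorem integral_mul_continuous_eq_zero (hD : Integrable D ν)
    (h : ∀ i j k, ∫ g, D g * monomial i j k g ∂ν = 0)
    (h' : ∀ i j k, ∫ g, D g * (starRingEnd ℂ) (monomial i j k g) ∂ν = 0) (f : C(SU2, ℝ)) :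
    ∫ g, D g * (f g : ℂ) ∂ν = 0 := by
  have hb : ∀ ε > 0, ‖∫ g, D g * (f g : ℂ) ∂ν‖ ≤ ε * ∫ g, ‖D g‖ ∂ν := by
    intro ε hε
    obtain ⟨P, hP, hPf⟩ := exists_poly_near f hε
    obtain ⟨hPc, hP0⟩ := integral_mul_eq_zero_of_mem_monoSpan hD h h' (polyAlgebra_mem_monoSpan hP)
    have hfc : Continuous (fun g => (f g : ℂ)) := Complex.continuous_ofReal.comp f.continuous
    rw [← sub_zero (∫ g, D g * (f g : ℂ) ∂ν), ← hP0,
      ← integral_sub (Integrable.mul_continuous hD hfc) (Integrable.mul_continuous hD hPc),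
      ← integral_const_mul]
    refine norm_integral_le_of_norm_le (hD.norm.const_mul _) (Eventually.of_forall fun g => ?_)
    rw [← mul_sub, norm_mul, mul_comm, ← Complex.ofReal_sub, Complex.norm_real, Real.norm_eq_abs,
      abs_sub_comm]
    exact mul_le_mul_of_nonneg_right (hPf g).le (norm_nonneg _)
  have hlim : Tendsto (fun ε : ℝ => ε * ∫ g, ‖D g‖ ∂ν) (𝓝[>] 0) (𝓝 (0 * ∫ g, ‖D g‖ ∂ν)) :=
    ((continuous_id.mul continuous_const).tendsto 0).mono_left nhdsWithin_le_nhds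
  rw [zero_mul] at hlim
  have := ge_of_tendsto hlim (by filter_upwards [self_mem_nhdsWithin] with ε hε using hb ε hε)
  exact norm_le_zero_iff.1 this

variable [ν.IsHaarMeasure]

/-- An integrable function all of whose moments vanish is zero where it is continuous. -/
theorem eq_zero_of_moments_eq_zero (hD : Integrable D ν)
    (h : ∀ i j k, ∫ g, D g * monomial i j k g ∂ν = 0)
    (h' : ∀ i j k, ∫ g, D g * (starRingEnd ℂ) (monomial i j k g) ∂ν = 0) {g₀ : SU2}
    (hc : ContinuousAt D g₀) : D g₀ = 0 := by
  by_contra hne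
  -- This real function is |D g₀|² at g₀, so it is positive on a neighbourhood; pairing it with a
  -- bump function supported there gives a contradiction.
  set E : SU2 → ℝ := fun g => ((starRingEnd ℂ) (D g₀) * D g).re with hE
  have hE0 : 0 < E g₀ := by
    simp only [hE]
    rw [mul_comm, Complex.mul_conj, Complex.ofReal_re]
    exact Complex.normSq_pos.2 hne
  have hEc : ContinuousAt E g₀ :=
    Complex.continuous_re.continuousAt.comp (continuousAt_const.mul hc)
  obtain ⟨U, hU, hUo, hgU⟩ := mem_nhds_iff.1 (hEc.eventually (lt_mem_nhds hE0))
  obtain ⟨f, hf0, hf1, hfI⟩ := exists_continuous_zero_one_of_isClosed hUo.isClosed_compl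
    (isClosed_singleton (x := g₀)) (by simpa using hgU)
  have hEint : Integrable E ν := (hD.const_mul _).re
  have hEf : Integrable (fun g => E g * f g) ν :=
    hEint.mul_bdd f.continuous.aestronglyMeasurable (c := 1) (Eventually.of_forall fun g => by
      rw [Real.norm_of_nonneg (hfI g).1]; exact (hfI g).2)
  have hint : ∫ g, E g * f g ∂ν = 0 := by
    have h1 := integral_mul_continuous_eq_zero hD h h' f
    have h2 : Integrable (fun g => (starRingEnd ℂ) (D g₀) * (D g * (f g : ℂ))) ν :=
      (Integrable.mul_continuous hD (Complex.continuous_ofReal.comp f.continuous)).const_mul _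
    have h3 := Complex.reCLM.integral_comp_comm h2
    rw [integral_const_mul, h1, mul_zero, map_zero] at h3
    rw [← h3]
    refine integral_congr_ae (Eventually.of_forall fun g => ?_)
    simp only [hE, Complex.reCLM_apply, ← mul_assoc, Complex.re_mul_ofReal]
  have hpos : 0 ≤ fun g => E g * f g := by
    intro g
    by_cases hg : g ∈ U
    · exact mul_nonneg (le_of_lt (hU hg)) (hfI g).1
    · have : f g = 0 := hf0 hg
      simp [this]
  have hae := (integral_eq_zero_iff_of_nonneg hpos hEf).1 hint
  have hopen : IsOpen (U ∩ {g | 0 < f g}) := hUo.inter (isOpen_lt continuous_const f.continuous)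
  have hmem : g₀ ∈ U ∩ {g | 0 < f g} := ⟨hgU, by
    have : f g₀ = 1 := hf1 rfl
    simp [this]⟩
  have hmeas := hopen.measure_pos ν ⟨g₀, hmem⟩
  have hz : ν (U ∩ {g | 0 < f g}) = 0 := by
    refine measure_mono_null (fun g hg => ?_) (ae_iff.1 hae)
    exact (mul_pos (hU hg.1) hg.2).ne'
  exact hmeas.ne' hz

end SU2

/-! ### Identification of the heat kernel with its spectral series. -/

namespace IsSubellipticHeatKernel
open SU2

variable {ν : Measure SU2} [ν.IsHaarMeasure] {p : ℝ → SU2 → ℝ}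

theorem integrable_mul (hp : IsSubellipticHeatKernel ν p) {t : ℝ} (ht : 0 < t) {f : SU2 → ℂ}
    (hf : Continuous f) : Integrable (fun g => (p t g : ℂ) * f g) ν :=
  integrable_of_continuous ν
    ((Complex.continuous_ofReal.comp (hp.smooth_at ht).continuous).mul hf)

theorem clm_integral_mul (hp : IsSubellipticHeatKernel ν p) {t : ℝ} (ht : 0 < t) {f : SU2 → ℂ}
    (hf : Continuous f) (φ : ℂ →L[ℝ] ℝ) :
    φ (∫ g, (p t g : ℂ) * f g ∂ν) = ∫ g, p t g * φ (f g) ∂ν := by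
  rw [← φ.integral_comp_comm (hp.integrable_mul ht hf)]
  refine integral_congr_ae (Eventually.of_forall fun g => ?_)
  show φ ((p t g : ℂ) * f g) = p t g * φ (f g)
  rw [← Complex.real_smul, map_smul, smul_eq_mul]

/-- By symmetry L passes to the monomial, where it is triangular. The real and imaginary parts are
differentiated separately and reassembled. -/
theorem hasDerivAt_moment (hp : IsSubellipticHeatKernel ν p) (i j k : ℕ) {t : ℝ} (ht : 0 < t) :
    HasDerivAt (fun t => ∫ g, (p t g : ℂ) * monomial i j k g ∂ν)
      (-(2 * (i + j + k) + 4 * i * k + 4 * i * j : ℂ) * (∫ g, (p t g : ℂ) * monomial i j k g ∂ν)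
        + 4 * i * j * ∫ g, (p t g : ℂ) * monomial (i - 1) (j - 1) k g ∂ν) t := by
  set LM : SU2 → ℂ := fun g => -(2 * (i + j + k) + 4 * i * k + 4 * i * j : ℂ) * monomial i j k g
        + 4 * i * j * monomial (i - 1) (j - 1) k g with hLM
  have hLMc : Continuous LM := by
    have h1 := continuous_monomial i j k
    have h2 := continuous_monomial (i - 1) (j - 1) k
    fun_prop
  have hd : ∀ φ : ℂ →L[ℝ] ℝ, HasDerivAt (fun t => ∫ g, p t g * φ (monomial i j k g) ∂ν)
      (φ (∫ g, (p t g : ℂ) * LM g ∂ν)) t := by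
    intro φ
    have := hp.hasDerivAt_integral' (smooth_monomial φ i j k) ht
    simp only [subLaplacian_monomial] at this
    rwa [hp.clm_integral_mul ht hLMc]
  have hre := (hd Complex.reCLM).ofReal_comp
  have him := (hd Complex.imCLM).ofReal_comp
  have h := hre.add (him.mul_const Complex.I)
  have hL : (∫ g, (p t g : ℂ) * LM g ∂ν) =
      -(2 * (i + j + k) + 4 * i * k + 4 * i * j : ℂ) * (∫ g, (p t g : ℂ) * monomial i j k g ∂ν)
        + 4 * i * j * ∫ g, (p t g : ℂ) * monomial (i - 1) (j - 1) k g ∂ν := by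
    rw [← integral_const_mul, ← integral_const_mul, ← integral_add
      ((hp.integrable_mul ht (continuous_monomial _ _ _)).const_mul _)
      ((hp.integrable_mul ht (continuous_monomial _ _ _)).const_mul _)]
    refine integral_congr_ae (Eventually.of_forall fun g => ?_)
    simp only [hLM]; ring
  rw [← hL]
  have hval : ((Complex.reCLM (∫ g, (p t g : ℂ) * LM g ∂ν) : ℝ) : ℂ) +
      (Complex.imCLM (∫ g, (p t g : ℂ) * LM g ∂ν) : ℝ) * Complex.I =
      ∫ g, (p t g : ℂ) * LM g ∂ν := Complex.re_add_im _
  rw [hval] at h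
  refine h.congr_of_eventuallyEq ?_
  filter_upwards [Ioi_mem_nhds ht] with s hs
  rw [Pi.add_apply, ← hp.clm_integral_mul hs (continuous_monomial i j k),
    ← hp.clm_integral_mul hs (continuous_monomial i j k)]
  exact (Complex.re_add_im _).symm

theorem tendsto_moment (hp : IsSubellipticHeatKernel ν p) (i j k : ℕ) :
    Tendsto (fun t => ∫ g, (p t g : ℂ) * monomial i j k g ∂ν) (𝓝[>] 0) (𝓝 (0 ^ k)) := by
  have hd : ∀ φ : ℂ →L[ℝ] ℝ, Tendsto (fun t => ((∫ g, p t g * φ (monomial i j k g) ∂ν : ℝ) : ℂ))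
      (𝓝[>] 0) (𝓝 (φ (0 ^ k) : ℝ)) := by
    intro φ
    have := hp.initial _ (smooth_monomial φ i j k)
    rw [monomial_one] at this
    exact (Complex.continuous_ofReal.tendsto _).comp this
  have h := (hd Complex.reCLM).add ((hd Complex.imCLM).mul_const Complex.I)
  have hval : ((Complex.reCLM (0 ^ k) : ℝ) : ℂ) + (Complex.imCLM (0 ^ k) : ℝ) * Complex.I = 0 ^ k :=
    Complex.re_add_im _
  rw [hval] at h
  refine h.congr' ?_
  filter_upwards [self_mem_nhdsWithin] with s hs
  rw [← hp.clm_integral_mul hs (continuous_monomial i j k),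
    ← hp.clm_integral_mul hs (continuous_monomial i j k)]
  exact Complex.re_add_im _

/-- Inductively the lower moment vanishes, leaving a homogeneous equation; the initial value is zero
because b = 0 at the identity. -/
theorem moment_eq_zero (hp : IsSubellipticHeatKernel ν p) (i j : ℕ) {k : ℕ} (hk : k ≠ 0) {t : ℝ}
    (ht : 0 < t) : ∫ g, (p t g : ℂ) * monomial i j k g ∂ν = 0 := by
  induction i generalizing j t with
  | zero =>
    refine eq_zero_of_hasDerivAt_neg_mul (fun t ht => ?_)
      (by simpa [hk] using hp.tendsto_moment 0 j k) ht
      (c := 2 * (((0 : ℕ) : ℂ) + j + k) + 4 * ((0 : ℕ) : ℂ) * k + 4 * ((0 : ℕ) : ℂ) * j)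
    simpa using hp.hasDerivAt_moment 0 j k ht
  | succ i ih =>
    refine eq_zero_of_hasDerivAt_neg_mul (fun t ht => ?_)
      (by simpa [hk] using hp.tendsto_moment (i + 1) j k) ht
      (c := 2 * (((i + 1 : ℕ) : ℂ) + j + k) + 4 * ((i + 1 : ℕ) : ℂ) * k + 4 * ((i + 1 : ℕ) : ℂ) * j)
    have := hp.hasDerivAt_moment (i + 1) j k ht
    rw [Nat.add_sub_cancel, ih _ ht, mul_zero, add_zero] at this
    exact this

/-- Both sides solve the same triangular system and tend to 1 as t → 0⁺; by induction their
difference solves a homogeneous equation with zero initial limit. -/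
theorem moment_eq_momentSeries (hp : IsSubellipticHeatKernel ν p) (i j : ℕ) {t : ℝ}
    (ht : 0 < t) : ∫ g, (p t g : ℂ) * monomial i j 0 g ∂ν = momentSeries i j t := by
  have hlim : ∀ i j, Tendsto (fun t => (∫ g, (p t g : ℂ) * monomial i j 0 g ∂ν) - momentSeries i j t)
      (𝓝[>] 0) (𝓝 0) := by
    intro i j
    have h1 := ((continuous_momentSeries i j).tendsto 0).mono_left
      (nhdsWithin_le_nhds (s := Ioi 0))
    rw [momentSeries_zero] at h1
    simpa using (hp.tendsto_moment i j 0).sub h1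
  have hbase : ∀ i j, (i = 0 ∨ j = 0) → ∀ t > 0,
      ∫ g, (p t g : ℂ) * monomial i j 0 g ∂ν = momentSeries i j t := by
    intro i j hij t ht
    refine sub_eq_zero.1 (eq_zero_of_hasDerivAt_neg_mul (fun t ht => ?_) (hlim i j) ht
      (c := diskEigenvalue j i))
    have h1 := hp.hasDerivAt_moment i j 0 ht
    have h2 : HasDerivAt (momentSeries i j) (-(diskEigenvalue j i) * momentSeries i j t) t := by
      rw [funext (momentSeries_of_eq_zero hij)]
      exact hasDerivAt_exp_neg_mul _ t
    refine (h1.sub h2).congr_deriv ?_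
    have : (i : ℂ) * j = 0 := by rcases hij with rfl | rfl <;> simp
    simp only [diskEigenvalue]
    push_cast
    linear_combination (4 * ∫ g, (p t g : ℂ) * monomial (i - 1) (j - 1) 0 g ∂ν) * this
  induction i generalizing j t with
  | zero => exact hbase 0 j (Or.inl rfl) t ht
  | succ i ih =>
    rcases j with _ | j
    · exact hbase _ 0 (Or.inr rfl) t ht
    refine sub_eq_zero.1 (eq_zero_of_hasDerivAt_neg_mul (fun t ht => ?_) (hlim (i + 1) (j + 1)) ht
      (c := diskEigenvalue (j + 1) (i + 1)))
    have h1 := hp.hasDerivAt_moment (i + 1) (j + 1) 0 ht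
    rw [Nat.add_sub_cancel, Nat.add_sub_cancel, ih j ht] at h1
    refine (h1.sub (hasDerivAt_momentSeries_succ i j t)).congr_deriv ?_
    simp only [diskEigenvalue]
    push_cast
    ring

/-- The heat kernel is given by its spectral series. -/
theorem eq_heatSeries (hp : IsSubellipticHeatKernel ν p) {t : ℝ} (ht : 0 < t) (g : SU2) :
    (p t g : ℂ) = heatSeries t (fst g) / ν.real univ := by
  set V : ℂ := (ν.real univ : ℂ) with hV
  have hV0 : V ≠ 0 := Complex.ofReal_ne_zero.2 (measureReal_univ_pos ν).ne'
  have hpc : Continuous (fun g => (p t g : ℂ)) :=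
    Complex.continuous_ofReal.comp (hp.smooth_at ht).continuous
  have hqc : Continuous (fun g => heatSeries t (fst g) / V) :=
    (continuous_heatSeries_fst ht).div_const V
  have hsplit : ∀ f : SU2 → ℂ, Continuous f →
      ∫ g, ((p t g : ℂ) - heatSeries t (fst g) / V) * f g ∂ν =
      (∫ g, (p t g : ℂ) * f g ∂ν) - ∫ g, (heatSeries t (fst g) / V) * f g ∂ν := by
    intro f hf
    simp only [sub_mul]
    exact integral_sub (integrable_of_continuous ν (hpc.mul hf))
      (integrable_of_continuous ν (hqc.mul hf))
  have h1 : ∀ i j k, ∫ g, ((p t g : ℂ) - heatSeries t (fst g) / V) * monomial i j k g ∂ν = 0 := by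
    intro i j k
    rw [hsplit _ (continuous_monomial i j k)]
    rcases Nat.eq_zero_or_pos k with rfl | hk
    · rw [hp.moment_eq_momentSeries i j ht]
      simp only [div_mul_eq_mul_div]
      rw [integral_div, integral_heatSeries_mul_monomial ν ht, ← hV, mul_div_cancel_left₀ _ hV0,
        sub_self]
    · rw [hp.moment_eq_zero i j hk.ne' ht, integral_mul_monomial ν (fun a => heatSeries t a / V) i j
        hk.ne', sub_self]
  have h2 : ∀ i j k, ∫ g, ((p t g : ℂ) - heatSeries t (fst g) / V) *
      (starRingEnd ℂ) (monomial i j k g) ∂ν = 0 := by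
    intro i j k
    rcases Nat.eq_zero_or_pos k with rfl | hk
    · simp only [conj_monomial_zero]; exact h1 j i 0
    · rw [hsplit (fun g => (starRingEnd ℂ) (monomial i j k g))
        (Complex.continuous_conj.comp (continuous_monomial i j k)),
        integral_mul_conj_monomial ν (fun a => heatSeries t a / V) i j hk.ne', sub_zero]
      have := congrArg (starRingEnd ℂ) (hp.moment_eq_zero i j hk.ne' ht)
      rw [← integral_conj] at this
      simpa using this
  exact sub_eq_zero.1 (eq_zero_of_moments_eq_zero
    (integrable_of_continuous ν (hpc.sub hqc)) h1 h2 (hpc.sub hqc).continuousAt)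

end IsSubellipticHeatKernel

/-! ### Positivity of the heat kernel -/

/-- A negative second derivative would make the point a local maximum too, so f would be locally
constant and the second derivative zero. -/
theorem IsLocalMin.deriv_deriv_nonneg {f f' : ℝ → ℝ} {x c : ℝ} (hmin : IsLocalMin f x)
    (hf : ∀ s, HasDerivAt f (f' s) s) (hf' : HasDerivAt f' c x) : 0 ≤ c := by
  by_contra! hc
  have hd : deriv f = f' := funext fun s => (hf s).deriv
  have hmax : IsLocalMax f x := isLocalMax_of_deriv_deriv_neg (by rw [hd, hf'.deriv]; exact hc)
    hmin.deriv_eq_zero (hf x).continuousAt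
  have heq : f =ᶠ[𝓝 x] fun _ => f x := by
    filter_upwards [hmin, hmax] with y h1 h2 using le_antisymm h2 h1
  have h1 : f' =ᶠ[𝓝 x] fun _ => 0 := by
    have := heq.deriv
    rw [hd] at this
    simpa using this
  have h2 := (hf'.congr_of_eventuallyEq h1.symm).unique (hasDerivAt_const x (0 : ℝ))
  linarith

namespace SU2

theorem subLaplacian_nonneg_of_isMin {f : SU2 → ℝ} (hf : IsSmoothSU2 f) {g : SU2}
    (hg : ∀ h, f g ≤ f h) : 0 ≤ subLaplacian f g := by
  have key : ∀ θ, 0 ≤ field θ (field θ f) g := by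
    intro θ
    refine IsLocalMin.deriv_deriv_nonneg (f := fun s => f (g * horizontalExp s θ)) (x := 0)
      (Eventually.of_forall fun s => ?_) (fun s => hasDerivAt_field hf g θ s)
      (hasDerivAt_field_zero (smooth_field hf θ) g θ)
    simpa using hg _
  rw [subLaplacian_eq]
  exact add_nonneg (key _) (key _)

/-- The minimum principle for the subelliptic heat equation. -/
theorem nonneg_of_heat_eq {u : ℝ → SU2 → ℝ} (hs : ∀ t > 0, IsSmoothSU2 (u t))
    (hc : ContinuousOn (fun x : ℝ × SU2 => u x.1 x.2) (Ioi 0 ×ˢ univ))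
    (hu : ∀ t > 0, ∀ g, HasDerivAt (fun t => u t g) (subLaplacian (u t) g) t)
    (h0 : ∀ ε > 0, ∃ δ > 0, ∀ t ∈ Ioo 0 δ, ∀ g, -ε ≤ u t g) {T : ℝ} (hT : 0 < T) (g : SU2) :
    0 ≤ u T g := by
  by_contra! hneg
  -- Adding (η/T)t to u gives a perturbed function equal to -2η at (T, g), while near t = 0 it stays
  -- at least -η; hence its minimum is not at the initial time.
  set η := -u T g / 3 with hη
  have hη0 : 0 < η := by rw [hη]; linarith
  obtain ⟨δ, hδ, hδu⟩ := h0 η hη0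
  set s₀ := min (δ / 2) (T / 2) with hs₀
  have hs₀0 : 0 < s₀ := lt_min (by linarith) (by linarith)
  have hs₀T : s₀ < T := (min_le_right _ _).trans_lt (by linarith)
  have hs₀δ : s₀ < δ := (min_le_left _ _).trans_lt (by linarith)
  have hK : IsCompact (Icc s₀ T ×ˢ (univ : Set SU2)) := isCompact_Icc.prod isCompact_univ
  have hsub : Icc s₀ T ×ˢ (univ : Set SU2) ⊆ Ioi 0 ×ˢ univ :=
    prod_mono (fun x hx => hs₀0.trans_le hx.1) subset_rfl
  have hvc : ContinuousOn (fun x : ℝ × SU2 => u x.1 x.2 + η / T * x.1) (Icc s₀ T ×ˢ univ) :=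
    (hc.mono hsub).add (by fun_prop)
  obtain ⟨⟨t, h⟩, ⟨htI, -⟩, hmin⟩ := hK.exists_isMinOn
    ⟨(T, g), ⟨hs₀T.le, le_rfl⟩, mem_univ _⟩ hvc
  have hmin' : ∀ s ∈ Icc s₀ T, ∀ k, u t h + η / T * t ≤ u s k + η / T * s :=
    fun s hs k => hmin (show (s, k) ∈ Icc s₀ T ×ˢ (univ : Set SU2) from ⟨hs, mem_univ _⟩)
  have htpos : 0 < t := hs₀0.trans_le htI.1
  have hval : u t h + η / T * t ≤ -2 * η := by
    have := hmin' T ⟨hs₀T.le, le_rfl⟩ g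
    rw [div_mul_cancel₀ _ hT.ne'] at this
    linarith
  have hηt : 0 < η / T * t := by positivity
  have hst : s₀ < t := by
    rcases htI.1.lt_or_eq with h1 | h1
    · exact h1
    · have h1' : s₀ = t := h1
      have := hδu t ⟨htpos, h1'.symm.trans_lt hs₀δ⟩ h
      linarith
  have hL : 0 ≤ subLaplacian (u t) h := subLaplacian_nonneg_of_isMin (hs t htpos) fun k => by
    have := hmin' t htI k
    linarith
  have hd : HasDerivAt (fun s => u s h + η / T * s) (subLaplacian (u t) h + η / T) t := by
    refine HasDerivAt.congr_deriv
      ((hu t htpos h).fun_add ((hasDerivAt_id' t).const_mul (η / T))) (by simp)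
  -- Only slopes from the left are used, since the minimum may sit at t = T. They are nonpositive,
  -- whereas L u + η/T > 0 there.
  have hslope := hd.hasDerivWithinAt (s := Iio t)
  rw [hasDerivWithinAt_iff_tendsto_slope' (by simp)] at hslope
  have hle : subLaplacian (u t) h + η / T ≤ 0 := by
    refine le_of_tendsto hslope ?_
    filter_upwards [Ioo_mem_nhdsLT hst] with s hs
    have h1 := hmin' s ⟨hs.1.le, hs.2.le.trans htI.2⟩ h
    rw [slope_def_field]
    exact div_nonpos_of_nonneg_of_nonpos (by linarith) (by linarith [hs.2])
  have : 0 < η / T := by positivity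
  linarith

/-- Kernels which are finite sums of products of smooth functions. -/
def IsSeparable (K : SU2 → SU2 → ℝ) : Prop :=
  ∃ (n : ℕ) (α β : Fin n → SU2 → ℝ), (∀ i, IsSmoothSU2 (α i)) ∧ (∀ i, IsSmoothSU2 (β i)) ∧
    ∀ h g, K h g = ∑ i, α i h * β i g

theorem IsSeparable.of_fintype {ι : Type} [Fintype ι] {K : SU2 → SU2 → ℝ} (α β : ι → SU2 → ℝ)
    (hα : ∀ i, IsSmoothSU2 (α i)) (hβ : ∀ i, IsSmoothSU2 (β i))
    (hK : ∀ h g, K h g = ∑ i, α i h * β i g) : IsSeparable K := by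
  let e := (Fintype.equivFin ι).symm
  refine ⟨Fintype.card ι, fun i => α (e i), fun i => β (e i), fun i => hα _, fun i => hβ _,
    fun h g => ?_⟩
  rw [hK, ← e.sum_comp]

theorem IsSeparable.left {α : SU2 → ℝ} (hα : IsSmoothSU2 α) : IsSeparable fun h _ => α h :=
  ⟨1, fun _ => α, fun _ _ => 1, fun _ => hα, fun _ => IsSmoothSU2.const 1, fun h g => by simp⟩

theorem IsSeparable.right {β : SU2 → ℝ} (hβ : IsSmoothSU2 β) : IsSeparable fun _ g => β g :=
  ⟨1, fun _ _ => 1, fun _ => β, fun _ => IsSmoothSU2.const 1, fun _ => hβ, fun h g => by simp⟩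

theorem IsSeparable.add {K L : SU2 → SU2 → ℝ} (hK : IsSeparable K) (hL : IsSeparable L) :
    IsSeparable fun h g => K h g + L h g := by
  obtain ⟨n, α, β, hα, hβ, h⟩ := hK
  obtain ⟨m, α', β', hα', hβ', h'⟩ := hL
  refine IsSeparable.of_fintype (ι := Fin n ⊕ Fin m) (Sum.elim α α') (Sum.elim β β') ?_ ?_ ?_
  · rintro (i | i); exacts [hα i, hα' i]
  · rintro (i | i); exacts [hβ i, hβ' i]
  · intro x y; simp [h, h']

theorem IsSeparable.mul {K L : SU2 → SU2 → ℝ} (hK : IsSeparable K) (hL : IsSeparable L) :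
    IsSeparable fun h g => K h g * L h g := by
  obtain ⟨n, α, β, hα, hβ, h⟩ := hK
  obtain ⟨m, α', β', hα', hβ', h'⟩ := hL
  refine IsSeparable.of_fintype (ι := Fin n × Fin m) (fun x g => α x.1 g * α' x.2 g)
    (fun x g => β x.1 g * β' x.2 g) (fun x => (hα _).mul (hα' _)) (fun x => (hβ _).mul (hβ' _)) ?_
  intro x y
  rw [h, h', Finset.sum_mul_sum, Fintype.sum_prod_type]
  refine Finset.sum_congr rfl fun i _ => Finset.sum_congr rfl fun j _ => ?_
  ring

/-- The coordinates of h g⁻¹ are bilinear in those of h and g, and separable kernels are closed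
under sums and products. -/
theorem IsSeparable.of_mem_polyAlgebra {P : C(SU2, ℝ)} (hP : P ∈ polyAlgebra) :
    IsSeparable fun h g => P (h * g⁻¹) := by
  have hs : ∀ i, IsSmoothSU2 (realCoord i) := by
    intro i
    fin_cases i
    · simpa [monomial, realCoord] using smooth_monomial Complex.reCLM 1 0 0
    · simpa [monomial, realCoord] using smooth_monomial Complex.imCLM 1 0 0
    · simpa [monomial, realCoord] using smooth_monomial Complex.reCLM 0 0 1
    · simpa [monomial, realCoord] using smooth_monomial Complex.imCLM 0 0 1
  have hc : ∀ c : ℝ, IsSeparable fun _ _ => c := fun c => IsSeparable.left (IsSmoothSU2.const c)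
  have hp : ∀ i j, ∀ c : ℝ, IsSeparable fun h g => c * (realCoord i h * realCoord j g) :=
    fun i j c => (hc c).mul ((IsSeparable.left (hs i)).mul (IsSeparable.right (hs j)))
  refine Algebra.adjoin_induction (p := fun P _ => IsSeparable fun h g => P (h * g⁻¹))
    ?_ (fun r => hc r) (fun x y _ _ hx hy => hx.add hy) (fun x y _ _ hx hy => hx.mul hy) hP
  rintro _ ⟨i, rfl⟩
  fin_cases i
  · convert (((hp 0 0 1).add (hp 1 1 1)).add (hp 2 2 1)).add (hp 3 3 1) using 3 with h g
    simp [realCoord, fst_mul, fst_inv, snd_inv]; ring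
  · convert (((hp 1 0 1).add (hp 0 1 (-1))).add (hp 3 2 1)).add (hp 2 3 (-1)) using 3 with h g
    simp [realCoord, fst_mul, fst_inv, snd_inv]; ring
  · convert (((hp 0 2 (-1)).add (hp 1 3 1)).add (hp 2 0 1)).add (hp 3 1 (-1)) using 3 with h g
    simp [realCoord, snd_mul, fst_inv, snd_inv]; ring
  · convert (((hp 0 3 (-1)).add (hp 1 2 (-1))).add (hp 2 1 1)).add (hp 3 0 1) using 3 with h g
    simp [realCoord, snd_mul, fst_inv, snd_inv]; ring

/-- Left-invariant fields pass under convolution integrals. -/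
theorem field_convolution (ν : Measure SU2) [ν.IsHaarMeasure] {w f : SU2 → ℝ} (hw : IsSmoothSU2 w)
    (hf : Continuous f) (θ : ℝ) (h : SU2) :
    field θ (fun h => ∫ g, w (g⁻¹ * h) * f g ∂ν) h = ∫ g, field θ w (g⁻¹ * h) * f g ∂ν := by
  obtain ⟨C, hC⟩ := (smooth_field hw θ).bounded
  obtain ⟨B, hB⟩ := (isCompact_univ (X := SU2)).exists_bound_of_continuousOn hf.continuousOn
  have hcont : ∀ {w : SU2 → ℝ}, IsSmoothSU2 w → ∀ k : SU2, Continuous fun g => w (g⁻¹ * k) * f g :=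
    fun hw k => (hw.continuous.comp (by fun_prop)).mul hf
  have hd := (hasDerivAt_integral_of_dominated_loc_of_deriv_le (μ := ν) (𝕜 := ℝ)
    (F := fun s g => w (g⁻¹ * (h * horizontalExp s θ)) * f g) (x₀ := 0) (s := univ)
    (bound := fun _ => C * B)
    (F' := fun s g => field θ w (g⁻¹ * (h * horizontalExp s θ)) * f g) univ_mem
    (Eventually.of_forall fun s => (hcont hw _).aestronglyMeasurable)
    (integrable_of_continuous ν (hcont hw _))
    (hcont (smooth_field hw θ) _).aestronglyMeasurable
    (Eventually.of_forall fun g s _ => by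
      rw [norm_mul]
      exact mul_le_mul (hC _) (hB g (mem_univ _)) (norm_nonneg _) ((norm_nonneg _).trans (hC 1)))
    (integrable_const _)
    (Eventually.of_forall fun g s _ => by
      simp only [← mul_assoc]
      exact (hasDerivAt_field hw (g⁻¹ * h) θ s).mul_const _)).2
  simpa [field] using hd.deriv

end SU2

namespace IsSubellipticHeatKernel
open SU2

variable {ν : Measure SU2} [ν.IsHaarMeasure] {p : ℝ → SU2 → ℝ}

/-- The convolution ∫ p_t(g⁻¹h) P(g) dν(g) solves the heat equation by left invariance. As P(hg⁻¹)
is a finite sum of products, weak convergence at t → 0⁺ becomes convergence to P uniform in h, so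
the minimum principle applies; take h = 1. -/
theorem integral_nonneg_of_mem_polyAlgebra (hp : IsSubellipticHeatKernel ν p) {P : C(SU2, ℝ)}
    (hP : P ∈ polyAlgebra) (hP0 : ∀ g, 0 ≤ P g) {t : ℝ} (ht : 0 < t) :
    0 ≤ ∫ g, p t g⁻¹ * P g ∂ν := by
  obtain ⟨n, α, β, hα, hβ, hsep⟩ := IsSeparable.of_mem_polyAlgebra hP
  set u : ℝ → SU2 → ℝ := fun t h => ∑ i, α i h * ∫ g, p t g * β i g ∂ν with hu
  have hsmul : ∀ {t : ℝ} (_ : 0 < t) (w : SU2 → ℝ), Continuous w → ∀ h,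
      ∫ g, w (g⁻¹ * h) * P g ∂ν = ∑ i, α i h * ∫ g, w g * β i g ∂ν := by
    intro t ht w hw h
    have h1 : ∫ g, w (g⁻¹ * h) * P g ∂ν = ∫ g, w g * P (h * g⁻¹) ∂ν := by
      rw [← integral_inv_eq_self (fun g => w g * P (h * g⁻¹)),
        ← integral_mul_left_eq_self (fun g => w g⁻¹ * P (h * g⁻¹⁻¹)) h⁻¹]
      simp
    rw [h1]
    simp only [hsep, Finset.mul_sum]
    rw [integral_finsetSum]
    · refine Finset.sum_congr rfl fun i _ => ?_
      rw [← integral_const_mul]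
      refine integral_congr_ae (Eventually.of_forall fun g => ?_)
      simp only; ring
    · intro i _
      exact integrable_of_continuous ν (hw.mul (continuous_const.mul (hβ i).continuous))
  have hconv : ∀ t > 0, u t = fun h => ∫ g, p t (g⁻¹ * h) * P g ∂ν := fun t ht =>
    funext fun h => (hsmul ht (p t) (hp.smooth_at ht).continuous h).symm
  have hlap : ∀ t > 0, ∀ h, subLaplacian (u t) h =
      ∑ i, α i h * ∫ g, subLaplacian (p t) g * β i g ∂ν := by
    intro t ht h
    have hst := hp.smooth_at ht
    have hf : ∀ θ, field θ (field θ (u t)) h = ∫ g, field θ (field θ (p t)) (g⁻¹ * h) * P g ∂ν := by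
      intro θ
      rw [hconv t ht, funext (field_convolution ν hst P.continuous θ),
        field_convolution ν (smooth_field hst θ) P.continuous θ]
    rw [← hsmul ht _ hst.subLaplacian.continuous, subLaplacian_eq, hf, hf, ← integral_add]
    · refine integral_congr_ae (Eventually.of_forall fun g => ?_)
      simp only [subLaplacian_eq]; ring
    all_goals
      exact integrable_of_continuous ν
        (((smooth_field (smooth_field hst _) _).continuous.comp (by fun_prop)).mul P.continuous)
  have hsum : ∀ (s : Finset (Fin n)) (c : Fin n → ℝ),
      IsSmoothSU2 fun h => ∑ i ∈ s, α i h * c i := by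
    intro s c
    induction s using Finset.induction_on with
    | empty => simpa using IsSmoothSU2.const 0
    | insert i s hi ih =>
      simp only [Finset.sum_insert hi]
      exact ((hα i).mul (IsSmoothSU2.const (c i))).add ih
  have hpos := nonneg_of_heat_eq (u := u) (fun t _ => hsum _ _) ?_ ?_ ?_ ht 1
  · rw [hconv t ht] at hpos
    simpa using hpos
  · refine continuousOn_finsetSum _ fun i _ => ?_
    refine ((hα i).continuous.comp continuous_snd).continuousOn.mul ?_
    have : ContinuousOn (fun t => ∫ g, p t g * β i g ∂ν) (Ioi 0) := fun t ht =>
      (hp.hasDerivAt_integral (hβ i) ht).continuousAt.continuousWithinAt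
    exact this.comp continuous_fst.continuousOn fun x hx => hx.1
  · intro t ht h
    rw [hlap t ht]
    exact HasDerivAt.fun_sum fun i _ => (hp.hasDerivAt_integral (hβ i) ht).const_mul _
  · intro ε hε
    have hbd : ∀ i, ∃ C > 0, ∀ h, ‖α i h‖ ≤ C := fun i => by
      obtain ⟨C, hC⟩ := (hα i).bounded
      exact ⟨max C 1, by positivity, fun h => (hC h).trans (le_max_left _ _)⟩
    choose C hC0 hC using hbd
    have hlim : Tendsto (fun t => ∑ i, C i * ‖(∫ g, p t g * β i g ∂ν) - β i 1‖) (𝓝[>] 0)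
        (𝓝 (∑ i, C i * ‖β i 1 - β i 1‖)) :=
      tendsto_finsetSum _ fun i _ => (((hp.initial _ (hβ i)).sub_const _).norm).const_mul _
    simp only [sub_self, norm_zero, mul_zero, Finset.sum_const_zero] at hlim
    obtain ⟨δ, hδ, hδs⟩ := mem_nhdsGT_iff_exists_Ioo_subset.1 (hlim.eventually (gt_mem_nhds hε))
    refine ⟨δ, hδ, fun s hs h => ?_⟩
    have h1 : ∑ i, C i * ‖(∫ g, p s g * β i g ∂ν) - β i 1‖ < ε := hδs hs
    have h2 : u s h - P h = ∑ i, α i h * ((∫ g, p s g * β i g ∂ν) - β i 1) := by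
      have := hsep h 1
      simp only [inv_one, mul_one] at this
      rw [this, hu]
      simp only [mul_sub, Finset.sum_sub_distrib]
    have h3 : ‖u s h - P h‖ ≤ ∑ i, C i * ‖(∫ g, p s g * β i g ∂ν) - β i 1‖ := by
      rw [h2]
      refine norm_sum_le_of_le _ fun i _ => ?_
      rw [norm_mul]
      exact mul_le_mul_of_nonneg_right (hC i h) (norm_nonneg _)
    have h4 := (abs_le.1 (h3.trans h1.le)).1
    linarith [hP0 h]

/-- The heat kernel is nonnegative. -/
theorem nonneg (hp : IsSubellipticHeatKernel ν p) {t : ℝ} (ht : 0 < t) (g : SU2) : 0 ≤ p t g := by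
  have hwc : Continuous fun g => p t g⁻¹ := (hp.smooth_at ht).continuous.comp continuous_inv
  have key : ∀ f : C(SU2, ℝ), (∀ g, 0 ≤ f g) → 0 ≤ ∫ g, p t g⁻¹ * f g ∂ν := by
    intro f hf
    have hb : ∀ ε > 0, -(2 * ε * ∫ g, ‖p t g⁻¹‖ ∂ν) ≤ ∫ g, p t g⁻¹ * f g ∂ν := by
      intro ε hε
      -- Approximating f + ε within ε keeps the polynomial nonnegative, at a total error of 2ε.
      obtain ⟨P, hP, hPf⟩ := exists_poly_near (f + ContinuousMap.const _ ε) hε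
      have hPf' : ∀ g, |P g - (f g + ε)| < ε := hPf
      have h1 := hp.integral_nonneg_of_mem_polyAlgebra hP
        (fun g => by linarith [(abs_lt.1 (hPf' g)).1, hf g]) ht
      have h2 : ‖(∫ g, p t g⁻¹ * P g ∂ν) - ∫ g, p t g⁻¹ * f g ∂ν‖ ≤
          ∫ g, 2 * ε * ‖p t g⁻¹‖ ∂ν := by
        have hPi : Integrable (fun g => p t g⁻¹ * P g) ν :=
          integrable_of_continuous ν (hwc.mul P.continuous)
        have hfi : Integrable (fun g => p t g⁻¹ * f g) ν :=
          integrable_of_continuous ν (hwc.mul f.continuous)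
        rw [← integral_sub hPi hfi]
        refine norm_integral_le_of_norm_le ((integrable_of_continuous ν hwc).norm.const_mul _)
          (Eventually.of_forall fun g => ?_)
        rw [← mul_sub, norm_mul, mul_comm]
        refine mul_le_mul_of_nonneg_right ?_ (norm_nonneg _)
        have h3 := abs_lt.1 (hPf' g)
        exact abs_le.2 ⟨by linarith [h3.1], by linarith [h3.2]⟩
      rw [integral_const_mul] at h2
      have := (abs_le.1 h2).2
      linarith
    have hlim : Tendsto (fun ε : ℝ => -(2 * ε * ∫ g, ‖p t g⁻¹‖ ∂ν)) (𝓝[>] 0)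
        (𝓝 (-(2 * 0 * ∫ g, ‖p t g⁻¹‖ ∂ν))) :=
      (Continuous.tendsto (by fun_prop) 0).mono_left nhdsWithin_le_nhds
    rw [mul_zero, zero_mul, neg_zero] at hlim
    exact le_of_tendsto hlim (by filter_upwards [self_mem_nhdsWithin] with ε hε using hb ε hε)
  -- Testing against the negative part itself makes the integral minus a square norm, so the
  -- negative part vanishes.
  set f : C(SU2, ℝ) := ⟨fun g => max (-p t g⁻¹) 0, hwc.neg.max continuous_const⟩ with hf
  have h1 := key f fun g => le_max_right _ _
  have h2 : ∀ g, p t g⁻¹ * f g = -(f g) ^ 2 := by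
    intro g
    simp only [hf, ContinuousMap.coe_mk]
    rcases max_cases (-p t g⁻¹) 0 with ⟨h, _⟩ | ⟨h, _⟩ <;> rw [h] <;> ring
  simp only [h2, integral_neg] at h1
  have hfi : Integrable (fun g => f g ^ 2) ν := integrable_of_continuous ν (f.continuous.pow 2)
  have h3 : ∫ g, f g ^ 2 ∂ν = 0 :=
    le_antisymm (by linarith) (integral_nonneg fun g => sq_nonneg _)
  have h4 := (integral_eq_zero_iff_of_nonneg (fun g => sq_nonneg (f g)) hfi).1 h3
  have h5 := ((f.continuous.pow 2).ae_eq_iff_eq ν continuous_const).1 h4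
  have h6 : f g⁻¹ ^ 2 = 0 := congrFun h5 g⁻¹
  have h7 : max (-p t g⁻¹⁻¹) 0 = 0 := pow_eq_zero_iff (two_ne_zero) |>.1 h6
  rw [inv_inv] at h7
  linarith [le_max_left (-p t g) 0]

theorem integral_eq_one (hp : IsSubellipticHeatKernel ν p) {t : ℝ} (ht : 0 < t) :
    ∫ g, p t g ∂ν = 1 := by
  have h := hp.moment_eq_momentSeries 0 0 ht
  rw [momentSeries_of_eq_zero (Or.inl rfl)] at h
  simp only [monomial, pow_zero, mul_one, diskEigenvalue, Nat.cast_zero, add_zero, mul_zero,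
    neg_zero, zero_mul, Real.exp_zero, integral_complex_ofReal] at h
  exact_mod_cast h

end IsSubellipticHeatKernel

/-! ### Subordination integral -/

section FTC

variable {f f' : ℝ → ℝ} {a b : ℝ}

/-- Redefining f at 0 by its right limit gives continuity at the endpoint, as the fundamental
theorem of calculus on [0, ∞) requires. -/
theorem exists_extension_of_hasDerivAt_of_tendsto
    (hf : ∀ t ∈ Ioi (0 : ℝ), HasDerivAt f (f' t) t)
    (ha : Tendsto f (𝓝[>] 0) (𝓝 a)) (hb : Tendsto f atTop (𝓝 b)) :
    ∃ g : ℝ → ℝ, g 0 = a ∧ ContinuousWithinAt g (Ici 0) 0 ∧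
      (∀ t ∈ Ioi (0 : ℝ), HasDerivAt g (f' t) t) ∧ Tendsto g atTop (𝓝 b) := by
  refine ⟨Function.update f 0 a, Function.update_self .., ?_, fun t ht => ?_, hb.congr' ?_⟩
  · rw [continuousWithinAt_update_same, Ici_sdiff_left]
    exact ha
  · refine (hf t ht).congr_of_eventuallyEq ?_
    filter_upwards [Ioi_mem_nhds ht] with s hs
    exact Function.update_of_ne (ne_of_gt hs) _ _
  · filter_upwards [Ioi_mem_atTop 0] with s hs
    exact (Function.update_of_ne (ne_of_gt hs) _ _).symm

theorem integral_Ioi_zero_of_hasDerivAt_of_tendsto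
    (hf : ∀ t ∈ Ioi (0 : ℝ), HasDerivAt f (f' t) t) (hi : IntegrableOn f' (Ioi 0))
    (ha : Tendsto f (𝓝[>] 0) (𝓝 a)) (hb : Tendsto f atTop (𝓝 b)) :
    ∫ t in Ioi (0 : ℝ), f' t = b - a := by
  obtain ⟨g, rfl, h0, hd, hlim⟩ := exists_extension_of_hasDerivAt_of_tendsto hf ha hb
  exact integral_Ioi_of_hasDerivAt_of_tendsto h0 hd hi hlim

theorem integrableOn_Ioi_zero_deriv_of_nonneg
    (hf : ∀ t ∈ Ioi (0 : ℝ), HasDerivAt f (f' t) t) (hpos : ∀ t ∈ Ioi (0 : ℝ), 0 ≤ f' t)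
    (ha : Tendsto f (𝓝[>] 0) (𝓝 a)) (hb : Tendsto f atTop (𝓝 b)) :
    IntegrableOn f' (Ioi 0) := by
  obtain ⟨g, rfl, h0, hd, hlim⟩ := exists_extension_of_hasDerivAt_of_tendsto hf ha hb
  exact integrableOn_Ioi_deriv_of_nonneg h0 hd hpos hlim

theorem integrableOn_Ioi_and_integral_of_tendsto
    (hf : ∀ t ∈ Ioi (0 : ℝ), HasDerivAt f (f' t) t) (hpos : ∀ t ∈ Ioi (0 : ℝ), 0 ≤ f' t)
    (ha : Tendsto f (𝓝[>] 0) (𝓝 a)) (hb : Tendsto f atTop (𝓝 b)) :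
    IntegrableOn f' (Ioi 0) ∧ ∫ t in Ioi (0 : ℝ), f' t = b - a :=
  have hi := integrableOn_Ioi_zero_deriv_of_nonneg hf hpos ha hb
  ⟨hi, integral_Ioi_zero_of_hasDerivAt_of_tendsto hf hi ha hb⟩

end FTC

/-- The unnormalized error function. -/
def gaussPrimitive (x : ℝ) : ℝ := ∫ u in (0 : ℝ)..x, Real.exp (-1 * u ^ 2)

theorem hasDerivAt_gaussPrimitive (x : ℝ) :
    HasDerivAt gaussPrimitive (Real.exp (-1 * x ^ 2)) x := by
  have hc : Continuous fun u : ℝ => Real.exp (-1 * u ^ 2) := by fun_prop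
  exact intervalIntegral.integral_hasDerivAt_right (hc.intervalIntegrable _ _)
    (hc.stronglyMeasurableAtFilter _ _) hc.continuousAt

theorem tendsto_gaussPrimitive_atTop : Tendsto gaussPrimitive atTop (𝓝 (√Real.pi / 2)) := by
  have h := intervalIntegral_tendsto_integral_Ioi 0
    (integrable_exp_neg_mul_sq one_pos).integrableOn tendsto_id
  rw [integral_gaussian_Ioi, div_one] at h
  exact h

theorem gaussPrimitive_neg (x : ℝ) : gaussPrimitive (-x) = -gaussPrimitive x := by
  have h := intervalIntegral.integral_comp_neg (a := 0) (b := x)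
    (fun u : ℝ => Real.exp (-1 * u ^ 2))
  simp only [neg_sq, neg_zero] at h
  rw [gaussPrimitive, gaussPrimitive, h, intervalIntegral.integral_symm]

theorem tendsto_gaussPrimitive_atBot : Tendsto gaussPrimitive atBot (𝓝 (-(√Real.pi / 2))) := by
  have h := (tendsto_gaussPrimitive_atTop.comp tendsto_neg_atBot_atTop).neg
  refine h.congr fun x => ?_
  rw [Function.comp_apply, gaussPrimitive_neg, neg_neg]

theorem tendsto_sqrt_nhdsGT_zero : Tendsto (fun t : ℝ => √t) (𝓝[>] 0) (𝓝[>] 0) := by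
  refine tendsto_nhdsWithin_iff.2 ⟨?_, ?_⟩
  · have := (Real.continuous_sqrt.tendsto 0).mono_left (nhdsWithin_le_nhds (s := Ioi 0))
    rwa [Real.sqrt_zero] at this
  · filter_upwards [self_mem_nhdsWithin] with t ht using Real.sqrt_pos.2 ht

section RealKernel

variable {α w : ℝ}

/-- The square of α√t + w/(2√t) is α²t + αw + w²/(4t). The version with -w is used alongside, so
that the terms in w cancel. -/
theorem hasDerivAt_sqrt_sub {t : ℝ} (ht : 0 < t) (α w : ℝ) :
    HasDerivAt (fun t : ℝ => gaussPrimitive (α * √t + w / (2 * √t)))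
      (Real.exp (-α * w) * Real.exp (-(α ^ 2 * t) - w ^ 2 / (4 * t)) *
        (α / (2 * √t) - w / (4 * t * √t))) t := by
  have hs : 0 < √t := Real.sqrt_pos.2 ht
  have h1 := Real.hasDerivAt_sqrt ht.ne'
  have h2 : HasDerivAt (fun t : ℝ => α * √t + w / (2 * √t))
      (α / (2 * √t) - w / (4 * t * √t)) t := by
    refine HasDerivAt.congr_deriv ((h1.const_mul α).fun_add
      ((hasDerivAt_const t w).fun_div (h1.const_mul 2) (by positivity))) ?_
    have : t = √t ^ 2 := (Real.sq_sqrt ht.le).symm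
    field_simp
    rw [← this]
    ring
  refine HasDerivAt.congr_deriv ((hasDerivAt_gaussPrimitive _).comp t h2) ?_
  congr 1
  rw [← Real.exp_add]
  congr 1
  have : t = √t ^ 2 := (Real.sq_sqrt ht.le).symm
  have e : w ^ 2 / (4 * t) = w ^ 2 / (4 * √t ^ 2) := by rw [← this]
  rw [e]
  have e' : α ^ 2 * t = α ^ 2 * √t ^ 2 := by rw [← this]
  rw [e']
  field_simp
  ring

theorem tendsto_sqrt_add_atTop (hα : 0 < α) (w : ℝ) :
    Tendsto (fun t : ℝ => α * √t + w / (2 * √t)) atTop atTop := by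
  have h1 : Tendsto (fun t : ℝ => w / (2 * √t)) atTop (𝓝 0) :=
    (Real.tendsto_sqrt_atTop.const_mul_atTop two_pos).const_div_atTop w
  exact (Real.tendsto_sqrt_atTop.const_mul_atTop hα).atTop_add h1

theorem tendsto_sqrt_add_nhdsGT_zero (α : ℝ) (hw : 0 < w) :
    Tendsto (fun t : ℝ => α * √t + w / (2 * √t)) (𝓝[>] 0) atTop := by
  have h1 : Tendsto (fun t : ℝ => w / 2 * (√t)⁻¹) (𝓝[>] 0) atTop :=
    (tendsto_inv_nhdsGT_zero.comp tendsto_sqrt_nhdsGT_zero).const_mul_atTop (by positivity)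
  have h2 : Tendsto (fun t : ℝ => α * √t) (𝓝[>] 0) (𝓝 (α * 0)) :=
    (tendsto_sqrt_nhdsGT_zero.mono_right nhdsWithin_le_nhds).const_mul α
  refine (h2.add_atTop h1).congr fun t => ?_
  rw [div_mul_eq_div_div, div_eq_mul_inv (w / 2)]

/-- The classical integral `∫₀^∞ (4πt)^{-1/2} exp(-α²t - w²/(4t)) dt = exp(-αw)/(2α)`. -/
theorem integrableOn_and_integral_exp_real (hα : 0 < α) (hw : 0 < w) :
    IntegrableOn (fun t : ℝ => (√(4 * Real.pi * t))⁻¹ *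
      Real.exp (-(α ^ 2 * t) - w ^ 2 / (4 * t))) (Ioi 0) ∧
    ∫ t in Ioi (0 : ℝ), (√(4 * Real.pi * t))⁻¹ * Real.exp (-(α ^ 2 * t) - w ^ 2 / (4 * t)) =
      Real.exp (-α * w) / (2 * α) := by
  have hπ : 0 < √Real.pi := Real.sqrt_pos.2 Real.pi_pos
  -- The weights e^{∓αw} undo the cross terms of the two squares. At 0⁺ the arguments tend to ∓∞, at
  -- infinity both tend to +∞, so only the first summand contributes to the difference.
  set f : ℝ → ℝ := fun t => (2 * α * √Real.pi)⁻¹ *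
    (Real.exp (-α * w) * gaussPrimitive (α * √t + -w / (2 * √t)) +
      Real.exp (α * w) * gaussPrimitive (α * √t + w / (2 * √t))) with hf
  have h := integrableOn_Ioi_and_integral_of_tendsto (f := f)
    (f' := fun t : ℝ => (√(4 * Real.pi * t))⁻¹ * Real.exp (-(α ^ 2 * t) - w ^ 2 / (4 * t)))
    (a := (2 * α * √Real.pi)⁻¹ * (Real.exp (-α * w) * (-(√Real.pi / 2)) +
      Real.exp (α * w) * (√Real.pi / 2)))
    (b := (2 * α * √Real.pi)⁻¹ * (Real.exp (-α * w) * (√Real.pi / 2) +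
      Real.exp (α * w) * (√Real.pi / 2))) ?_ (fun t ht => by positivity) ?_ ?_
  · refine ⟨h.1, h.2.trans ?_⟩
    field_simp
    ring
  · intro t ht
    have ht : 0 < t := ht
    have hs : 0 < √t := Real.sqrt_pos.2 ht
    refine HasDerivAt.congr_deriv ((((hasDerivAt_sqrt_sub ht α (-w)).const_mul _).fun_add
      ((hasDerivAt_sqrt_sub ht α w).const_mul _)).const_mul _) ?_
    have e1 : √(4 * Real.pi * t) = 2 * √Real.pi * √t := by
      rw [Real.sqrt_mul (by positivity), Real.sqrt_mul (by norm_num),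
        show (4 : ℝ) = 2 ^ 2 by norm_num, Real.sqrt_sq (by norm_num)]
    have e2 : Real.exp (-α * w) * Real.exp (α * w) = 1 := by
      rw [← Real.exp_add]; simp
    have e3 : -α * -w = α * w := by ring
    rw [e1, e3, neg_sq]
    calc _ = (2 * α * √Real.pi)⁻¹ * ((Real.exp (-α * w) * Real.exp (α * w)) *
          Real.exp (-(α ^ 2 * t) - w ^ 2 / (4 * t)) *
          ((α / (2 * √t) - -w / (4 * t * √t)) + (α / (2 * √t) - w / (4 * t * √t)))) := by ring
      _ = _ := by
        rw [e2]
        field_simp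
        ring
  · have hneg : Tendsto (fun t : ℝ => α * √t + -w / (2 * √t)) (𝓝[>] 0) atBot := by
      refine (tendsto_neg_atTop_atBot.comp (tendsto_sqrt_add_nhdsGT_zero (-α) hw)).congr
        fun t => ?_
      simp only [Function.comp_apply]
      ring
    exact (((tendsto_gaussPrimitive_atBot.comp hneg).const_mul _).add
      ((tendsto_gaussPrimitive_atTop.comp (tendsto_sqrt_add_nhdsGT_zero α hw)).const_mul _)
      ).const_mul _
  · exact (((tendsto_gaussPrimitive_atTop.comp (tendsto_sqrt_add_atTop hα (-w))).const_mul _).add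
      ((tendsto_gaussPrimitive_atTop.comp (tendsto_sqrt_add_atTop hα w)).const_mul _)
      ).const_mul _

end RealKernel

/-- The integrand of the subordination integral, with `c = w²` complex. -/
def subKernel (α : ℝ) (c : ℂ) (t : ℝ) : ℂ :=
  ((√(4 * Real.pi * t))⁻¹ : ℝ) * Complex.exp (-(α ^ 2 * t : ℝ) - c / (4 * t : ℝ))

theorem norm_subKernel (α : ℝ) (c : ℂ) (t : ℝ) :
    ‖subKernel α c t‖ = (√(4 * Real.pi * t))⁻¹ * Real.exp (-(α ^ 2 * t) - c.re / (4 * t)) := by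
  rw [subKernel, norm_mul, Complex.norm_real, Real.norm_of_nonneg (by positivity),
    Complex.norm_exp, Complex.sub_re, Complex.neg_re, Complex.ofReal_re, Complex.div_ofReal_re]

theorem measurable_subKernel (α : ℝ) (c : ℂ) : Measurable (subKernel α c) := by
  unfold subKernel
  fun_prop

theorem integrableOn_norm_subKernel {α : ℝ} (hα : 0 < α) {c : ℝ} (hc : 0 < c) :
    IntegrableOn (fun t : ℝ => (√(4 * Real.pi * t))⁻¹ * Real.exp (-(α ^ 2 * t) - c / (4 * t)))
      (Ioi 0) := by
  have h := (integrableOn_and_integral_exp_real hα (Real.sqrt_pos.2 hc)).1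
  rwa [Real.sq_sqrt hc.le] at h

theorem integrableOn_subKernel {α : ℝ} (hα : 0 < α) {c : ℂ} (hc : 0 < c.re) :
    IntegrableOn (subKernel α c) (Ioi 0) := by
  refine (integrableOn_norm_subKernel hα hc).mono' (measurable_subKernel α c).aestronglyMeasurable
    (ae_of_all _ fun t => (norm_subKernel α c t).le)

theorem integral_subKernel_ofReal {α : ℝ} (hα : 0 < α) {c : ℝ} (hc : 0 < c) :
    ∫ t in Ioi (0 : ℝ), subKernel α c t =
      Complex.exp (-α * Complex.sqrt c) / (2 * α) := by
  have h := (integrableOn_and_integral_exp_real hα (Real.sqrt_pos.2 hc)).2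
  rw [Real.sq_sqrt hc.le] at h
  have h1 : ∀ t : ℝ, subKernel α c t =
      (((√(4 * Real.pi * t))⁻¹ * Real.exp (-(α ^ 2 * t) - c / (4 * t)) : ℝ) : ℂ) := by
    intro t
    simp [subKernel]
  have h2 : Complex.sqrt c = (√c : ℝ) := by
    rw [Complex.sqrt_of_nonneg (by exact_mod_cast hc.le), Complex.ofReal_re]
  simp_rw [h1]
  rw [integral_complex_ofReal, h, h2]
  push_cast
  rfl

/-- Holomorphy in c is what analytic continuation from positive real c needs. Near c₀ the factor
1/(4t) of the derivative is absorbed by part of the decay e^{-δ/(4t)}. -/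
theorem hasDerivAt_integral_subKernel {α : ℝ} (hα : 0 < α) {c₀ : ℂ} (hc : 0 < c₀.re) :
    HasDerivAt (fun c => ∫ t in Ioi (0 : ℝ), subKernel α c t)
      (∫ t in Ioi (0 : ℝ), -(((4 * t)⁻¹ : ℝ) : ℂ) * subKernel α c₀ t) c₀ := by
  set δ := c₀.re / 2 with hδ
  have hδ0 : 0 < δ := by positivity
  have hs : {c : ℂ | δ < c.re} ∈ 𝓝 c₀ :=
    (isOpen_lt continuous_const Complex.continuous_re).mem_nhds (by
      change δ < c₀.re
      linarith)
  refine (hasDerivAt_integral_of_dominated_loc_of_deriv_le hs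
    (Eventually.of_forall fun c => (measurable_subKernel α c).aestronglyMeasurable)
    (integrableOn_subKernel hα hc)
    (bound := fun t : ℝ => 2 / δ *
      ((√(4 * Real.pi * t))⁻¹ * Real.exp (-(α ^ 2 * t) - (δ / 2) / (4 * t))))
    (F' := fun c t => -(((4 * t)⁻¹ : ℝ) : ℂ) * subKernel α c t)
    ?_ ?_ ((integrableOn_norm_subKernel hα (by positivity)).const_mul _) ?_).2
  · refine Measurable.aestronglyMeasurable ?_
    have := measurable_subKernel α c₀
    fun_prop
  · refine (ae_restrict_iff' measurableSet_Ioi).2 (ae_of_all _ fun t ht c hc => ?_)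
    have ht : 0 < t := ht
    have hc : δ < c.re := hc
    rw [norm_mul, norm_neg, Complex.norm_real, Real.norm_of_nonneg (by positivity), norm_subKernel]
    have h1 : (4 * t)⁻¹ ≤ 2 / δ * Real.exp ((δ / 2) / (4 * t)) := by
      have := (Real.add_one_le_exp ((δ / 2) / (4 * t))).trans' (le_add_of_nonneg_right zero_le_one)
      calc (4 * t)⁻¹ = 2 / δ * ((δ / 2) / (4 * t)) := by field_simp
        _ ≤ _ := by gcongr
    have h2 : c.re / (4 * t) ≥ δ / (4 * t) := by gcongr
    calc (4 * t)⁻¹ * ((√(4 * Real.pi * t))⁻¹ * Real.exp (-(α ^ 2 * t) - c.re / (4 * t)))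
        ≤ (2 / δ * Real.exp ((δ / 2) / (4 * t))) * ((√(4 * Real.pi * t))⁻¹ *
          Real.exp (-(α ^ 2 * t) - δ / (4 * t))) := by gcongr
      _ = 2 / δ * ((√(4 * Real.pi * t))⁻¹ * (Real.exp ((δ / 2) / (4 * t)) *
          Real.exp (-(α ^ 2 * t) - δ / (4 * t)))) := by ring
      _ = _ := by
        rw [← Real.exp_add]
        congr 3
        ring
  · refine ae_of_all _ fun t c _ => ?_
    unfold subKernel
    have h1 : HasDerivAt (fun c : ℂ => -((α ^ 2 * t : ℝ) : ℂ) - c / (4 * t : ℝ))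
        (-(1 / ((4 * t : ℝ) : ℂ))) c :=
      HasDerivAt.congr_deriv (((hasDerivAt_id' c).div_const _).const_sub _) rfl
    refine HasDerivAt.congr_deriv (h1.cexp.const_mul _) ?_
    push_cast
    ring

/-- Both sides are holomorphic on the right half-plane and agree on the reals above 1, which
accumulate at the point 1; apply the identity theorem. -/
theorem integral_subKernel {α : ℝ} (hα : 0 < α) {c : ℂ} (hc : 0 < c.re) :
    ∫ t in Ioi (0 : ℝ), subKernel α c t = Complex.exp (-α * Complex.sqrt c) / (2 * α) := by
  set U : Set ℂ := {c | 0 < c.re} with hU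
  have hUo : IsOpen U := isOpen_lt continuous_const Complex.continuous_re
  have hUc : IsPreconnected U := (convex_halfSpace_re_gt 0).isPreconnected
  have h1 : AnalyticOnNhd ℂ (fun c => ∫ t in Ioi (0 : ℝ), subKernel α c t) U :=
    DifferentiableOn.analyticOnNhd (fun c hc =>
      (hasDerivAt_integral_subKernel hα hc).differentiableAt.differentiableWithinAt) hUo
  have h2 : AnalyticOnNhd ℂ (fun c => Complex.exp (-α * Complex.sqrt c) / (2 * α)) U :=
    DifferentiableOn.analyticOnNhd (fun c hc => by
      have := Complex.differentiableAt_sqrt (Or.inl hc : c ∈ Complex.slitPlane)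
      exact ((this.const_mul _).cexp.div_const _).differentiableWithinAt) hUo
  refine h1.eqOn_of_preconnected_of_frequently_eq h2 hUc (z₀ := 1) (by simp [hU]) ?_ hc
  have h3 : Tendsto (fun x : ℝ => (x : ℂ)) (𝓝[>] 1) (𝓝[≠] 1) := by
    refine tendsto_nhdsWithin_iff.2 ⟨?_, ?_⟩
    · exact (Complex.continuous_ofReal.tendsto' 1 1 (by simp)).mono_left nhdsWithin_le_nhds
    · filter_upwards [self_mem_nhdsWithin] with x hx h
      have hx' : (1 : ℝ) < x := hx
      have h1 : (x : ℂ) = 1 := h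
      have : x = 1 := by exact_mod_cast h1
      linarith
  refine h3.frequently (Eventually.frequently ?_)
  filter_upwards [self_mem_nhdsWithin] with x hx
  exact integral_subKernel_ofReal hα (zero_lt_one.trans hx)

/-! ### Bounds for the denominator -/

/-- Every term of the difference of the two power series is nonnegative; keeping those of degree 2
and 8 gives the bound, with 40320 = 8!. The sixth power supplies the later decay in y and Im λ. -/
theorem le_cosh_sub_cosh {x y : ℝ} (h : y ^ 2 ≤ x ^ 2) :
    (x ^ 2 - y ^ 2) * (1 + x ^ 6) / 40320 ≤ Real.cosh x - Real.cosh y := by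
  have h1 := (Real.hasSum_cosh x).sub (Real.hasSum_cosh y)
  have h2 : ∀ n : ℕ, n ∉ ({1, 4} : Finset ℕ) →
      0 ≤ x ^ (2 * n) / ((2 * n).factorial : ℝ) - y ^ (2 * n) / ((2 * n).factorial : ℝ) := by
    intro n _
    rw [← sub_div, pow_mul, pow_mul]
    have := pow_le_pow_left₀ (sq_nonneg y) h n
    exact div_nonneg (by linarith) (by positivity)
  have h3 := sum_le_hasSum {1, 4} h2 h1
  rw [Finset.sum_pair (by norm_num)] at h3
  norm_num [Nat.factorial] at h3
  refine le_trans ?_ h3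
  have h4 : y ^ 8 ≤ y ^ 2 * x ^ 6 := by
    have := pow_le_pow_left₀ (sq_nonneg y) h 3
    calc y ^ 8 = y ^ 2 * (y ^ 2) ^ 3 := by ring
      _ ≤ y ^ 2 * (x ^ 2) ^ 3 := by gcongr
      _ = _ := by ring
  nlinarith [h4, h]

section Sqrt

variable {lam : ℂ} {y : ℝ}

theorem re_sq_add_four_mul (lam : ℂ) (y : ℝ) : ((y : ℂ) ^ 2 + 4 * lam).re = y ^ 2 + 4 * lam.re := by
  simp [← Complex.ofReal_pow]

theorem im_sq_add_four_mul (lam : ℂ) (y : ℝ) : ((y : ℂ) ^ 2 + 4 * lam).im = 4 * lam.im := by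
  simp [← Complex.ofReal_pow]

theorem re_sqrt_nonneg (c : ℂ) : 0 ≤ (Complex.sqrt c).re := by
  rw [Complex.sqrt, Complex.cpow_inv_two_re]
  exact Real.sqrt_nonneg _

theorem re_sqrt_sq (c : ℂ) : (Complex.sqrt c).re ^ 2 = (‖c‖ + c.re) / 2 := by
  rw [Complex.sqrt, Complex.cpow_inv_two_re, Real.sq_sqrt]
  linarith [neg_abs_le c.re, Complex.abs_re_le_norm c]

theorem sq_add_four_re_le_re_sqrt_sq (lam : ℂ) (y : ℝ) :
    y ^ 2 + 4 * lam.re ≤ (Complex.sqrt (y ^ 2 + 4 * lam)).re ^ 2 := by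
  rw [re_sqrt_sq, ← re_sq_add_four_mul]
  linarith [Complex.re_le_norm ((y : ℂ) ^ 2 + 4 * lam)]

/-- Here (Re √c)² = (|c| + Re c)/2 ≥ Re c. The strict gap puts cosh √(y² + 4λ) outside the ellipse
containing `halfTrace a y`. -/
theorem abs_lt_re_sqrt (h : 0 < lam.re) (y : ℝ) :
    |y| < (Complex.sqrt (y ^ 2 + 4 * lam)).re := by
  refine abs_lt_of_sq_lt_sq ?_ (re_sqrt_nonneg _)
  linarith [sq_add_four_re_le_re_sqrt_sq lam y]

theorem sq_add_abs_le_re_sqrt_sq (h : 0 < lam.re) (y : ℝ) :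
    (y ^ 2 + 4 * |lam.im|) / 2 ≤ (Complex.sqrt (y ^ 2 + 4 * lam)).re ^ 2 := by
  rw [re_sqrt_sq, re_sq_add_four_mul]
  have h1 := Complex.abs_im_le_norm ((y : ℂ) ^ 2 + 4 * lam)
  rw [im_sq_add_four_mul, abs_mul, abs_of_pos (by norm_num : (0 : ℝ) < 4)] at h1
  linarith

end Sqrt

/-- The denominator `cosh √(y² + 4λ) - X`, `X = (a e^{-y} + ā e^{y})/2`. -/
def resolventDenom (a lam : ℂ) (y : ℝ) : ℂ :=
  Complex.cosh (Complex.sqrt ((y : ℂ) ^ 2 + 4 * lam)) - halfTrace a y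

theorem laplaceDenom_eq (r z : ℝ) (lam : ℂ) (y : ℝ) :
    laplaceDenom r z lam y = resolventDenom (Real.cos r * Complex.exp (z * Complex.I)) lam y := by
  rw [laplaceDenom, resolventDenom, halfTrace_cyl]

section Denom

variable {a lam : ℂ}

/-- With A = Re √(y² + 4λ), A² - y² is at least 4 Re λ, and A² dominates both y²/2 and |Im λ|; hence
1 + A⁶ controls (1 + y²)(1 + (Im λ)²). The constant is 4 · 8! and is not optimal. -/
theorem re_le_norm_resolventDenom (ha : ‖a‖ ≤ 1) (h : 0 < lam.re) (y : ℝ) :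
    lam.re * ((1 + y ^ 2) * (1 + lam.im ^ 2)) / 161280 ≤ ‖resolventDenom a lam y‖ := by
  refine le_trans ?_ (cosh_sub_cosh_le_norm ha y _)
  set A := (Complex.sqrt ((y : ℂ) ^ 2 + 4 * lam)).re
  have h1 : y ^ 2 + 4 * lam.re ≤ A ^ 2 := sq_add_four_re_le_re_sqrt_sq lam y
  have h2 : (y ^ 2 + 4 * |lam.im|) / 2 ≤ A ^ 2 := sq_add_abs_le_re_sqrt_sq h y
  refine le_trans ?_ (le_cosh_sub_cosh (by linarith))
  have h3 : (1 + y ^ 2) / 2 ≤ 1 + A ^ 2 := by linarith [abs_nonneg lam.im]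
  have h4 : 1 + lam.im ^ 2 ≤ (1 + A ^ 2) ^ 2 := by
    have h5 : |lam.im| ≤ A ^ 2 := by nlinarith [sq_nonneg y, abs_nonneg lam.im]
    nlinarith [sq_abs lam.im, abs_nonneg lam.im, sq_nonneg A]
  have h5 : (1 + A ^ 2) ^ 3 ≤ 4 * (1 + A ^ 6) := by
    nlinarith [mul_nonneg (by positivity : 0 ≤ 1 + A ^ 2) (sq_nonneg (A ^ 2 - 1))]
  have h6 : (1 + y ^ 2) * (1 + lam.im ^ 2) ≤ 8 * (1 + A ^ 6) := by
    calc (1 + y ^ 2) * (1 + lam.im ^ 2) ≤ (2 * (1 + A ^ 2)) * (1 + A ^ 2) ^ 2 := by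
          gcongr; linarith
      _ = 2 * (1 + A ^ 2) ^ 3 := by ring
      _ ≤ _ := by linarith
  calc lam.re * ((1 + y ^ 2) * (1 + lam.im ^ 2)) / 161280
      ≤ lam.re * (8 * (1 + A ^ 6)) / 161280 := by gcongr
    _ ≤ 4 * lam.re * (1 + A ^ 6) / 40320 := by
        have : 0 ≤ lam.re * (1 + A ^ 6) := by positivity
        linarith
    _ ≤ _ := by gcongr; linarith

theorem resolventDenom_ne_zero (ha : ‖a‖ ≤ 1) (h : 0 < lam.re) (y : ℝ) :
    resolventDenom a lam y ≠ 0 := by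
  refine norm_pos_iff.1 (lt_of_lt_of_le ?_ (re_le_norm_resolventDenom ha h y))
  positivity

theorem norm_inv_resolventDenom_le (ha : ‖a‖ ≤ 1) (h : 0 < lam.re) (y : ℝ) :
    ‖(resolventDenom a lam y)⁻¹‖ ≤ 161280 / lam.re * ((1 + lam.im ^ 2)⁻¹ * (1 + y ^ 2)⁻¹) := by
  rw [norm_inv]
  calc ‖resolventDenom a lam y‖⁻¹ ≤ (lam.re * ((1 + y ^ 2) * (1 + lam.im ^ 2)) / 161280)⁻¹ :=
        inv_anti₀ (by positivity) (re_le_norm_resolventDenom ha h y)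
    _ = _ := by field_simp

theorem continuousOn_resolventDenom :
    ContinuousOn (fun x : (ℂ × ℂ) × ℝ => resolventDenom x.1.1 x.1.2 x.2)
      {x | 0 < x.1.2.re} := by
  intro x hx
  refine ContinuousAt.continuousWithinAt ?_
  have h1 : ContinuousAt (fun x : (ℂ × ℂ) × ℝ => (x.2 : ℂ) ^ 2 + 4 * x.1.2) x := by fun_prop
  have h2 : ContinuousAt Complex.sqrt ((x.2 : ℂ) ^ 2 + 4 * x.1.2) := by
    refine Complex.continuousAt_sqrt (Or.inl ?_)
    rw [re_sq_add_four_mul]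
    have : 0 < x.1.2.re := hx
    positivity
  have h3 : ContinuousAt (fun x : (ℂ × ℂ) × ℝ => halfTrace x.1.1 x.2) x := by
    unfold halfTrace
    fun_prop
  have h4 : ContinuousAt (fun x : (ℂ × ℂ) × ℝ =>
      Complex.cosh (Complex.sqrt ((x.2 : ℂ) ^ 2 + 4 * x.1.2))) x :=
    Complex.continuous_cosh.continuousAt.comp (ContinuousAt.comp (g := Complex.sqrt) h2 h1)
  exact h4.sub h3

theorem continuous_resolventDenom (a : ℂ) (h : 0 < lam.re) : Continuous (resolventDenom a lam) := by
  refine continuousOn_resolventDenom.comp_continuous (f := fun y : ℝ => ((a, lam), y))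
    (by fun_prop) fun y => h

theorem integrable_inv_resolventDenom (ha : ‖a‖ ≤ 1) (h : 0 < lam.re) :
    Integrable (fun y => (resolventDenom a lam y)⁻¹) := by
  refine ((integrable_inv_one_add_sq.const_mul (1 + lam.im ^ 2)⁻¹).const_mul
    (161280 / lam.re)).mono' ?_ (ae_of_all _ fun y => norm_inv_resolventDenom_le ha h y)
  exact ((continuous_resolventDenom a h).inv₀
    fun y => resolventDenom_ne_zero ha h y).aestronglyMeasurable

theorem norm_integral_inv_resolventDenom_le (ha : ‖a‖ ≤ 1) (h : 0 < lam.re) :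
    ‖∫ y, (resolventDenom a lam y)⁻¹‖ ≤
      161280 / lam.re * Real.pi * (1 + lam.im ^ 2)⁻¹ := by
  refine (norm_integral_le_of_norm_le ((integrable_inv_one_add_sq.const_mul
    (1 + lam.im ^ 2)⁻¹).const_mul (161280 / lam.re))
    (ae_of_all _ fun y => norm_inv_resolventDenom_le ha h y)).trans_eq ?_
  rw [integral_const_mul, integral_const_mul, integral_univ_inv_one_add_sq]
  ring

theorem continuous_integral_inv_resolventDenom (ha : ‖a‖ ≤ 1) {γ : ℝ} (h : 0 < γ) :
    Continuous (fun τ : ℝ => ∫ y, (resolventDenom a (γ + τ * Complex.I) y)⁻¹) := by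
  have hre : ∀ τ : ℝ, ((γ : ℂ) + τ * Complex.I).re = γ := fun τ => by simp
  have hc : Continuous fun x : ℝ × ℝ => resolventDenom a (γ + x.1 * Complex.I) x.2 :=
    continuousOn_resolventDenom.comp_continuous
      (f := fun x : ℝ × ℝ => ((a, γ + x.1 * Complex.I), x.2)) (by fun_prop) fun x => by
        change 0 < ((γ : ℂ) + x.1 * Complex.I).re
        rwa [hre]
  have hi : Continuous fun x : ℝ × ℝ => (resolventDenom a (γ + x.1 * Complex.I) x.2)⁻¹ :=
    hc.inv₀ fun x => resolventDenom_ne_zero ha (by rwa [hre]) _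
  have h1 : ∀ τ : ℝ, Continuous fun y : ℝ => (resolventDenom a (γ + τ * Complex.I) y)⁻¹ :=
    fun τ => (continuous_resolventDenom a (by rwa [hre])).inv₀ fun y =>
      resolventDenom_ne_zero ha (by rwa [hre]) _
  have h2 : ∀ y : ℝ, Continuous fun τ : ℝ => (resolventDenom a (γ + τ * Complex.I) y)⁻¹ :=
    fun y => Continuous.comp (f := fun τ : ℝ => (τ, y)) hi (by fun_prop)
  refine continuous_of_dominated (bound := fun y => 161280 / γ * (1 * (1 + y ^ 2)⁻¹))
    (fun τ => (h1 τ).aestronglyMeasurable) (fun τ => ae_of_all _ fun y => ?_)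
    ((integrable_inv_one_add_sq.const_mul 1).const_mul _) (ae_of_all _ h2)
  refine (norm_inv_resolventDenom_le ha (by rwa [hre]) y).trans ?_
  rw [hre]
  gcongr
  exact inv_le_one_of_one_le₀ (by linarith [sq_nonneg ((γ : ℂ) + τ * Complex.I).im])

/-- The quadratic decay in Im λ gives absolute convergence of the outer contour integral. -/
theorem integrable_integral_inv_resolventDenom (ha : ‖a‖ ≤ 1) {γ : ℝ} (h : 0 < γ) :
    Integrable (fun τ : ℝ => ∫ y, (resolventDenom a (γ + τ * Complex.I) y)⁻¹) := by
  refine (integrable_inv_one_add_sq.const_mul (161280 / γ * Real.pi)).mono'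
    (continuous_integral_inv_resolventDenom ha h).aestronglyMeasurable (ae_of_all _ fun τ => ?_)
  have := norm_integral_inv_resolventDenom_le (lam := γ + τ * Complex.I) ha (by simpa using h)
  simpa using this

end Denom

/-! ### Laplace transform of the heat series -/

theorem MeasureTheory.integrable_of_hasSum_of_summable_integral_norm {X : Type*}
    [MeasurableSpace X] {μ : Measure X} {F : ℕ → X → ℂ} {f : X → ℂ}
    (hF : ∀ i, Integrable (F i) μ) (hsum : Summable fun i => ∫ x, ‖F i x‖ ∂μ)
    (hf : ∀ᵐ x ∂μ, HasSum (fun i => F i x) (f x)) : Integrable f μ := by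
  have hmeas : AEStronglyMeasurable f μ :=
    aestronglyMeasurable_of_tendsto_ae atTop
      (f := fun n x => ∑ i ∈ Finset.range n, F i x)
      (fun n => (integrable_finsetSum _ fun i _ => hF i).aestronglyMeasurable)
      (hf.mono fun x hx => hx.tendsto_sum_nat)
  refine ⟨hmeas, ?_⟩
  have h1 : ∀ i, ∫⁻ x, ‖F i x‖ₑ ∂μ = ENNReal.ofReal (∫ x, ‖F i x‖ ∂μ) := fun i =>
    (ofReal_integral_norm_eq_lintegral_enorm (hF i)).symm
  have h2 : ∫⁻ x, ‖f x‖ₑ ∂μ ≤ ∫⁻ x, ∑' i, ‖F i x‖ₑ ∂μ := by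
    refine lintegral_mono_ae (hf.mono fun x hx => ?_)
    rw [← hx.tsum_eq]
    exact enorm_tsum_le_tsum_enorm
  refine h2.trans_lt ?_
  rw [lintegral_tsum fun i => (hF i).aestronglyMeasurable.enorm]
  simp_rw [h1]
  rw [← ENNReal.ofReal_tsum_of_nonneg (fun i => integral_nonneg fun x => norm_nonneg _) hsum]
  exact ENNReal.ofReal_lt_top

/-- The integrand of the `m`-th term of the Laplace transform of the heat series. -/
def laplaceTerm (m : ℕ) (a lam : ℂ) (x : ℝ × ℝ) : ℂ :=
  (m + 1) * chebU m (halfTrace a x.2) * subKernel (m + 1) ((x.2 : ℂ) ^ 2 + 4 * lam) x.1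

section LaplaceTerm

variable {a lam : ℂ}

theorem measurable_laplaceTerm (m : ℕ) (a lam : ℂ) : Measurable (laplaceTerm m a lam) := by
  have h1 : Measurable fun x : ℝ × ℝ => chebU m (halfTrace a x.2) :=
    ((continuous_chebU m).comp ((continuous_halfTrace a).comp _root_.continuous_snd)).measurable
  have h2 : Measurable fun x : ℝ × ℝ => subKernel (m + 1) ((x.2 : ℂ) ^ 2 + 4 * lam) x.1 := by
    unfold subKernel
    fun_prop
  exact (measurable_const.mul h1).mul h2

/-- The exponents recombine through (m+1)² = m(m+2) + 1 and (y² + 4λ)/(4t) = y²/(4t) + λ/t. -/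
theorem integral_laplaceTerm_right {t : ℝ} (ht : 0 < t) (m : ℕ) (a lam : ℂ) :
    ∫ y, laplaceTerm m a lam (t, y) = heatTerm m t a * Complex.exp (-t - lam / t) := by
  have h1 : ∀ y : ℝ, laplaceTerm m a lam (t, y) =
      ((gauss t y : ℂ) * chebU m (halfTrace a y)) *
        (((m + 1) * Real.exp (-(m * (m + 2)) * t) : ℝ) * Complex.exp (-t - lam / t)) := by
    intro y
    have ht' : (t : ℂ) ≠ 0 := by exact_mod_cast ht.ne'
    simp only [laplaceTerm, subKernel, gauss]
    push_cast
    have e : Complex.exp (-((((m : ℂ) + 1) ^ 2 * t)) - ((y : ℂ) ^ 2 + 4 * lam) / (4 * t)) =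
        Complex.exp (-(y : ℂ) ^ 2 / (4 * t)) * (Complex.exp (-((m : ℂ) * (m + 2)) * t) *
          Complex.exp (-t - lam / t)) := by
      rw [← Complex.exp_add, ← Complex.exp_add]
      congr 1
      field_simp
      ring
    rw [e]
    ring
  simp_rw [h1]
  rw [integral_mul_const, heatTerm_eq ht]
  ring

theorem integrable_laplaceTerm_left (h : 0 < lam.re) (m : ℕ) (y : ℝ) :
    IntegrableOn (fun t => laplaceTerm m a lam (t, y)) (Ioi 0) := by
  have h1 := integrableOn_subKernel (α := (m : ℝ) + 1) (by positivity)
    (c := (y : ℂ) ^ 2 + 4 * lam) (by rw [re_sq_add_four_mul]; positivity)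
  exact Integrable.const_mul h1 (((m : ℂ) + 1) * chebU m (halfTrace a y))

theorem integral_laplaceTerm_left (h : 0 < lam.re) (m : ℕ) (y : ℝ) :
    ∫ t in Ioi (0 : ℝ), laplaceTerm m a lam (t, y) =
      1 / 2 * (Complex.exp (-((m + 1) * Complex.sqrt ((y : ℂ) ^ 2 + 4 * lam))) *
        chebU m (halfTrace a y)) := by
  simp only [laplaceTerm]
  rw [integral_const_mul, integral_subKernel (by positivity)
    (by rw [re_sq_add_four_mul]; positivity)]
  have : (m : ℂ) + 1 ≠ 0 := by exact_mod_cast m.succ_ne_zero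
  push_cast
  field_simp

theorem mul_exp_neg_le_inv_sq {m x : ℝ} (hm : 0 < m) (hx : 0 < x) :
    m * Real.exp (-(m * x)) ≤ 6 / (m ^ 2 * x ^ 3) := by
  have h := Real.pow_div_factorial_le_exp (x := m * x) (by positivity) 3
  norm_num [Nat.factorial] at h
  rw [Real.exp_neg, ← div_eq_mul_inv, div_le_div_iff₀ (Real.exp_pos _) (by positivity)]
  calc m * (m ^ 2 * x ^ 3) = 6 * ((m * x) ^ 3 / 6) := by ring
    _ ≤ _ := by gcongr

theorem exp_neg_half_abs_le (y : ℝ) : Real.exp (-(|y| / 2)) ≤ 8 * (1 + y ^ 2)⁻¹ := by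
  rw [Real.exp_neg, ← div_eq_mul_inv, ← inv_div (1 + y ^ 2) 8]
  refine inv_anti₀ (by positivity) ?_
  have := Real.quadratic_le_exp_of_nonneg (x := |y| / 2) (by positivity)
  nlinarith [sq_abs y, abs_nonneg y]

/-- Passing to norms replaces λ by its real part γ, for which the subordination integral is
explicit. The gap δ = √(y²+4γ) - |y| shrinks as |y| grows; using δ⁻³ gives summability in m, and its
growth in y is absorbed by half of the decay e^{-|y|}. -/
theorem integral_norm_laplaceTerm_left_le (ha : ‖a‖ ≤ 1) (h : 0 < lam.re) (m : ℕ) (y : ℝ) :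
    ∫ t in Ioi (0 : ℝ), ‖laplaceTerm m a lam (t, y)‖ ≤
      144 * Real.exp (√lam.re / 2) / lam.re ^ 3 * (((m : ℝ) + 1) ^ 2)⁻¹ * (1 + y ^ 2)⁻¹ := by
  set γ := lam.re with hγ
  have hm : (0 : ℝ) < m + 1 := by positivity
  set A := √(y ^ 2 + 4 * γ) with hA
  have hA2 : A ^ 2 = y ^ 2 + 4 * γ := Real.sq_sqrt (by positivity)
  have hyA : |y| < A := by
    rw [hA]
    exact Real.lt_sqrt_of_sq_lt (by rw [sq_abs]; linarith)
  have hA' : A ≤ |y| + 2 * √γ := by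
    rw [hA, Real.sqrt_le_iff]
    refine ⟨by positivity, ?_⟩
    nlinarith [sq_abs y, Real.sq_sqrt h.le, abs_nonneg y, Real.sqrt_nonneg γ,
      mul_nonneg (abs_nonneg y) (Real.sqrt_nonneg γ)]
  have h1 : ∫ t in Ioi (0 : ℝ), ‖laplaceTerm m a lam (t, y)‖ =
      1 / 2 * ‖Complex.exp (-((m + 1) * (A : ℂ))) * chebU m (halfTrace a y)‖ := by
    have h2 : ∀ t : ℝ, ‖laplaceTerm m a lam (t, y)‖ = ((m + 1) * ‖chebU m (halfTrace a y)‖) *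
        ((√(4 * Real.pi * t))⁻¹ * Real.exp (-(((m : ℝ) + 1) ^ 2 * t) - A ^ 2 / (4 * t))) := by
      intro t
      rw [laplaceTerm, norm_mul, norm_subKernel, norm_mul, re_sq_add_four_mul, hA2]
      congr 3
      exact_mod_cast Complex.norm_natCast (m + 1)
    simp_rw [h2]
    rw [integral_const_mul, (integrableOn_and_integral_exp_real hm
      ((abs_nonneg y).trans_lt hyA)).2, norm_mul, Complex.norm_exp]
    have e : (-(((m : ℂ) + 1) * A)).re = -((m : ℝ) + 1) * A := by
      rw [← Complex.ofReal_natCast, ← Complex.ofReal_one, ← Complex.ofReal_add,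
        ← Complex.ofReal_mul, ← Complex.ofReal_neg, Complex.ofReal_re]
      ring
    rw [e]
    field_simp
  rw [h1]
  set δ := A - |y| with hδ
  have hδ0 : 0 < δ := by linarith
  have h3 : ‖Complex.exp (-((m + 1) * (A : ℂ))) * chebU m (halfTrace a y)‖ ≤
      Real.exp (-|y|) * (6 / (((m : ℝ) + 1) ^ 2 * δ ^ 3)) := by
    refine (norm_exp_mul_chebU_le ha m y A).trans ?_
    rw [Complex.ofReal_re, mul_comm ((m : ℝ) + 1), mul_assoc]
    gcongr
    exact mul_exp_neg_le_inv_sq hm hδ0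
  have h4 : (δ ^ 3)⁻¹ ≤ 6 / γ ^ 3 * Real.exp (√γ / 2 + |y| / 2) := by
    -- Rationalizing the difference turns the inverse cube of the gap into a polynomially growing
    -- factor, estimated by an exponential.
    have e1 : δ * (A + |y|) = 4 * γ := by rw [hδ]; nlinarith [sq_abs y]
    have e2 : (δ ^ 3)⁻¹ = ((A + |y|) / 4) ^ 3 / γ ^ 3 := by
      have : γ = δ * ((A + |y|) / 4) := by linarith
      rw [this]
      have : A + |y| ≠ 0 := by linarith [abs_nonneg y]
      field_simp
    have e3 := Real.pow_div_factorial_le_exp (x := (A + |y|) / 4) (by linarith [abs_nonneg y]) 3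
    norm_num [Nat.factorial] at e3
    have e4 : Real.exp ((A + |y|) / 4) ≤ Real.exp (√γ / 2 + |y| / 2) :=
      Real.exp_le_exp.2 (by linarith)
    rw [e2, div_mul_eq_mul_div]
    gcongr
    linarith
  calc 1 / 2 * ‖Complex.exp (-((m + 1) * (A : ℂ))) * chebU m (halfTrace a y)‖
      ≤ 1 / 2 * (Real.exp (-|y|) * (6 / (((m : ℝ) + 1) ^ 2 * δ ^ 3))) := by gcongr
    _ = 3 * (((m : ℝ) + 1) ^ 2)⁻¹ * (Real.exp (-|y|) * (δ ^ 3)⁻¹) := by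
        field_simp
        ring
    _ ≤ 3 * (((m : ℝ) + 1) ^ 2)⁻¹ * (Real.exp (-|y|) *
        (6 / γ ^ 3 * Real.exp (√γ / 2 + |y| / 2))) := by gcongr
    _ = 18 * Real.exp (√γ / 2) / γ ^ 3 * (((m : ℝ) + 1) ^ 2)⁻¹ * Real.exp (-(|y| / 2)) := by
        have : Real.exp (-(|y| / 2)) = Real.exp (-|y|) * Real.exp (|y| / 2) := by
          rw [← Real.exp_add]
          congr 1
          ring
        rw [this, Real.exp_add]
        ring
    _ ≤ 18 * Real.exp (√γ / 2) / γ ^ 3 * (((m : ℝ) + 1) ^ 2)⁻¹ * (8 * (1 + y ^ 2)⁻¹) := by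
        gcongr
        exact exp_neg_half_abs_le y
    _ = _ := by ring

theorem integrable_laplaceTerm (ha : ‖a‖ ≤ 1) (h : 0 < lam.re) (m : ℕ) :
    Integrable (laplaceTerm m a lam) ((volume.restrict (Ioi 0)).prod volume) := by
  have hm := (measurable_laplaceTerm m a lam)
  refine (integrable_prod_iff' hm.aestronglyMeasurable).2
    ⟨ae_of_all _ fun y => integrable_laplaceTerm_left h m y, ?_⟩
  refine (integrable_inv_one_add_sq.const_mul (144 * Real.exp (√lam.re / 2) / lam.re ^ 3 *
    (((m : ℝ) + 1) ^ 2)⁻¹)).mono'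
    (hm.norm.stronglyMeasurable.integral_prod_left').aestronglyMeasurable
    (ae_of_all _ fun y => ?_)
  rw [Real.norm_of_nonneg (integral_nonneg fun t => norm_nonneg _)]
  exact integral_norm_laplaceTerm_left_le ha h m y

theorem integral_norm_laplaceTerm_le (ha : ‖a‖ ≤ 1) (h : 0 < lam.re) (m : ℕ) :
    ∫ x, ‖laplaceTerm m a lam x‖ ∂((volume.restrict (Ioi 0)).prod volume) ≤
      144 * Real.exp (√lam.re / 2) / lam.re ^ 3 * Real.pi * (((m : ℝ) + 1) ^ 2)⁻¹ := by
  have hi := integrable_laplaceTerm ha h m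
  rw [integral_prod_symm _ hi.norm]
  calc _ ≤ ∫ y : ℝ, 144 * Real.exp (√lam.re / 2) / lam.re ^ 3 * (((m : ℝ) + 1) ^ 2)⁻¹ *
        (1 + y ^ 2)⁻¹ := integral_mono hi.norm.integral_prod_right
          (integrable_inv_one_add_sq.const_mul _)
          fun y => integral_norm_laplaceTerm_left_le ha h m y
    _ = _ := by
      rw [integral_const_mul, integral_univ_inv_one_add_sq]
      ring

theorem summable_integral_norm_laplaceTerm (ha : ‖a‖ ≤ 1) (h : 0 < lam.re) :
    Summable fun m => ∫ x, ‖laplaceTerm m a lam x‖ ∂((volume.restrict (Ioi 0)).prod volume) := by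
  refine Summable.of_nonneg_of_le (fun m => integral_nonneg fun x => norm_nonneg _)
    (fun m => integral_norm_laplaceTerm_le ha h m) (Summable.mul_left _ ?_)
  have := (summable_nat_add_iff 1).2 (Real.summable_nat_pow_inv.2 (one_lt_two : 1 < 2))
  simpa using this

/-- The Laplace transform of the heat series. -/
theorem integrableOn_heatSeries_mul_exp (ha : ‖a‖ ≤ 1) (h : 0 < lam.re) :
    IntegrableOn (fun t : ℝ => heatSeries t a * Complex.exp (-t - lam / t)) (Ioi 0) ∧
    ∫ t in Ioi (0 : ℝ), heatSeries t a * Complex.exp (-t - lam / t) =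
      1 / 4 * ∫ y, (resolventDenom a lam y)⁻¹ := by
  set F : ℕ → ℝ → ℂ := fun m t => ∫ y, laplaceTerm m a lam (t, y) with hF
  set K : ℕ → ℝ → ℂ := fun m y => ∫ t in Ioi (0 : ℝ), laplaceTerm m a lam (t, y) with hK
  have hi := fun m => integrable_laplaceTerm ha h m
  have hs := summable_integral_norm_laplaceTerm ha h
  have hFi : ∀ m, IntegrableOn (F m) (Ioi 0) := fun m => (hi m).integral_prod_left
  have hKi : ∀ m, Integrable (K m) := fun m => (hi m).integral_prod_right
  have hFs : Summable fun m => ∫ t in Ioi (0 : ℝ), ‖F m t‖ := by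
    refine hs.of_nonneg_of_le (fun m => integral_nonneg fun x => norm_nonneg _) fun m => ?_
    rw [integral_prod _ (hi m).norm]
    exact integral_mono (hFi m).norm (hi m).norm.integral_prod_left
      fun t => norm_integral_le_integral_norm _
  have hKs : Summable fun m => ∫ y, ‖K m y‖ := by
    refine hs.of_nonneg_of_le (fun m => integral_nonneg fun x => norm_nonneg _) fun m => ?_
    rw [integral_prod_symm _ (hi m).norm]
    exact integral_mono (hKi m).norm (hi m).norm.integral_prod_right
      fun y => norm_integral_le_integral_norm _
  have hFsum : ∀ t ∈ Ioi (0 : ℝ), HasSum (fun m => F m t)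
      (heatSeries t a * Complex.exp (-t - lam / t)) := fun t ht => by
    simp only [hF, integral_laplaceTerm_right ht]
    exact (hasSum_heatTerm ht ha).mul_right _
  have hKsum : ∀ y : ℝ, HasSum (fun m => K m y) (1 / 4 * (resolventDenom a lam y)⁻¹) := by
    intro y
    simp only [hK, integral_laplaceTerm_left h]
    have := (hasSum_exp_mul_chebU ha (abs_lt_re_sqrt h y)).mul_left (1 / 2)
    rw [show (1 / 4 * (resolventDenom a lam y)⁻¹) = 1 / 2 *
      (1 / (2 * (Complex.cosh (Complex.sqrt ((y : ℂ) ^ 2 + 4 * lam)) - halfTrace a y))) by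
        rw [resolventDenom, one_div (2 * _), mul_inv]; ring]
    exact this
  have hae : ∀ᵐ t ∂volume.restrict (Ioi (0 : ℝ)), HasSum (fun m => F m t)
      (heatSeries t a * Complex.exp (-t - lam / t)) :=
    (ae_restrict_iff' measurableSet_Ioi).2 (ae_of_all _ hFsum)
  refine ⟨integrable_of_hasSum_of_summable_integral_norm hFi hFs hae, ?_⟩
  have e1 := (hasSum_integral_of_summable_integral_norm hFi hFs).tsum_eq
  have e2 := (hasSum_integral_of_summable_integral_norm hKi hKs).tsum_eq
  -- Integrating the same term first in y gives the heat series, and first in t gives the Chebyshev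
  -- generating function; the norm bounds allow both sums to pass under the integral.
  have e3 : ∀ m, ∫ t in Ioi (0 : ℝ), F m t = ∫ y, K m y := fun m =>
    integral_integral_swap (hi m)
  rw [integral_congr_ae (hae.mono fun t ht => ht.tsum_eq.symm), ← e1, tsum_congr e3, e2]
  simp_rw [fun y => (hKsum y).tsum_eq]
  rw [integral_const_mul]

end LaplaceTerm

/-! ### Inversion of the Laplace transform -/

theorem abs_neg_one_mul_rpow {s : ℝ} (hs : 0 < s) :
    |(-1 : ℝ)| * s ^ ((-1 : ℝ) - 1) = (s ^ 2)⁻¹ := by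
  rw [abs_neg, abs_one, one_mul, show (-1 : ℝ) - 1 = -(2 : ℕ) by norm_num,
    Real.rpow_neg hs.le, Real.rpow_natCast]

theorem integral_comp_inv_Ioi (g : ℝ → ℂ) :
    ∫ s in Ioi (0 : ℝ), (s ^ 2)⁻¹ • g s⁻¹ = ∫ t in Ioi (0 : ℝ), g t := by
  rw [← integral_comp_rpow_Ioi g (p := -1) (by norm_num)]
  refine setIntegral_congr_fun measurableSet_Ioi fun s hs => ?_
  simp only [abs_neg_one_mul_rpow hs, Real.rpow_neg_one]

theorem integrableOn_Ioi_comp_inv_iff (g : ℝ → ℂ) :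
    IntegrableOn (fun s : ℝ => (s ^ 2)⁻¹ • g s⁻¹) (Ioi 0) ↔ IntegrableOn g (Ioi 0) := by
  rw [← integrableOn_Ioi_comp_rpow_iff g (p := -1) (by norm_num)]
  refine integrableOn_congr_fun (fun s hs => ?_) measurableSet_Ioi
  simp only [abs_neg_one_mul_rpow hs, Real.rpow_neg_one]

open scoped FourierTransform in
/-- Inversion of the transform `λ ↦ ∫₀^∞ q(t) e^{-λ/t} dt` on a vertical line. -/
theorem eq_integral_of_laplace_inv {q : ℝ → ℂ} (hc : ContinuousOn q (Ioi 0)) {γ : ℝ}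
    (hi : IntegrableOn (fun t : ℝ => q t * Complex.exp (-γ / t)) (Ioi 0)) {L : ℝ → ℂ}
    (hL : ∀ τ : ℝ, ∫ t in Ioi (0 : ℝ), q t * Complex.exp (-(γ + τ * Complex.I) / t) = L τ)
    (hLi : Integrable L) {t : ℝ} (ht : 0 < t) :
    q t = 1 / (2 * Real.pi * t ^ 2) * ∫ τ : ℝ, Complex.exp ((γ + τ * Complex.I) / t) * L τ := by
  set g : ℝ → ℂ := fun t => q t * Complex.exp (-γ / t) with hg
  -- In the variable s = 1/t, the transform along λ = γ + iτ is the Fourier transform of f at ξ =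
  -- τ/(2π).
  set f : ℝ → ℂ := (Ioi (0 : ℝ)).indicator fun s => (s ^ 2)⁻¹ • g s⁻¹ with hf
  have hfi : Integrable f :=
    ((integrableOn_Ioi_comp_inv_iff g).2 hi).integrable_indicator measurableSet_Ioi
  have hFf : 𝓕 f = fun ξ => L (2 * Real.pi * ξ) := by
    funext ξ
    rw [Real.fourier_eq', ← hL, ← integral_comp_inv_Ioi,
      ← integral_indicator (f := fun s : ℝ => _) measurableSet_Ioi]
    refine integral_congr_ae (ae_of_all _ fun s => ?_)
    simp only [hf, indicator]
    split_ifs with h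
    · have hs : (s : ℂ) ≠ 0 := by exact_mod_cast (ne_of_gt h)
      simp only [hg, Complex.real_smul, smul_eq_mul]
      have e : Complex.exp (-((γ : ℂ) + ((2 * Real.pi * ξ : ℝ) : ℂ) * Complex.I) / (s⁻¹ : ℝ)) =
          Complex.exp (((-2 * Real.pi * inner ℝ s ξ : ℝ) : ℂ) * Complex.I) *
            Complex.exp (-γ / (s⁻¹ : ℝ)) := by
        rw [← Complex.exp_add]
        congr 1
        simp only [RCLike.inner_apply, conj_trivial]
        push_cast
        field_simp
        ring
      rw [e]
      ring
    · simp
  have hFi : Integrable (𝓕 f) := by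
    rw [hFf]
    exact hLi.comp_mul_left' (by positivity)
  have ht' : 0 < t⁻¹ := inv_pos.2 ht
  have hcont : ContinuousAt f t⁻¹ := by
    have h1 : ContinuousAt (fun s : ℝ => (s ^ 2)⁻¹ • g s⁻¹) t⁻¹ := by
      have h2 : ContinuousAt q t := hc.continuousAt (Ioi_mem_nhds ht)
      have h3 : ContinuousAt g t := by
        refine h2.mul ?_
        have : (t : ℂ) ≠ 0 := by exact_mod_cast ht.ne'
        fun_prop (disch := assumption)
      have h4 : ContinuousAt (fun s : ℝ => s⁻¹) t⁻¹ := continuousAt_inv₀ ht'.ne'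
      have h5 : ContinuousAt (fun s : ℝ => g s⁻¹) t⁻¹ :=
        ContinuousAt.comp (g := g) (by rwa [inv_inv]) h4
      have h6 : ContinuousAt (fun s : ℝ => (s ^ 2)⁻¹) t⁻¹ :=
        (continuousAt_id.pow 2).inv₀ (by simpa using ht.ne')
      exact h6.smul h5
    refine h1.congr ?_
    filter_upwards [Ioi_mem_nhds ht'] with s hs
    rw [hf, indicator_of_mem hs]
  -- Pointwise inversion needs only that f and its transform are integrable and that f is continuous
  -- at s = 1/t; the jump allowed at s = 0 is irrelevant.
  have hinv := hfi.fourierInv_fourier_eq hFi hcont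
  rw [hFf, Real.fourierInv_eq'] at hinv
  have hcv : ∫ ξ : ℝ, Complex.exp (((2 * Real.pi * inner ℝ ξ t⁻¹ : ℝ) : ℂ) * Complex.I) •
      L (2 * Real.pi * ξ) =
      (2 * Real.pi : ℂ)⁻¹ * ∫ τ : ℝ, Complex.exp ((τ * Complex.I) / t) * L τ := by
    have h := Measure.integral_comp_mul_left
      (fun τ : ℝ => Complex.exp ((τ * Complex.I) / t) * L τ) (2 * Real.pi)
    rw [abs_of_pos (by positivity), Complex.real_smul] at h
    push_cast at h
    rw [← h]
    refine integral_congr_ae (ae_of_all _ fun ξ => ?_)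
    simp only [RCLike.inner_apply, conj_trivial, smul_eq_mul]
    push_cast
    congr 2
    field_simp
  rw [hcv, hf, indicator_of_mem (show t⁻¹ ∈ Ioi (0 : ℝ) from ht'), inv_inv, hg] at hinv
  simp only [Complex.real_smul] at hinv
  have e1 : ∀ τ : ℝ, Complex.exp ((γ + τ * Complex.I) / t) * L τ =
      Complex.exp (γ / t) * (Complex.exp ((τ * Complex.I) / t) * L τ) := by
    intro τ
    rw [add_div, Complex.exp_add, mul_assoc]
  simp_rw [e1]
  rw [integral_const_mul]
  have e2 : Complex.exp (γ / t) * Complex.exp (-γ / t) = 1 := by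
    rw [← Complex.exp_add, neg_div, add_neg_cancel, Complex.exp_zero]
  have e3 : (t : ℂ) ≠ 0 := by exact_mod_cast ht.ne'
  have e4 : (Real.pi : ℂ) ≠ 0 := by exact_mod_cast Real.pi_ne_zero
  have hinv' : (2 * Real.pi : ℂ)⁻¹ * ∫ τ : ℝ, Complex.exp ((τ * Complex.I) / t) * L τ =
      t ^ 2 * (q t * Complex.exp (-γ / t)) := by
    rw [hinv]
    push_cast
    field_simp
  generalize (∫ τ : ℝ, Complex.exp ((τ * Complex.I) / t) * L τ) = J at hinv' ⊢
  have hJ : J = 2 * Real.pi * (t ^ 2 * (q t * Complex.exp (-γ / t))) := by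
    rw [← hinv']
    field_simp
  rw [hJ]
  calc q t = q t * (Complex.exp (γ / t) * Complex.exp (-γ / t)) := by rw [e2, mul_one]
    _ = _ := by
      generalize Complex.exp (γ / t) = E
      generalize Complex.exp (-γ / t) = E'
      field_simp

/-- The contour integral formula for the heat series. -/
theorem heatSeries_eq_integral {a : ℂ} (ha : ‖a‖ ≤ 1)
    (hc : ContinuousOn (fun t => heatSeries t a) (Ioi 0)) {γ : ℝ} (hγ : 0 < γ) {t : ℝ}
    (ht : 0 < t) :
    Integrable (fun τ : ℝ => ∫ y : ℝ,
      Complex.exp ((γ + τ * Complex.I) / t) / resolventDenom a (γ + τ * Complex.I) y) ∧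
    heatSeries t a = Complex.exp t / (8 * Real.pi * t ^ 2) * ∫ τ : ℝ, ∫ y : ℝ,
      Complex.exp ((γ + τ * Complex.I) / t) / resolventDenom a (γ + τ * Complex.I) y := by
  have hre : ∀ τ : ℝ, 0 < ((γ : ℂ) + τ * Complex.I).re := fun τ => by simpa using hγ
  have hL := integrable_integral_inv_resolventDenom ha hγ
  have h0 : ∀ τ : ℝ, ∫ y : ℝ,
      Complex.exp ((γ + τ * Complex.I) / t) / resolventDenom a (γ + τ * Complex.I) y =
      Complex.exp ((γ + τ * Complex.I) / t) *
        ∫ y, (resolventDenom a (γ + τ * Complex.I) y)⁻¹ := by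
    intro τ
    simp_rw [div_eq_mul_inv]
    rw [integral_const_mul]
  simp_rw [h0]
  have e1 : ∀ (lam : ℂ) (s : ℝ), heatSeries s a * Complex.exp (-s - lam / s) =
      heatSeries s a * Complex.exp (-s) * Complex.exp (-lam / s) := by
    intro lam s
    rw [mul_assoc, ← Complex.exp_add, neg_div, sub_eq_add_neg]
  refine ⟨?_, ?_⟩
  · refine hL.bdd_mul (c := Real.exp (γ / t)) (Continuous.aestronglyMeasurable (by fun_prop))
      (ae_of_all _ fun τ => ?_)
    rw [Complex.norm_exp, Complex.div_ofReal_re]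
    simp
  · have h1 := (integrableOn_heatSeries_mul_exp (lam := (γ : ℂ)) ha (by simpa using hγ)).1
    have h2 : ∀ τ : ℝ, ∫ s in Ioi (0 : ℝ), heatSeries s a * Complex.exp (-s) *
        Complex.exp (-(γ + τ * Complex.I) / s) =
        1 / 4 * ∫ y, (resolventDenom a (γ + τ * Complex.I) y)⁻¹ := by
      intro τ
      rw [← (integrableOn_heatSeries_mul_exp (lam := γ + τ * Complex.I) ha (hre τ)).2]
      simp_rw [e1]
    simp_rw [e1] at h1
    have h3 := eq_integral_of_laplace_inv
      (q := fun t => heatSeries t a * Complex.exp (-t))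
      (hc.mul (Continuous.continuousOn (by fun_prop))) h1 h2 (hL.const_mul _) ht
    have e2 : Complex.exp t * Complex.exp (-t) = 1 := by
      rw [← Complex.exp_add, add_neg_cancel, Complex.exp_zero]
    calc heatSeries t a = Complex.exp t * (heatSeries t a * Complex.exp (-t)) := by
          linear_combination (-heatSeries t a) * e2
      _ = _ := by
          rw [h3]
          simp_rw [mul_left_comm (Complex.exp _) (1 / 4 : ℂ)]
          rw [integral_const_mul]
          ring

/-! ### The Green function -/

theorem halfTrace_re (a : ℂ) (y : ℝ) : (halfTrace a y).re = a.re * Real.cosh y := by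
  have h1 : Complex.exp (-y) = (Real.exp (-y) : ℝ) := by push_cast; rfl
  have h2 : Complex.exp y = (Real.exp y : ℝ) := by push_cast; rfl
  rw [halfTrace, h1, h2, Complex.div_ofNat_re, Complex.add_re, Complex.re_mul_ofReal,
    Complex.re_mul_ofReal, Complex.conj_re, Real.cosh_eq]
  ring

theorem halfTrace_im (a : ℂ) (y : ℝ) : (halfTrace a y).im = -(a.im * Real.sinh y) := by
  have h1 : Complex.exp (-y) = (Real.exp (-y) : ℝ) := by push_cast; rfl
  have h2 : Complex.exp y = (Real.exp y : ℝ) := by push_cast; rfl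
  rw [halfTrace, h1, h2, Complex.div_ofNat_im, Complex.add_im, Complex.im_mul_ofReal,
    Complex.im_mul_ofReal, Complex.conj_im, Real.sinh_eq]
  ring

section GreenIntegral

variable {a : ℂ}

theorem Complex.re_lt_one_of_norm_le_one (ha : ‖a‖ ≤ 1) (ha1 : a ≠ 1) : a.re < 1 := by
  refine lt_of_le_of_ne ((Complex.re_le_norm a).trans ha) fun h => ha1 ?_
  have h1 := Complex.normSq_eq_norm_sq a
  rw [Complex.normSq_apply, h] at h1
  have h2 : a.im = 0 := by nlinarith [norm_nonneg a, sq_nonneg a.im]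
  exact Complex.ext h h2

theorem one_add_sq_le_cosh (y : ℝ) : (1 + y ^ 2) / 40320 ≤ Real.cosh y := by
  have h := le_cosh_sub_cosh (x := y) (y := 0) (by simpa using sq_nonneg y)
  rw [Real.cosh_zero] at h
  nlinarith [sq_nonneg y, mul_nonneg (sq_nonneg y) (by positivity : 0 ≤ y ^ 6)]

/-- This is the limiting integrand at λ = 0, where cosh |y| = cosh y. Real parts suffice because the
kernel is real. Using cosh² = 1 + sinh² leaves a function of sinh y times its derivative. -/
theorem re_inv_cosh_sub_halfTrace (a : ℂ) (y : ℝ) :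
    ((Complex.cosh y - halfTrace a y)⁻¹).re = (1 - a.re) * Real.cosh y /
      ((1 - a.re) ^ 2 + ‖1 - a‖ ^ 2 * Real.sinh y ^ 2) := by
  have h1 : Complex.cosh y = (Real.cosh y : ℝ) := by push_cast; rfl
  have hre : (Complex.cosh y - halfTrace a y).re = (1 - a.re) * Real.cosh y := by
    rw [Complex.sub_re, h1, Complex.ofReal_re, halfTrace_re]
    ring
  have him : (Complex.cosh y - halfTrace a y).im = a.im * Real.sinh y := by
    rw [Complex.sub_im, h1, Complex.ofReal_im, halfTrace_im]
    ring
  rw [Complex.inv_re, Complex.normSq_apply, hre, him, ← Complex.normSq_eq_norm_sq,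
    Complex.normSq_apply]
  congr 1
  simp only [Complex.sub_re, Complex.sub_im, Complex.one_re, Complex.one_im]
  linear_combination (1 - a.re) ^ 2 * Real.cosh_sq y

/-- A primitive is arctan((R/A) sinh y)/R with A = 1 - Re a and R = |1 - a|; its total variation is
π/R. -/
theorem integral_re_inv_cosh_sub_halfTrace (ha : ‖a‖ ≤ 1) (ha1 : a ≠ 1) :
    ∫ y : ℝ, ((Complex.cosh y - halfTrace a y)⁻¹).re = Real.pi / ‖1 - a‖ := by
  have hA : 0 < 1 - a.re := sub_pos.2 (Complex.re_lt_one_of_norm_le_one ha ha1)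
  have hR : 0 < ‖1 - a‖ := norm_pos_iff.2 (sub_ne_zero.2 (Ne.symm ha1))
  simp only [re_inv_cosh_sub_halfTrace]
  set A := 1 - a.re
  set R := ‖1 - a‖
  have hd : ∀ y : ℝ, HasDerivAt (fun y => Real.arctan (R / A * Real.sinh y) / R)
      (A * Real.cosh y / (A ^ 2 + R ^ 2 * Real.sinh y ^ 2)) y := by
    intro y
    refine HasDerivAt.congr_deriv
      ((((Real.hasDerivAt_sinh y).const_mul (R / A)).arctan).div_const R) ?_
    field_simp
  have hi : Integrable fun y : ℝ => A * Real.cosh y / (A ^ 2 + R ^ 2 * Real.sinh y ^ 2) := by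
    have hc : Continuous fun y : ℝ => A * Real.cosh y / (A ^ 2 + R ^ 2 * Real.sinh y ^ 2) := by
      refine Continuous.div (by fun_prop) (by fun_prop) fun y => ?_
      positivity
    have hAR : A ≤ R := by
      have := Complex.re_le_norm (1 - a)
      rwa [Complex.sub_re, Complex.one_re] at this
    refine (integrable_inv_one_add_sq.const_mul (40320 / A)).mono' hc.aestronglyMeasurable
      (ae_of_all _ fun y => ?_)
    have hc0 := Real.cosh_pos y
    have h2 : A ^ 2 * Real.cosh y ^ 2 ≤ A ^ 2 + R ^ 2 * Real.sinh y ^ 2 := by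
      rw [Real.cosh_sq]
      have : A ^ 2 * Real.sinh y ^ 2 ≤ R ^ 2 * Real.sinh y ^ 2 := by gcongr
      linarith
    rw [Real.norm_of_nonneg (by positivity)]
    calc A * Real.cosh y / (A ^ 2 + R ^ 2 * Real.sinh y ^ 2)
        ≤ A * Real.cosh y / (A ^ 2 * Real.cosh y ^ 2) := by gcongr
      _ = 1 / A * (Real.cosh y)⁻¹ := by field_simp
      _ ≤ 1 / A * ((1 + y ^ 2) / 40320)⁻¹ := by
          gcongr
          exact one_add_sq_le_cosh y
      _ = _ := by field_simp
  have hsinh_top : Tendsto Real.sinh atTop atTop :=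
    Real.sinhOrderIso.tendsto_atTop
  have hsinh_bot : Tendsto Real.sinh atBot atBot :=
    Real.sinhOrderIso.tendsto_atBot
  have htop : Tendsto (fun y => Real.arctan (R / A * Real.sinh y) / R) atTop
      (𝓝 (Real.pi / 2 / R)) :=
    ((tendsto_nhds_of_tendsto_nhdsWithin Real.tendsto_arctan_atTop).comp
      (hsinh_top.const_mul_atTop (by positivity))).div_const R
  have hbot : Tendsto (fun y => Real.arctan (R / A * Real.sinh y) / R) atBot
      (𝓝 (-(Real.pi / 2) / R)) :=
    ((tendsto_nhds_of_tendsto_nhdsWithin Real.tendsto_arctan_atBot).comp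
      (hsinh_bot.const_mul_atBot (by positivity))).div_const R
  rw [integral_of_hasDerivAt_of_tendsto hd hi hbot htop]
  ring

theorem resolventDenom_ofReal {s : ℝ} (hs : 0 ≤ s) (y : ℝ) :
    resolventDenom a s y = (Real.cosh √(y ^ 2 + 4 * s) : ℝ) - halfTrace a y := by
  have h : ((y : ℂ) ^ 2 + 4 * (s : ℂ)) = ((y ^ 2 + 4 * s : ℝ) : ℂ) := by push_cast; rfl
  rw [resolventDenom, h, Complex.sqrt_of_nonneg (by
    rw [Complex.zero_le_real]; positivity), Complex.ofReal_re]
  push_cast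
  rfl

/-- For real λ = s ≥ 0 the real part of the denominator is at least (1 - Re a) cosh y. Unlike the
general bound, this is uniform as s → 0, provided a ≠ 1. -/
theorem norm_inv_resolventDenom_ofReal_le (ha : ‖a‖ ≤ 1) (ha1 : a ≠ 1) {s : ℝ} (hs : 0 ≤ s)
    (y : ℝ) : ‖(resolventDenom a s y)⁻¹‖ ≤ 40320 / (1 - a.re) * (1 + y ^ 2)⁻¹ := by
  have hA : 0 < 1 - a.re := sub_pos.2 (Complex.re_lt_one_of_norm_le_one ha ha1)
  have h1 : Real.cosh y ≤ Real.cosh √(y ^ 2 + 4 * s) := by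
    refine Real.cosh_le_cosh.2 ?_
    rw [abs_of_nonneg (Real.sqrt_nonneg _)]
    exact Real.le_sqrt_of_sq_le (by rw [sq_abs]; linarith)
  have h2 : (1 - a.re) * ((1 + y ^ 2) / 40320) ≤ ‖resolventDenom a s y‖ := by
    refine le_trans ?_ (Complex.re_le_norm _)
    rw [resolventDenom_ofReal hs, Complex.sub_re, Complex.ofReal_re, halfTrace_re]
    have := mul_le_mul_of_nonneg_left (one_add_sq_le_cosh y) hA.le
    linarith
  rw [norm_inv]
  calc ‖resolventDenom a s y‖⁻¹ ≤ ((1 - a.re) * ((1 + y ^ 2) / 40320))⁻¹ :=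
        inv_anti₀ (by positivity) h2
    _ = _ := by field_simp

theorem integral_re_inv_resolventDenom_le (ha : ‖a‖ ≤ 1) (ha1 : a ≠ 1) {s : ℝ} (hs : 0 ≤ s) :
    ∫ y, ((resolventDenom a s y)⁻¹).re ≤ 40320 / (1 - a.re) * Real.pi := by
  rw [← integral_univ_inv_one_add_sq, ← integral_const_mul]
  refine (le_abs_self _).trans ?_
  rw [← Real.norm_eq_abs]
  refine norm_integral_le_of_norm_le
    (integrable_inv_one_add_sq.const_mul _) (ae_of_all _ fun y => ?_)
  exact (Complex.abs_re_le_norm _).trans (norm_inv_resolventDenom_ofReal_le ha ha1 hs y)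

theorem tendsto_integral_re_inv_resolventDenom (ha : ‖a‖ ≤ 1) (ha1 : a ≠ 1) {s : ℕ → ℝ}
    (hs : ∀ n, 0 < s n) (hlim : Tendsto s atTop (𝓝 0)) :
    Tendsto (fun n => ∫ y, ((resolventDenom a (s n) y)⁻¹).re) atTop (𝓝 (Real.pi / ‖1 - a‖)) := by
  rw [← integral_re_inv_cosh_sub_halfTrace ha ha1]
  refine tendsto_integral_of_dominated_convergence
    (fun y => 40320 / (1 - a.re) * (1 + y ^ 2)⁻¹) (fun n => ?_)
    (integrable_inv_one_add_sq.const_mul _)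
    (fun n => ae_of_all _ fun y => (Complex.abs_re_le_norm _).trans
      (norm_inv_resolventDenom_ofReal_le ha ha1 (hs n).le y)) (ae_of_all _ fun y => ?_)
  · have hn : 0 < ((s n : ℝ) : ℂ).re := by simpa using hs n
    exact (Complex.continuous_re.comp ((continuous_resolventDenom a hn).inv₀
      fun y => resolventDenom_ne_zero ha hn y)).aestronglyMeasurable
  · have h1 : Tendsto (fun n => resolventDenom a (s n) y) atTop
        (𝓝 (Complex.cosh y - halfTrace a y)) := by
      simp_rw [fun n => resolventDenom_ofReal (a := a) (hs n).le y]
      have h2 : Continuous fun x : ℝ =>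
          ((Real.cosh √(y ^ 2 + 4 * x) : ℝ) : ℂ) - halfTrace a y := by fun_prop
      have h3 := (h2.tendsto 0).comp hlim
      rw [mul_zero, add_zero, Real.sqrt_sq_eq_abs, Real.cosh_abs, Complex.ofReal_cosh] at h3
      exact h3
    have hne : Complex.cosh y - halfTrace a y ≠ 0 := by
      intro h0
      have hA : 0 < 1 - a.re := sub_pos.2 (Complex.re_lt_one_of_norm_le_one ha ha1)
      have h2 := congrArg Complex.re h0
      rw [Complex.sub_re, ← Complex.ofReal_cosh, Complex.ofReal_re, halfTrace_re,
        Complex.zero_re] at h2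
      have := Real.cosh_pos y
      nlinarith
    exact (Complex.continuous_re.tendsto _).comp (h1.inv₀ hne)

end GreenIntegral

/-! ### Laplace transform and time integral of the heat kernel. -/

namespace IsSubellipticHeatKernel

open SU2

variable {ν : Measure SU2} {p : ℝ → SU2 → ℝ}

theorem continuousOn_time (hp : IsSubellipticHeatKernel ν p) (g : SU2) :
    ContinuousOn (fun t => p t g) (Ioi 0) :=
  hp.continuousOn.comp (f := fun t : ℝ => (t, g)) (by fun_prop) fun t ht => ⟨ht, mem_univ _⟩

variable [ν.IsHaarMeasure]

theorem heatSeries_eq (hp : IsSubellipticHeatKernel ν p) {t : ℝ} (ht : 0 < t) (g : SU2) :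
    heatSeries t (fst g) = ν.real univ * p t g := by
  have hV0 : (ν.real univ : ℂ) ≠ 0 := Complex.ofReal_ne_zero.2 (measureReal_univ_pos ν).ne'
  rw [hp.eq_heatSeries ht g, mul_div_cancel₀ _ hV0]

/-- The Laplace transform of the heat kernel. -/
theorem integrableOn_mul_exp (hp : IsSubellipticHeatKernel ν p) {lam : ℂ} (h : 0 < lam.re)
    (g : SU2) :
    IntegrableOn (fun t : ℝ => (p t g : ℂ) * Complex.exp (-t - lam / t)) (Ioi 0) ∧
    ∫ t in Ioi (0 : ℝ), (p t g : ℂ) * Complex.exp (-t - lam / t) =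
      1 / (4 * ν.real univ) * ∫ y, (resolventDenom (fst g) lam y)⁻¹ := by
  have h1 := integrableOn_heatSeries_mul_exp (norm_fst_le g) h
  have h2 : EqOn (fun t : ℝ => (ν.real univ : ℂ)⁻¹ *
      (heatSeries t (fst g) * Complex.exp (-t - lam / t)))
      (fun t : ℝ => (p t g : ℂ) * Complex.exp (-t - lam / t)) (Ioi 0) := fun t ht => by
    simp only [hp.eq_heatSeries ht g]
    ring
  refine ⟨(IntegrableOn.congr_fun (h1.1.const_mul _) h2 measurableSet_Ioi), ?_⟩
  rw [← setIntegral_congr_fun measurableSet_Ioi h2, integral_const_mul, h1.2]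
  ring

theorem integrableOn_mul_exp_real (hp : IsSubellipticHeatKernel ν p) {s : ℝ} (h : 0 < s)
    (g : SU2) :
    IntegrableOn (fun t : ℝ => p t g * Real.exp (-t - s / t)) (Ioi 0) ∧
    ∫ t in Ioi (0 : ℝ), p t g * Real.exp (-t - s / t) =
      1 / (4 * ν.real univ) * ∫ y, ((resolventDenom (fst g) s y)⁻¹).re := by
  have hs : 0 < (s : ℂ).re := by simpa using h
  obtain ⟨h1, h2⟩ := hp.integrableOn_mul_exp hs g
  have h3 : ∀ t : ℝ, (p t g : ℂ) * Complex.exp (-t - s / t) =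
      ((p t g * Real.exp (-t - s / t) : ℝ) : ℂ) := fun t => by push_cast; rfl
  simp_rw [h3] at h1 h2
  refine ⟨h1.re, ?_⟩
  rw [integral_complex_ofReal] at h2
  have h4 := congrArg Complex.re h2
  rw [Complex.ofReal_re, show (1 / (4 * (ν.real univ : ℂ))) = ((1 / (4 * ν.real univ) : ℝ) : ℂ) by
    push_cast; rfl, Complex.re_ofReal_mul] at h4
  rw [h4]
  congr 1
  exact (integral_re (integrable_inv_resolventDenom (norm_fst_le g) hs)).symm

/-- The time integral of the heat kernel off the pole. -/
theorem integrableOn_exp_mul (hp : IsSubellipticHeatKernel ν p) {g : SU2} (hg : g ≠ 1) :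
    IntegrableOn (fun t : ℝ => Real.exp (-t) * p t g) (Ioi 0) ∧
    ∫ t in Ioi (0 : ℝ), Real.exp (-t) * p t g =
      Real.pi / (4 * ν.real univ * ‖1 - fst g‖) := by
  have ha := norm_fst_le g
  have ha1 : fst g ≠ 1 := fun h => hg ((fst_eq_one_iff g).1 h)
  have hV := measureReal_univ_pos ν
  set s : ℕ → ℝ := fun n => 1 / ((n : ℝ) + 1) with hs
  have hs0 : ∀ n, 0 < s n := fun n => by positivity
  have hslim : Tendsto s atTop (𝓝 0) := tendsto_one_div_add_atTop_nhds_zero_nat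
  set F : ℕ → ℝ → ℝ := fun n t => p t g * Real.exp (-t - s n / t) with hF
  have hFi : ∀ n, IntegrableOn (F n) (Ioi 0) := fun n => (hp.integrableOn_mul_exp_real (hs0 n) g).1
  have hFint : ∀ n, ∫ t in Ioi (0 : ℝ), F n t =
      1 / (4 * ν.real univ) * ∫ y, ((resolventDenom (fst g) (s n) y)⁻¹).re :=
    fun n => (hp.integrableOn_mul_exp_real (hs0 n) g).2
  have hFnn : ∀ n, 0 ≤ᵐ[volume.restrict (Ioi 0)] F n := fun n =>
    (ae_restrict_iff' measurableSet_Ioi).2 (ae_of_all _ fun t ht =>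
      mul_nonneg (hp.nonneg ht g) (Real.exp_nonneg _))
  have hlim : ∀ t : ℝ, Tendsto (fun n => F n t) atTop (𝓝 (Real.exp (-t) * p t g)) := by
    intro t
    have h1 : Continuous fun x : ℝ => p t g * Real.exp (-t - x / t) := by fun_prop
    have h2 := (h1.tendsto 0).comp hslim
    rw [zero_div, sub_zero, mul_comm] at h2
    exact h2
  have hint : IntegrableOn (fun t : ℝ => Real.exp (-t) * p t g) (Ioi 0) := by
    -- Fatou's lemma: nonnegativity turns the bounded integrals of F n into bounded norms. Once
    -- integrability is known, the limit function itself dominates the sequence.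
    refine integrable_of_tendsto (ae_of_all _ hlim) (fun n => (hFi n).aestronglyMeasurable) ?_
    refine ne_top_of_le_ne_top (b := ENNReal.ofReal
      (1 / (4 * ν.real univ) * (40320 / (1 - (fst g).re) * Real.pi))) ENNReal.ofReal_ne_top ?_
    refine liminf_le_of_le (by isBoundedDefault) fun b hb => ?_
    obtain ⟨n, hn⟩ := hb.exists
    refine hn.trans ?_
    rw [← ofReal_integral_norm_eq_lintegral_enorm (hFi n)]
    refine ENNReal.ofReal_le_ofReal ?_
    rw [integral_congr_ae ((hFnn n).mono fun t ht => Real.norm_of_nonneg ht), hFint]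
    gcongr
    exact integral_re_inv_resolventDenom_le ha ha1 (hs0 n).le
  refine ⟨hint, ?_⟩
  have hdom : Tendsto (fun n => ∫ t in Ioi (0 : ℝ), F n t) atTop
      (𝓝 (∫ t in Ioi (0 : ℝ), Real.exp (-t) * p t g)) := by
    refine tendsto_integral_of_dominated_convergence _ (fun n => (hFi n).aestronglyMeasurable)
      hint (fun n => (ae_restrict_iff' measurableSet_Ioi).2 (ae_of_all _ fun t ht => ?_))
      (ae_of_all _ hlim)
    have ht0 : 0 < t := ht
    rw [Real.norm_of_nonneg (mul_nonneg (hp.nonneg ht g) (Real.exp_nonneg _)), mul_comm]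
    refine mul_le_mul_of_nonneg_right (Real.exp_le_exp.2 ?_) (hp.nonneg ht g)
    have := div_nonneg (hs0 n).le ht0.le
    linarith
  simp_rw [hFint] at hdom
  have h := tendsto_nhds_unique hdom
    ((tendsto_integral_re_inv_resolventDenom ha ha1 hs0 hslim).const_mul _)
  rw [h]
  have : ‖1 - fst g‖ ≠ 0 := norm_ne_zero_iff.2 (sub_ne_zero.2 (Ne.symm ha1))
  field_simp

end IsSubellipticHeatKernel

/-! ### The time integral of the heat kernel as a Green function. -/

namespace IsSubellipticHeatKernel

open SU2

variable {ν : Measure SU2} [ν.IsHaarMeasure] {p : ℝ → SU2 → ℝ}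

/-- Since p_t is nonnegative with mass 1, the norm integrates over the group to e^{-t}. -/
theorem integrable_exp_mul_prod (hp : IsSubellipticHeatKernel ν p) :
    Integrable (fun x : ℝ × SU2 => Real.exp (-x.1) * p x.1 x.2)
      ((volume.restrict (Ioi 0)).prod ν) := by
  have hm : AEStronglyMeasurable (fun x : ℝ × SU2 => Real.exp (-x.1) * p x.1 x.2)
      ((volume.restrict (Ioi 0)).prod ν) := by
    have h1 : (volume.restrict (Ioi (0 : ℝ))).prod ν =
        ((volume : Measure ℝ).prod ν).restrict (Ioi 0 ×ˢ univ) := by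
      rw [← Measure.prod_restrict, Measure.restrict_univ]
    rw [h1]
    refine ContinuousOn.aestronglyMeasurable ?_ (measurableSet_Ioi.prod MeasurableSet.univ)
    exact ContinuousOn.mul (f := fun x : ℝ × SU2 => Real.exp (-x.1))
      (Continuous.continuousOn (by fun_prop)) hp.continuousOn
  refine (integrable_prod_iff hm).2 ⟨?_, ?_⟩
  · refine (ae_restrict_iff' measurableSet_Ioi).2 (ae_of_all _ fun t ht => ?_)
    exact (integrable_of_continuous ν (hp.smooth_at ht).continuous).const_mul (Real.exp (-t))
  · refine IntegrableOn.congr_fun (f := fun t : ℝ => Real.exp (-t)) (integrableOn_exp_neg_Ioi 0)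
      (fun t ht => ?_) measurableSet_Ioi
    have h1 : ∀ g, ‖Real.exp (-t) * p t g‖ = Real.exp (-t) * p t g := fun g =>
      Real.norm_of_nonneg (mul_nonneg (Real.exp_nonneg _) (hp.nonneg ht g))
    simp only [h1]
    rw [integral_const_mul, hp.integral_eq_one ht, mul_one]

theorem abs_integral_mul_le (hp : IsSubellipticHeatKernel ν p) {f : SU2 → ℝ} {C : ℝ}
    (hC : ∀ g, ‖f g‖ ≤ C) {t : ℝ} (ht : 0 < t) : ‖∫ g, p t g * f g ∂ν‖ ≤ C := by
  have hi : Integrable (p t) ν := integrable_of_continuous ν (hp.smooth_at ht).continuous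
  refine (norm_integral_le_of_norm_le (hi.mul_const C) (ae_of_all _ fun g => ?_)).trans_eq ?_
  · rw [norm_mul, Real.norm_of_nonneg (hp.nonneg ht g)]
    exact mul_le_mul_of_nonneg_left (hC g) (hp.nonneg ht g)
  · rw [integral_mul_const, hp.integral_eq_one ht, one_mul]

/-- The resolvent of the heat semigroup, at the pole of the heat kernel. -/
theorem isGreenFunction (hp : IsSubellipticHeatKernel ν p) :
    IsGreenFunction ν (fun g => ∫ t in Ioi (0 : ℝ), Real.exp (-t) * p t g) := by
  have hP := hp.integrable_exp_mul_prod
  refine ⟨?_, hP.integral_prod_right, fun f hf => ?_⟩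
  -- Continuity off the pole is read from the closed form of the time integral.
  · have h1 : ContinuousOn (fun g : SU2 => Real.pi / (4 * ν.real univ * ‖1 - fst g‖)) {1}ᶜ := by
      refine ContinuousOn.div continuousOn_const ?_ fun g hg => ?_
      · have := SU2.continuous_fst
        exact Continuous.continuousOn (by fun_prop)
      · have hg' : fst g ≠ 1 := fun h => hg ((fst_eq_one_iff g).1 h)
        exact mul_ne_zero (mul_ne_zero (by norm_num) (measureReal_univ_pos ν).ne')
          (norm_ne_zero_iff.2 (sub_ne_zero.2 (Ne.symm hg')))
    exact h1.congr fun g hg => (hp.integrableOn_exp_mul hg).2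
  · set h : SU2 → ℝ := fun g => -subLaplacian f g + f g with hh
    have hhc : Continuous h := hf.subLaplacian.continuous.neg.add hf.continuous
    obtain ⟨C, hC⟩ := hf.bounded
    obtain ⟨C', hC'⟩ := hf.subLaplacian.bounded
    have hPh : Integrable (fun x : ℝ × SU2 => Real.exp (-x.1) * p x.1 x.2 * h x.2)
        ((volume.restrict (Ioi 0)).prod ν) := by
      refine hP.mul_bdd (c := C' + C)
        (hhc.comp _root_.continuous_snd).aestronglyMeasurable (ae_of_all _ fun x => ?_)
      refine (norm_add_le _ _).trans ?_
      rw [norm_neg]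
      exact add_le_add (hC' _) (hC _)
    have h1 : ∀ g, (∫ t in Ioi (0 : ℝ), Real.exp (-t) * p t g) * h g =
        ∫ t in Ioi (0 : ℝ), Real.exp (-t) * p t g * h g := fun g => (integral_mul_const _ _).symm
    change ∫ g, (∫ t in Ioi (0 : ℝ), Real.exp (-t) * p t g) * h g ∂ν = f 1
    simp_rw [h1]
    rw [← integral_integral_swap hPh]
    set u : ℝ → ℝ := fun t => ∫ g, p t g * f g ∂ν with hu
    -- After exchanging the integrals the integrand in t is an exact derivative, whose primitive
    -- runs from -f(1) at 0⁺ to 0 at infinity.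
    have hd : ∀ t ∈ Ioi (0 : ℝ), HasDerivAt (fun t => -(Real.exp (-t) * u t))
        (∫ g, Real.exp (-t) * p t g * h g ∂ν) t := by
      intro t ht
      have e : HasDerivAt (fun t : ℝ => Real.exp (-t)) (-Real.exp (-t)) t := by
        simpa using (hasDerivAt_neg t).exp
      refine HasDerivAt.congr_deriv (e.fun_mul (hp.hasDerivAt_integral' hf ht)).fun_neg ?_
      have hpc := (hp.smooth_at ht).continuous
      have i1 : Integrable (fun g => p t g * subLaplacian f g) ν :=
        integrable_of_continuous ν (hpc.mul hf.subLaplacian.continuous)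
      have i2 : Integrable (fun g => p t g * f g) ν :=
        integrable_of_continuous ν (hpc.mul hf.continuous)
      have h2 : ∀ g, Real.exp (-t) * p t g * h g =
          Real.exp (-t) * (p t g * f g - p t g * subLaplacian f g) := fun g => by
        simp only [hh]
        ring
      simp_rw [h2]
      rw [integral_const_mul, integral_sub i2 i1]
      ring
    rw [integral_Ioi_zero_of_hasDerivAt_of_tendsto hd hPh.integral_prod_left (a := -(1 * f 1))
      (b := 0)]
    · ring
    · have h3 : Tendsto (fun t : ℝ => Real.exp (-t)) (𝓝[>] 0) (𝓝 1) :=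
        ((by fun_prop : Continuous fun t : ℝ => Real.exp (-t)).tendsto' 0 1 (by simp)).mono_left
          nhdsWithin_le_nhds
      exact (h3.mul (hp.initial f hf)).neg
    · have h3 : Tendsto (fun t : ℝ => Real.exp (-t) * C) atTop (𝓝 0) := by
        simpa using Real.tendsto_exp_neg_atTop_nhds_zero.mul_const C
      refine squeeze_zero_norm' ?_ h3
      filter_upwards [Ioi_mem_atTop 0] with t ht
      rw [norm_neg, norm_mul, Real.norm_of_nonneg (Real.exp_nonneg _)]
      exact mul_le_mul_of_nonneg_left (hp.abs_integral_mul_le hC ht) (Real.exp_nonneg _)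

end IsSubellipticHeatKernel

/-! ### Uniqueness of the Green function off the pole. -/

namespace IsGreenFunction

open SU2

variable {ν : Measure SU2} {G H : SU2 → ℝ}

/-- The difference annihilates the range of -L + 1. On monomials this operator is triangular with
diagonal entries 1 + eigenvalue ≠ 0, so induction on i kills every moment. -/
theorem moment_sub_eq_zero (hG : IsGreenFunction ν G) (hH : IsGreenFunction ν H) (i j k : ℕ) :
    ∫ g, ((G g - H g : ℝ) : ℂ) * monomial i j k g ∂ν = 0 := by
  set D : SU2 → ℝ := fun g => G g - H g with hD
  have hDi : Integrable D ν := hG.integrable.sub hH.integrable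
  have hmul : ∀ f : SU2 → ℂ, Continuous f → Integrable (fun g => (D g : ℂ) * f g) ν := fun f hf =>
    Integrable.mul_continuous hDi.ofReal hf
  have hmulr : ∀ f : SU2 → ℝ, Continuous f → ∀ K : SU2 → ℝ, Integrable K ν →
      Integrable (fun g => K g * f g) ν := by
    intro f hf K hK
    obtain ⟨C, hC⟩ := isCompact_univ.exists_bound_of_continuousOn hf.continuousOn
    exact hK.mul_bdd hf.aestronglyMeasurable (ae_of_all _ fun g => hC g (mem_univ g))
  have hzero : ∀ f : SU2 → ℝ, IsSmoothSU2 f → ∫ g, D g * (-subLaplacian f g + f g) ∂ν = 0 := by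
    intro f hf
    have hc : Continuous fun g => -subLaplacian f g + f g :=
      hf.subLaplacian.continuous.neg.add hf.continuous
    simp only [hD, sub_mul]
    rw [integral_sub (hmulr _ hc _ hG.integrable) (hmulr _ hc _ hH.integrable),
      hG.fundamental f hf, hH.fundamental f hf, sub_self]
  have hrec : ∀ i j k : ℕ,
      (1 + (2 * (i + j + k) + 4 * i * k + 4 * i * j) : ℂ) * (∫ g, (D g : ℂ) * monomial i j k g ∂ν) =
        4 * i * j * ∫ g, (D g : ℂ) * monomial (i - 1) (j - 1) k g ∂ν := by
    intro i j k
    set N : SU2 → ℂ := fun g => (1 + (2 * (i + j + k) + 4 * i * k + 4 * i * j) : ℂ) *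
      monomial i j k g - 4 * i * j * monomial (i - 1) (j - 1) k g with hN
    have hNc : Continuous N := by
      have h1 := continuous_monomial i j k
      have h2 := continuous_monomial (i - 1) (j - 1) k
      fun_prop
    have hφ : ∀ φ : ℂ →L[ℝ] ℝ, φ (∫ g, (D g : ℂ) * N g ∂ν) = 0 := by
      intro φ
      rw [← φ.integral_comp_comm (hmul N hNc), ← hzero _ (smooth_monomial φ i j k)]
      refine integral_congr_ae (ae_of_all _ fun g => ?_)
      simp only [subLaplacian_monomial]
      rw [← Complex.real_smul, map_smul, smul_eq_mul, ← map_neg, ← map_add]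
      congr 2
      simp only [hN]
      ring
    have h0 : ∫ g, (D g : ℂ) * N g ∂ν = 0 :=
      Complex.ext (hφ Complex.reCLM) (hφ Complex.imCLM)
    rw [← sub_eq_zero, ← integral_const_mul, ← integral_const_mul, ← integral_sub
      ((hmul _ (continuous_monomial _ _ _)).const_mul _)
      ((hmul _ (continuous_monomial _ _ _)).const_mul _), ← h0]
    refine integral_congr_ae (ae_of_all _ fun g => ?_)
    simp only [hN]
    ring
  have hne : ∀ i j k : ℕ, (1 + (2 * (i + j + k) + 4 * i * k + 4 * i * j) : ℂ) ≠ 0 := by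
    intro i j k
    exact_mod_cast (by positivity : 1 + (2 * (i + j + k) + 4 * i * k + 4 * i * j) ≠ 0)
  induction i generalizing j with
  | zero => exact (mul_eq_zero.1 ((hrec 0 j k).trans (by simp))).resolve_left (hne _ _ _)
  | succ i ih =>
    have h := hrec (i + 1) j k
    rw [Nat.add_sub_cancel, ih (j - 1), mul_zero] at h
    exact (mul_eq_zero.1 h).resolve_left (hne _ _ _)

variable [ν.IsHaarMeasure]

/-- Two Green functions agree off the pole. -/
theorem eq_of_ne (hG : IsGreenFunction ν G) (hH : IsGreenFunction ν H) {g : SU2} (hg : g ≠ 1) :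
    G g = H g := by
  have hc : ContinuousAt (fun g => ((G g - H g : ℝ) : ℂ)) g :=
    Complex.continuous_ofReal.continuousAt.comp
      (f := fun g => G g - H g) ((hG.continuousOn.sub hH.continuousOn).continuousAt
        (isOpen_compl_singleton.mem_nhds hg))
  have h0 := hG.moment_sub_eq_zero hH
  have h := eq_zero_of_moments_eq_zero (hG.integrable.sub hH.integrable).ofReal h0
    (fun i j k => by
      have := congrArg (starRingEnd ℂ) (h0 i j k)
      rw [← integral_conj] at this
      simpa using this) hc
  have h1 : ((G g - H g : ℝ) : ℂ) = 0 := h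
  exact sub_eq_zero.1 (by exact_mod_cast h1)

end IsGreenFunction

/-! ### Distance to the pole in cylindric coordinates. -/

section CylPoint

open SU2

variable {r z : ℝ}

/-- At the identity cos r cos z = 1; since cos r > 0, both cosines equal 1, and the coordinate
ranges force r = z = 0. -/
theorem cylPoint_ne_one (hr : r ∈ Ico 0 (Real.pi / 2)) (θ : ℝ) (hz : z ∈ Icc (-Real.pi) Real.pi)
    (h : (r, z) ≠ (0, 0)) : cylPoint r θ z ≠ 1 := by
  intro h1
  have h2 := congrArg Complex.re ((fst_eq_one_iff _).2 h1)
  rw [fst_cylPoint, Complex.re_ofReal_mul, Complex.exp_ofReal_mul_I_re, Complex.one_re] at h2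
  have hπ := Real.pi_pos
  have hr0 : 0 < Real.cos r := Real.cos_pos_of_mem_Ioo ⟨by linarith [hr.1], hr.2⟩
  have hr1 := Real.cos_le_one r
  have hz1 := Real.cos_le_one z
  have e1 : Real.cos r = 1 := by nlinarith
  have e2 : Real.cos z = 1 := by rwa [e1, one_mul] at h2
  have e3 := (Real.cos_eq_one_iff_of_lt_of_lt (by linarith [hr.1]) (by linarith [hr.2])).1 e1
  have e4 := (Real.cos_eq_one_iff_of_lt_of_lt (by linarith [hz.1]) (by linarith [hz.2])).1 e2
  exact h (by rw [e3, e4])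

theorem norm_one_sub_fst_cylPoint (r θ z : ℝ) : ‖1 - fst (cylPoint r θ z)‖ =
    √(1 - 2 * Real.cos r * Real.cos z + Real.cos r ^ 2) := by
  rw [fst_cylPoint, Complex.norm_def, Complex.normSq_apply, Complex.sub_re, Complex.sub_im,
    Complex.re_ofReal_mul, Complex.im_ofReal_mul, Complex.exp_ofReal_mul_I_re,
    Complex.exp_ofReal_mul_I_im, Complex.one_re, Complex.one_im]
  congr 1
  linear_combination Real.cos r ^ 2 * Real.sin_sq_add_cos_sq z

end CylPoint

end

/-! ### Assembly of the three formulas. -/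

theorem proposition3p6 (ν : Measure SU2) [ν.IsHaarMeasure] (p : ℝ → SU2 → ℝ)
    (hp : IsSubellipticHeatKernel ν p) :
    -- the Laplace transform
    (∀ lam : ℂ, 0 < lam.re → ∀ r ∈ Ico 0 (Real.pi / 2), ∀ θ : ℝ, ∀ z ∈ Icc (-Real.pi) Real.pi,
      IntegrableOn
        (fun t : ℝ => (p t (cylPoint r θ z) : ℂ) * Complex.exp (-t - lam / t)) (Ioi 0) ∧
      (∀ y : ℝ, laplaceDenom r z lam y ≠ 0) ∧
      Integrable (fun y : ℝ => 1 / (8 * (Real.pi : ℂ) ^ 2 * laplaceDenom r z lam y)) ∧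
      ∫ t in Ioi (0 : ℝ), (p t (cylPoint r θ z) : ℂ) * Complex.exp (-t - lam / t) =
        (2 * Real.pi ^ 2 / ν.real univ : ℝ) *
          ∫ y : ℝ, 1 / (8 * (Real.pi : ℂ) ^ 2 * laplaceDenom r z lam y)) ∧
    -- the contour integral formula, on the vertical line `lam = γ + i τ`, `d lam = i d τ`
    (∀ t : ℝ, 0 < t → ∀ r ∈ Ico 0 (Real.pi / 2), ∀ θ : ℝ, ∀ z ∈ Icc (-Real.pi) Real.pi, ∀ γ : ℝ, 0 < γ →
      Integrable (fun τ : ℝ => ∫ y : ℝ,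
        Complex.exp ((γ + τ * Complex.I) / t) / laplaceDenom r z (γ + τ * Complex.I) y) ∧
      (p t (cylPoint r θ z) : ℂ) =
        (2 * Real.pi ^ 2 / ν.real univ : ℝ) *
          (Complex.exp t / (16 * Complex.I * (Real.pi : ℂ) ^ 3 * (t : ℂ) ^ 2) *
            (Complex.I * ∫ τ : ℝ, ∫ y : ℝ,
              Complex.exp ((γ + τ * Complex.I) / t) /
                laplaceDenom r z (γ + τ * Complex.I) y))) ∧
    -- the Green function of `-L + 1`
    (∃ G : SU2 → ℝ, IsGreenFunction ν G) ∧
    (∀ G : SU2 → ℝ, IsGreenFunction ν G →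
      ∀ r ∈ Ico 0 (Real.pi / 2), ∀ θ : ℝ, ∀ z ∈ Icc (-Real.pi) Real.pi, (r, z) ≠ (0, 0) →
        G (cylPoint r θ z) = 2 * Real.pi ^ 2 / ν.real univ *
          (1 / (8 * Real.pi * √(1 - 2 * Real.cos r * Real.cos z + Real.cos r ^ 2))) ∧
        IntegrableOn (fun t : ℝ => Real.exp (-t) * p t (cylPoint r θ z)) (Ioi 0) ∧
        G (cylPoint r θ z) = ∫ t in Ioi (0 : ℝ), Real.exp (-t) * p t (cylPoint r θ z)) := by
  have hV := SU2.measureReal_univ_pos ν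
  have hVC : (ν.real univ : ℂ) ≠ 0 := Complex.ofReal_ne_zero.2 hV.ne'
  have hπC : (Real.pi : ℂ) ≠ 0 := Complex.ofReal_ne_zero.2 Real.pi_ne_zero
  have hfst := SU2.fst_cylPoint
  have hnorm : ∀ r θ z : ℝ, ‖(Real.cos r : ℂ) * Complex.exp (z * Complex.I)‖ ≤ 1 := fun r θ z =>
    hfst r θ z ▸ SU2.norm_fst_le _
  have hgreen : ∀ r ∈ Ico 0 (Real.pi / 2), ∀ θ : ℝ, ∀ z ∈ Icc (-Real.pi) Real.pi,
      (r, z) ≠ (0, 0) → ∫ t in Ioi (0 : ℝ), Real.exp (-t) * p t (cylPoint r θ z) =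
        2 * Real.pi ^ 2 / ν.real univ *
          (1 / (8 * Real.pi * √(1 - 2 * Real.cos r * Real.cos z + Real.cos r ^ 2))) := by
    intro r hr θ z hz h
    have hne := cylPoint_ne_one hr θ hz h
    rw [(hp.integrableOn_exp_mul hne).2, norm_one_sub_fst_cylPoint]
    have h0 : ‖1 - SU2.fst (cylPoint r θ z)‖ ≠ 0 := norm_ne_zero_iff.2
      (sub_ne_zero.2 fun h => hne ((SU2.fst_eq_one_iff _).1 h.symm))
    rw [norm_one_sub_fst_cylPoint] at h0
    field_simp
    norm_num
  refine ⟨fun lam h r _ θ z _ => ?_, fun t ht r _ θ z _ γ hγ => ?_, ⟨_, hp.isGreenFunction⟩,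
    fun G hG r hr θ z hz h => ?_⟩
  · obtain ⟨h1, h2⟩ := hp.integrableOn_mul_exp h (cylPoint r θ z)
    have e : ∀ y : ℝ, 1 / (8 * (Real.pi : ℂ) ^ 2 * laplaceDenom r z lam y) =
        1 / (8 * (Real.pi : ℂ) ^ 2) * (resolventDenom (SU2.fst (cylPoint r θ z)) lam y)⁻¹ := by
      intro y
      rw [laplaceDenom_eq, hfst, one_div, mul_inv, one_div]
    simp_rw [e]
    refine ⟨h1, fun y => ?_, (integrable_inv_resolventDenom (SU2.norm_fst_le _) h).const_mul _, ?_⟩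
    · rw [laplaceDenom_eq]
      exact resolventDenom_ne_zero (hnorm r θ z) h y
    · rw [h2, integral_const_mul, ← mul_assoc]
      congr 1
      push_cast
      field_simp
      norm_num
  · simp_rw [laplaceDenom_eq]
    have hc : ContinuousOn (fun t => heatSeries t (SU2.fst (cylPoint r θ z))) (Ioi 0) := by
      have h1 : ContinuousOn (fun t => (ν.real univ : ℂ) * p t (cylPoint r θ z)) (Ioi 0) :=
        continuousOn_const.mul
          (Complex.continuous_ofReal.comp_continuousOn (hp.continuousOn_time (cylPoint r θ z)))
      exact h1.congr fun t ht => hp.heatSeries_eq ht _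
    have h := heatSeries_eq_integral (SU2.norm_fst_le (cylPoint r θ z)) hc hγ ht
    rw [hp.heatSeries_eq ht, hfst] at h
    refine ⟨h.1, ?_⟩
    -- After multiplying by the total mass V, the two prefactors agree since 2π²/(16π³) = 1/(8π) and
    -- the factors of the imaginary unit cancel.
    rw [← mul_right_inj' hVC, h.2]
    have htC : (t : ℂ) ≠ 0 := Complex.ofReal_ne_zero.2 ht.ne'
    generalize (∫ τ : ℝ, ∫ y : ℝ, Complex.exp ((γ + τ * Complex.I) / t) / resolventDenom
      (Real.cos r * Complex.exp (z * Complex.I)) (γ + τ * Complex.I) y) = J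
    push_cast
    field_simp [Complex.I_ne_zero]
    ring
  · have hne := cylPoint_ne_one hr θ hz h
    have h1 := hG.eq_of_ne hp.isGreenFunction hne
    exact ⟨h1.trans (hgreen r hr θ z hz h), (hp.integrableOn_exp_mul hne).1, h1⟩
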